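/- Let $K$ be a field. **Posets.** A double poset is a finite set with two partial orders $\leq_h,\leq_r$. It is plane if any two distinct elements are comparable for exactly one of the two orders. It is WN if it is plane and has no double subposet isomorphic to one of the two plane posets on $\{a,b,c,d\}$ whose strict relations are $a<_hc,\ a<_hd,\ b<_hd,\ a<_rb,\ c<_rb,\ c<_rd$, respectively $a<_hc,\ b<_hc,\ b<_hd,\ a<_rb,\ a<_rd,\ c<_rd$. It is $h$-connected if it is nonempty and any two elements are joined by a path of $\leq_h$-comparable elements. Let $H_{WNP}$ be the vector space with basis the isomorphism classes of WN posets. For WN posets $P,Q$, let $PQ$ be the disjoint union of $P$ and $Q$ (with their orders), where $x\leq_r y$ and $x,y$ are not $\leq_h$-comparable for all $x\in P$, $y\in Q$; let $$P\star Q=\sum_{R} n(P,Q;R)\,R,\qquad \Delta(P)=\sum_{QR=P}Q\otimes R,$$ where $R$ in the first sum runs over WN posets and $n(P,Q;R)$ is the number of subsets $I\subseteq R$, closed upwards for $\leq_h$, with $R\setminus I\cong P$ and $I\cong Q$, and the second sum runs over the pairs of isomorphism classes $(Q,R)$ with $QR=P$. Extend these linearly; the unit $1$ is the empty poset. Let $\mathrm{Prim}(H_{WNP})=\{x\in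 H_{WNP} : \Delta(x)=x\otimes 1+1\otimes x\}$. **$B_\infty$-algebras.** For a vector space $V$, let $T(V)$ be the tensor coalgebra with the deconcatenation coproduct, and $\pi_V:T(V)\to V$ the canonical projection. A $B_\infty$-algebra is a vector space $V$ with linear maps $[-;-]_{m,n}:V^{\otimes m}\otimes V^{\otimes n}\to V$ $(m,n\geq 1)$ such that there is a coalgebra morphism $\star_V:T(V)\otimes T(V)\to T(V)$ with $\pi_V\big((x_1\cdots x_m)\star_V(y_1\cdots y_n)\big)=[x_1,\dots,x_m;y_1,\dots,y_n]_{m,n}$ for all $m,n\geq 1$ which makes $T(V)$ a Hopf algebra with unit the empty word. A morphism of $B_\infty$-algebras is a linear map that commutes with all the maps $[-;-]_{m,n}$. **Theorem.** 1. $\mathrm{Prim}(H_{WNP})$ is the span of the $h$-connected WN posets. 2. Let $\pi:H_{WNP}\to \mathrm{Prim}(H_{WNP})$ be the linear projection that fixes the $h$-connected WN posets and kills the other ones. Then the maps $$[P_1,\dots,P_m;Q_1,\dots,Q_n]_{m,n}=\pi\big((P_1\cdots P_m)\star(Q_1\cdots Q_n)\big)\qquad (m,n\geq 1)$$ make $\mathrm{Prim}(H_{WNP})$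 a $B_\infty$-algebra. 3. It is the free $B_\infty$-algebra on the one-point poset $\bullet$: for any $B_\infty$-algebra $B$ over $K$ and any $x\in B$, there is a unique morphism of $B_\infty$-algebras $\phi:\mathrm{Prim}(H_{WNP})\to B$ with $\phi(\bullet)=x$. -/

import Mathlib

open scoped TensorProduct

namespace BInf

/-! ### The tensor coalgebra -/

/-- Auxiliary operator for the deconcatenation coproduct: the vector `v` acts on pairs `(t, w)`
by `v · (t, w) = ((v ⊗ 1) t + 1 ⊗ v w, v w)`. -/
noncomputable def deconcAux (K V : Type*) [Field K] [AddCommGroup V] [Module K V] :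
    V →ₗ[K] Module.End K
      ((TensorAlgebra K V ⊗[K] TensorAlgebra K V) × TensorAlgebra K V) :=
  LinearMap.mk₂ K
    (fun v p => ((TensorAlgebra.ι K v ⊗ₜ[K] 1) * p.1 + 1 ⊗ₜ[K] (TensorAlgebra.ι K v * p.2),
      TensorAlgebra.ι K v * p.2))
    (fun v v' p => by
      simp only [map_add, TensorProduct.add_tmul, TensorProduct.tmul_add, add_mul, Prod.mk_add_mk]
      abel_nf)
    (fun c v p => by
      simp only [map_smul, Prod.smul_mk, smul_add, smul_mul_assoc, TensorProduct.tmul_smul,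
        ← TensorProduct.smul_tmul'])
    (fun v p q => by
      simp only [Prod.fst_add, Prod.snd_add, mul_add, TensorProduct.tmul_add, Prod.mk_add_mk]
      abel_nf)
    (fun c v p => by
      simp only [Prod.smul_fst, Prod.smul_snd, mul_smul_comm, TensorProduct.tmul_smul,
        Prod.smul_mk, smul_add])

theorem deconcAux_apply {K V : Type*} [Field K] [AddCommGroup V] [Module K V] (v : V)
    (p : (TensorAlgebra K V ⊗[K] TensorAlgebra K V) × TensorAlgebra K V) :
    deconcAux K V v p =
      ((TensorAlgebra.ι K v ⊗ₜ[K] 1) * p.1 + 1 ⊗ₜ[K] (TensorAlgebra.ι K v * p.2),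
        TensorAlgebra.ι K v * p.2) := rfl

/-- The deconcatenation coproduct of `T(V)`; see `deconc_word` for the usual formula
`Δ(v₁ ⋯ vₙ) = ∑ᵢ v₁ ⋯ vᵢ ⊗ vᵢ₊₁ ⋯ vₙ`. -/
noncomputable def deconc (K V : Type*) [Field K] [AddCommGroup V] [Module K V] :
    TensorAlgebra K V →ₗ[K] TensorAlgebra K V ⊗[K] TensorAlgebra K V :=
  LinearMap.fst K _ _ ∘ₗ LinearMap.applyₗ (1, 1) ∘ₗ
    (TensorAlgebra.lift K (deconcAux K V)).toLinearMap

theorem lift_deconcAux_snd {K V : Type*} [Field K] [AddCommGroup V] [Module K V]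
    (w : TensorAlgebra K V) :
    ∀ p, (TensorAlgebra.lift K (deconcAux K V) w p).2 = w * p.2 := by
  induction w using TensorAlgebra.induction with
  | algebraMap r => intro p; simp [Algebra.smul_def]
  | ι x => intro p; simp [deconcAux_apply]
  | mul a b ha hb => intro p; simp [ha, hb, mul_assoc]
  | add a b ha hb => intro p; simp [ha, hb, add_mul]

theorem deconc_one (K V : Type*) [Field K] [AddCommGroup V] [Module K V] :
    deconc K V 1 = 1 ⊗ₜ 1 := by
  simp [deconc, Algebra.TensorProduct.one_def]

theorem deconc_ι_mul {K V : Type*} [Field K] [AddCommGroup V] [Module K V]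
    (v : V) (w : TensorAlgebra K V) :
    deconc K V (TensorAlgebra.ι K v * w) =
      (TensorAlgebra.ι K v ⊗ₜ 1) * deconc K V w + 1 ⊗ₜ (TensorAlgebra.ι K v * w) := by
  have h := lift_deconcAux_snd w ((1, 1) : _ × TensorAlgebra K V)
  simp only [mul_one] at h
  simp only [deconc, LinearMap.comp_apply, AlgHom.toLinearMap_apply, map_mul,
    TensorAlgebra.lift_ι_apply, LinearMap.applyₗ_apply_apply, Module.End.mul_apply,
    LinearMap.fst_apply]
  simp [deconcAux_apply, h]

/-- Deconcatenation of words. -/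
theorem deconc_word {K V : Type*} [Field K] [AddCommGroup V] [Module K V] (l : List V) :
    deconc K V (l.map (TensorAlgebra.ι K)).prod =
      ∑ i ∈ Finset.range (l.length + 1),
        ((l.take i).map (TensorAlgebra.ι K)).prod ⊗ₜ[K]
          ((l.drop i).map (TensorAlgebra.ι K)).prod := by
  induction l with
  | nil => simp [deconc_one]
  | cons v l ih =>
    rw [List.map_cons, List.prod_cons, deconc_ι_mul, ih, Finset.mul_sum, List.length_cons,
      Finset.sum_range_succ' _ (l.length + 1)]
    simp

/-- Linear maps on `T(V)` can be compared letter by letter. -/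
theorem tensorAlgebra_left_induction {K V : Type*} [Field K] [AddCommGroup V] [Module K V]
    {C : TensorAlgebra K V → Prop} (one : C 1)
    (cons : ∀ v w, C w → C (TensorAlgebra.ι K v * w))
    (add : ∀ a b, C a → C b → C (a + b)) (smul : ∀ (r : K) a, C a → C (r • a))
    (a : TensorAlgebra K V) : C a := by
  have key : ∀ b, C b → C (a * b) := by
    induction a using TensorAlgebra.induction with
    | algebraMap r => intro b hb; rw [← Algebra.smul_def]; exact smul r b hb
    | ι x => intro b hb; exact cons x b hb
    | mul a b ha hb => intro c hc; rw [mul_assoc]; exact ha _ (hb _ hc)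
    | add a b ha hb => intro c hc; rw [add_mul]; exact add _ _ (ha _ hc) (hb _ hc)
  simpa using key 1 one

/-- The tensor coalgebra: `T(V)` with the deconcatenation coproduct and the counit that is the
projection on the degree zero part. -/
noncomputable instance tensorCoalgebra (K V : Type*) [Field K] [AddCommGroup V] [Module K V] :
    Coalgebra K (TensorAlgebra K V) where
  comul := deconc K V
  counit := TensorAlgebra.algebraMapInv.toLinearMap
  coassoc := by
    ext a
    simp only [LinearMap.comp_apply, LinearEquiv.coe_coe]
    induction a using tensorAlgebra_left_induction with
    | one => simp [deconc_one]
    | add a b ha hb => simp only [map_add, ha, hb]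
    | smul r a ha => simp only [map_smul, ha]
    | cons v w ih =>
      have h1 : ∀ t : TensorAlgebra K V ⊗[K] TensorAlgebra K V,
          TensorProduct.assoc K _ _ _ ((deconc K V).rTensor _ ((TensorAlgebra.ι K v ⊗ₜ 1) * t)) =
            (TensorAlgebra.ι K v ⊗ₜ 1) *
              TensorProduct.assoc K _ _ _ ((deconc K V).rTensor _ t) +
            1 ⊗ₜ ((TensorAlgebra.ι K v ⊗ₜ 1) * t) := by
        intro t
        induction t with
        | zero => simp
        | add x y hx hy => simp only [mul_add, map_add, hx, hy, TensorProduct.tmul_add]; abel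
        | tmul x y =>
          simp only [Algebra.TensorProduct.tmul_mul_tmul, one_mul, LinearMap.rTensor_tmul,
            deconc_ι_mul, TensorProduct.add_tmul, map_add, TensorProduct.assoc_tmul]
          congr 1
          induction deconc K V x with
          | zero => simp
          | add a b ha hb => simp only [mul_add, map_add, TensorProduct.add_tmul, ha, hb]
          | tmul a b => simp
      have h2 : ∀ t : TensorAlgebra K V ⊗[K] TensorAlgebra K V,
          (deconc K V).lTensor _ ((TensorAlgebra.ι K v ⊗ₜ 1) * t) =
            (TensorAlgebra.ι K v ⊗ₜ 1) * (deconc K V).lTensor _ t := by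
        intro t
        induction t with
        | zero => simp
        | add x y hx hy => simp only [mul_add, map_add, hx, hy]
        | tmul x y => simp
      rw [deconc_ι_mul, map_add, map_add, map_add, h1, h2, ih]
      simp [deconc_one, deconc_ι_mul, TensorProduct.tmul_add, add_assoc]
  rTensor_counit_comp_comul := by
    ext a
    simp only [LinearMap.comp_apply, TensorProduct.mk_apply]
    induction a using tensorAlgebra_left_induction with
    | one => simp [deconc_one]
    | add a b ha hb => simp only [map_add, ha, hb, TensorProduct.tmul_add]
    | smul r a ha => simp only [map_smul, ha, TensorProduct.tmul_smul]
    | cons v w ih =>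
      rw [deconc_ι_mul, map_add]
      have h : ∀ t : TensorAlgebra K V ⊗[K] TensorAlgebra K V,
          (TensorAlgebra.algebraMapInv.toLinearMap : TensorAlgebra K V →ₗ[K] K).rTensor _
            ((TensorAlgebra.ι K v ⊗ₜ 1) * t) = 0 := by
        intro t
        induction t with
        | zero => simp
        | add x y hx hy => simp only [mul_add, map_add, hx, hy, add_zero]
        | tmul x y => simp [TensorAlgebra.algebraMapInv]
      rw [h]
      simp
  lTensor_counit_comp_comul := by
    ext a
    simp only [LinearMap.comp_apply, LinearMap.flip_apply, TensorProduct.mk_apply]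
    induction a using tensorAlgebra_left_induction with
    | one => simp [deconc_one]
    | add a b ha hb => simp only [map_add, ha, hb, TensorProduct.add_tmul]
    | smul r a ha => simp only [map_smul, ha, TensorProduct.smul_tmul']
    | cons v w ih =>
      rw [deconc_ι_mul, map_add]
      have h : ∀ t : TensorAlgebra K V ⊗[K] TensorAlgebra K V,
          (TensorAlgebra.algebraMapInv.toLinearMap : TensorAlgebra K V →ₗ[K] K).lTensor _
            ((TensorAlgebra.ι K v ⊗ₜ 1) * t) =
          (TensorAlgebra.ι K v ⊗ₜ 1) * (TensorAlgebra.algebraMapInv.toLinearMap :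
            TensorAlgebra K V →ₗ[K] K).lTensor _ t := by
        intro t
        induction t with
        | zero => simp
        | add x y hx hy => simp only [mul_add, map_add, hx, hy]
        | tmul x y => simp
      rw [h, ih]
      simp [TensorAlgebra.algebraMapInv]

/-! ### `B_∞`-algebras -/

/-- A coalgebra morphism `⋆ : T(V) ⊗ T(V) → T(V)` makes the tensor coalgebra `T(V)` a Hopf algebra
with unit the empty word. -/
structure IsHopfProduct {K V : Type*} [Field K] [AddCommGroup V] [Module K V]
    (star : TensorAlgebra K V ⊗[K] TensorAlgebra K V →ₗc[K] TensorAlgebra K V) : Prop where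
  one_star : ∀ x, star (1 ⊗ₜ x) = x
  star_one : ∀ x, star (x ⊗ₜ 1) = x
  star_assoc : ∀ x y z, star (star (x ⊗ₜ y) ⊗ₜ z) = star (x ⊗ₜ star (y ⊗ₜ z))
  exists_antipode : ∃ S : TensorAlgebra K V →ₗ[K] TensorAlgebra K V, ∀ x,
    star (S.rTensor _ (Coalgebra.comul (R := K) x)) =
        algebraMap K _ (Coalgebra.counit (R := K) x) ∧
      star (S.lTensor _ (Coalgebra.comul (R := K) x)) =
        algebraMap K _ (Coalgebra.counit (R := K) x)

/-- Families of linear maps `V^{⊗ m} ⊗ V^{⊗ n} → V` for `m, n ≥ 1`. -/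
abbrev Brackets (K V : Type*) [Field K] [AddCommGroup V] [Module K V] :=
  ∀ m n : ℕ+, (⨂[K]^(m : ℕ) V) ⊗[K] (⨂[K]^(n : ℕ) V) →ₗ[K] V

/-- The family of brackets `br` is a `B_∞`-algebra structure on `V`: the coalgebra morphism
`⋆ : T(V) ⊗ T(V) → T(V)` with `π((x₁ ⋯ xₘ) ⋆ (y₁ ⋯ yₙ)) = br(x₁, …, xₘ; y₁, …, yₙ)` for
`m, n ≥ 1`, where `π` (`TensorAlgebra.ιInv`) is the projection on `V`, makes `T(V)` a Hopf
algebra. -/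
def IsBInfty {K V : Type*} [Field K] [AddCommGroup V] [Module K V] (br : Brackets K V) : Prop :=
  ∃ star : TensorAlgebra K V ⊗[K] TensorAlgebra K V →ₗc[K] TensorAlgebra K V,
    IsHopfProduct star ∧
    ∀ (m n : ℕ+) (x : Fin m → V) (y : Fin n → V),
      TensorAlgebra.ιInv (star (TensorAlgebra.tprod K V m x ⊗ₜ TensorAlgebra.tprod K V n y)) =
        br m n (PiTensorProduct.tprod K x ⊗ₜ PiTensorProduct.tprod K y)

/-- Morphisms of `B_∞`-algebras: linear maps that commute with all brackets. -/
def IsBInftyHom {K V W : Type*} [Field K] [AddCommGroup V] [Module K V] [AddCommGroup W]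
    [Module K W] (brV : Brackets K V) (brW : Brackets K W) (φ : V →ₗ[K] W) : Prop :=
  ∀ (m n : ℕ+) (x : Fin m → V) (y : Fin n → V),
    φ (brV m n (PiTensorProduct.tprod K x ⊗ₜ PiTensorProduct.tprod K y)) =
      brW m n (PiTensorProduct.tprod K (fun i => φ (x i)) ⊗ₜ
        PiTensorProduct.tprod K (fun j => φ (y j)))

/-! ### Double posets, plane posets, WN posets -/

/-- A double poset: a finite set with two partial orders `le₁` (written `≤_h` for plane posets)
and `le₂` (written `≤_r`). -/
structure DoublePoset : Type 1 where
  carrier : Type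
  finite : Finite carrier
  le₁ : carrier → carrier → Prop
  le₂ : carrier → carrier → Prop
  po₁ : IsPartialOrder carrier le₁
  po₂ : IsPartialOrder carrier le₂

namespace DoublePoset

/-- Two double posets are isomorphic. -/
def Iso (P Q : DoublePoset) : Prop :=
  ∃ e : P.carrier ≃ Q.carrier, ∀ x y,
    (P.le₁ x y ↔ Q.le₁ (e x) (e y)) ∧ (P.le₂ x y ↔ Q.le₂ (e x) (e y))

theorem Iso.refl (P : DoublePoset) : Iso P P := ⟨Equiv.refl _, fun _ _ => ⟨Iff.rfl, Iff.rfl⟩⟩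

theorem Iso.symm {P Q : DoublePoset} : Iso P Q → Iso Q P := fun ⟨e, he⟩ =>
  ⟨e.symm, fun x y => by
    have h := he (e.symm x) (e.symm y)
    simp only [Equiv.apply_symm_apply] at h
    exact ⟨h.1.symm, h.2.symm⟩⟩

theorem Iso.trans {P Q R : DoublePoset} : Iso P Q → Iso Q R → Iso P R := fun ⟨e, he⟩ ⟨f, hf⟩ =>
  ⟨e.trans f, fun x y => ⟨(he x y).1.trans (hf _ _).1, (he x y).2.trans (hf _ _).2⟩⟩

/-- The double subposet of `P` on the subset `I`. -/
def restrict (P : DoublePoset) (I : Set P.carrier) : DoublePoset where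
  carrier := I
  finite := haveI := P.finite; inferInstance
  le₁ x y := P.le₁ x y
  le₂ x y := P.le₂ x y
  po₁ := haveI := P.po₁
    { refl := fun x => refl_of P.le₁ (x : P.carrier)
      trans := fun _ _ _ h h' => trans_of P.le₁ h h'
      antisymm := fun _ _ h h' => Subtype.ext (antisymm_of P.le₁ h h') }
  po₂ := haveI := P.po₂
    { refl := fun x => refl_of P.le₂ (x : P.carrier)
      trans := fun _ _ _ h h' => trans_of P.le₂ h h'
      antisymm := fun _ _ h h' => Subtype.ext (antisymm_of P.le₂ h h') }

/-- The product `P · Q`: the disjoint union of `P` and `Q`, where `x ≤₂ y` and `x, y` are not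
comparable for `≤₁` whenever `x ∈ P` and `y ∈ Q`. -/
def prod (P Q : DoublePoset) : DoublePoset where
  carrier := P.carrier ⊕ Q.carrier
  finite := haveI := P.finite; haveI := Q.finite; inferInstance
  le₁ := Sum.LiftRel P.le₁ Q.le₁
  le₂ := Sum.Lex P.le₂ Q.le₂
  po₁ := haveI := P.po₁; haveI := Q.po₁; { }
  po₂ := haveI := P.po₂; haveI := Q.po₂; { }

/-- The empty double poset. -/
def empty : DoublePoset where
  carrier := Empty
  finite := inferInstance
  le₁ _ _ := True
  le₂ _ _ := True
  po₁ := { refl := fun x => x.elim, trans := fun x => x.elim, antisymm := fun x => x.elim }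
  po₂ := { refl := fun x => x.elim, trans := fun x => x.elim, antisymm := fun x => x.elim }

/-- The double poset with one element. -/
def point : DoublePoset where
  carrier := Unit
  finite := inferInstance
  le₁ _ _ := True
  le₂ _ _ := True
  po₁ := { refl := fun _ => trivial, trans := fun _ _ _ _ _ => trivial,
           antisymm := fun _ _ _ _ => rfl }
  po₂ := { refl := fun _ => trivial, trans := fun _ _ _ _ _ => trivial,
           antisymm := fun _ _ _ _ => rfl }

/-- A double poset is plane if any two distinct elements are comparable for exactly one of the
two orders. -/
def IsPlane (P : DoublePoset) : Prop :=
  ∀ x y, x ≠ y → ((P.le₁ x y ∨ P.le₁ y x) ↔ ¬ (P.le₂ x y ∨ P.le₂ y x))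

/-- `P` has a double subposet isomorphic to `Q`. -/
def Contains (P Q : DoublePoset) : Prop := ∃ I : Set P.carrier, Iso Q (P.restrict I)

/-- The reflexive relation on `Fin 4` given by a list of pairs. -/
def listRel (l : List (Fin 4 × Fin 4)) (x y : Fin 4) : Prop := x = y ∨ (x, y) ∈ l

instance (l : List (Fin 4 × Fin 4)) : DecidableRel (listRel l) := fun _ _ => instDecidableOr

/-- The first plane poset of shape N, on the vertices `0, 1, 2, 3`: `0 <_h 2`, `0 <_h 3`,
`1 <_h 3` and `0 <_r 1`, `2 <_r 1`, `2 <_r 3`. -/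
def posetN : DoublePoset where
  carrier := Fin 4
  finite := inferInstance
  le₁ := listRel [(0, 2), (0, 3), (1, 3)]
  le₂ := listRel [(0, 1), (2, 1), (2, 3)]
  po₁ := { refl := by decide, trans := by decide, antisymm := by decide }
  po₂ := { refl := by decide, trans := by decide, antisymm := by decide }

/-- The second plane poset of shape N, on the vertices `0, 1, 2, 3`: `0 <_h 2`, `1 <_h 2`,
`1 <_h 3` and `0 <_r 1`, `0 <_r 3`, `2 <_r 3`. -/
def posetN' : DoublePoset where
  carrier := Fin 4
  finite := inferInstance
  le₁ := listRel [(0, 2), (1, 2), (1, 3)]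
  le₂ := listRel [(0, 1), (0, 3), (2, 3)]
  po₁ := { refl := by decide, trans := by decide, antisymm := by decide }
  po₂ := { refl := by decide, trans := by decide, antisymm := by decide }

/-- WN ("without N") posets. -/
def IsWN (P : DoublePoset) : Prop :=
  P.IsPlane ∧ ¬ P.Contains posetN ∧ ¬ P.Contains posetN'

/-- `P` is `h`-connected: it is nonempty and any two elements are joined by a path of
`≤₁`-comparable elements. -/
def HConnected (P : DoublePoset) : Prop :=
  Nonempty P.carrier ∧ ∀ x y, Relation.ReflTransGen (fun a b => P.le₁ a b ∨ P.le₁ b a) x y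

/-- Ideals are the subsets that are closed upwards for `≤₁`. -/
def IsIdeal (P : DoublePoset) (I : Set P.carrier) : Prop :=
  ∀ x ∈ I, ∀ y, P.le₁ x y → y ∈ I

theorem prod_congr {P P' Q Q' : DoublePoset} : Iso P P' → Iso Q Q' →
    Iso (P.prod Q) (P'.prod Q') := fun ⟨e, he⟩ ⟨f, hf⟩ => by
  have key : ∀ x y : P.carrier ⊕ Q.carrier,
      (Sum.LiftRel P.le₁ Q.le₁ x y ↔ Sum.LiftRel P'.le₁ Q'.le₁ (Sum.map e f x) (Sum.map e f y)) ∧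
      (Sum.Lex P.le₂ Q.le₂ x y ↔ Sum.Lex P'.le₂ Q'.le₂ (Sum.map e f x) (Sum.map e f y)) := by
    rintro (x | x) (y | y)
    · simpa using he x y
    · simp
    · simp
    · simpa using hf x y
  exact ⟨Equiv.sumCongr e f, key⟩

theorem prod_assoc (P Q R : DoublePoset) : Iso ((P.prod Q).prod R) (P.prod (Q.prod R)) := by
  let e := Equiv.sumAssoc P.carrier Q.carrier R.carrier
  have key : ∀ x y : (P.carrier ⊕ Q.carrier) ⊕ R.carrier,
      (Sum.LiftRel (Sum.LiftRel P.le₁ Q.le₁) R.le₁ x y ↔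
        Sum.LiftRel P.le₁ (Sum.LiftRel Q.le₁ R.le₁) (e x) (e y)) ∧
      (Sum.Lex (Sum.Lex P.le₂ Q.le₂) R.le₂ x y ↔
        Sum.Lex P.le₂ (Sum.Lex Q.le₂ R.le₂) (e x) (e y)) := by
    rintro ((x | x) | x) ((y | y) | y) <;> simp [e]
  exact ⟨e, key⟩

theorem empty_prod (P : DoublePoset) : Iso (empty.prod P) P := by
  let e := Equiv.emptySum Empty P.carrier
  have key : ∀ x y : Empty ⊕ P.carrier,
      (Sum.LiftRel (fun _ _ => True) P.le₁ x y ↔ P.le₁ (e x) (e y)) ∧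
      (Sum.Lex (fun _ _ => True) P.le₂ x y ↔ P.le₂ (e x) (e y)) := by
    rintro (x | x) (y | y)
    · exact x.elim
    · exact x.elim
    · exact y.elim
    · simp [e]
  exact ⟨e, key⟩

theorem prod_empty (P : DoublePoset) : Iso (P.prod empty) P := by
  let e := Equiv.sumEmpty P.carrier Empty
  have key : ∀ x y : P.carrier ⊕ Empty,
      (Sum.LiftRel P.le₁ (fun _ _ => True) x y ↔ P.le₁ (e x) (e y)) ∧
      (Sum.Lex P.le₂ (fun _ _ => True) x y ↔ P.le₂ (e x) (e y)) := by
    rintro (x | x) (y | y)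
    · simp [e]
    · exact y.elim
    · exact x.elim
    · exact x.elim
  exact ⟨e, key⟩

theorem iso_empty (P : DoublePoset) (h : IsEmpty P.carrier) : Iso P empty :=
  ⟨Equiv.equivOfIsEmpty P.carrier Empty, fun x => h.elim x⟩

theorem Iso.hConnected {P Q : DoublePoset} : Iso P Q → P.HConnected → Q.HConnected := by
  rintro ⟨e, he⟩ ⟨⟨x₀⟩, h⟩
  refine ⟨⟨e x₀⟩, fun x y => ?_⟩
  have key : ∀ a b, Relation.ReflTransGen (fun a b => P.le₁ a b ∨ P.le₁ b a) a b →
      Relation.ReflTransGen (fun a b => Q.le₁ a b ∨ Q.le₁ b a) (e a) (e b) := by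
    intro a b hab
    induction hab with
    | refl => exact .refl
    | tail _ h ih =>
      rw [(he _ _).1, (he _ _).1] at h
      exact ih.tail h
  simpa using key _ _ (h (e.symm x) (e.symm y))

/-- A product of two nonempty double posets is not `h`-connected. -/
theorem not_hConnected_prod {P Q : DoublePoset} (x : P.carrier) (y : Q.carrier) :
    ¬ (P.prod Q).HConnected := by
  rintro ⟨-, h⟩
  have key : ∀ z : (P.prod Q).carrier, Relation.ReflTransGen
      (fun a b => (P.prod Q).le₁ a b ∨ (P.prod Q).le₁ b a) (Sum.inl x) z →
        ∃ p : P.carrier, z = Sum.inl p := by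
    intro z hz
    induction hz with
    | refl => exact ⟨x, rfl⟩
    | @tail b c _ hbc ih =>
      obtain ⟨p, rfl⟩ := ih
      rcases c with c | c
      · exact ⟨c, rfl⟩
      · simp [prod] at hbc
  obtain ⟨p, hp⟩ := key _ (h (Sum.inl x) (Sum.inr y))
  cases hp

theorem contains_iff {P Q : DoublePoset} : P.Contains Q ↔
    ∃ f : Q.carrier → P.carrier, Function.Injective f ∧ ∀ x y,
      (Q.le₁ x y ↔ P.le₁ (f x) (f y)) ∧ (Q.le₂ x y ↔ P.le₂ (f x) (f y)) := by
  constructor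
  · rintro ⟨I, e, he⟩
    exact ⟨fun x => (e x : I).1, fun x y h => e.injective (Subtype.ext h), he⟩
  · rintro ⟨f, hf, h⟩
    exact ⟨Set.range f, Equiv.ofInjective f hf, h⟩

theorem Iso.contains {P P' Q : DoublePoset} : Iso P P' → P.Contains Q → P'.Contains Q := by
  rintro ⟨e, he⟩ h
  obtain ⟨f, hf, h⟩ := contains_iff.1 h
  exact contains_iff.2 ⟨e ∘ f, e.injective.comp hf, fun x y =>
    ⟨(h x y).1.trans (he _ _).1, (h x y).2.trans (he _ _).2⟩⟩

/-- An `h`-connected double poset contained in a product is contained in one of the factors. -/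
theorem contains_of_prod {P P' Q : DoublePoset} (hQ : Q.HConnected)
    (h : (P.prod P').Contains Q) : P.Contains Q ∨ P'.Contains Q := by
  obtain ⟨f, hf, h⟩ := contains_iff.1 h
  obtain ⟨⟨x₀⟩, hc⟩ := hQ
  rcases hx : f x₀ with p | p
  · left
    have key : ∀ z, ∃ p : P.carrier, f z = Sum.inl p := by
      intro z
      induction hc x₀ z with
      | refl => exact ⟨p, hx⟩
      | @tail b c _ hbc ih =>
        obtain ⟨q, hq⟩ := ih
        rw [(h _ _).1, (h _ _).1, hq] at hbc
        rcases hc' : f c with r | r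
        · exact ⟨r, rfl⟩
        · rw [hc'] at hbc; simp [prod] at hbc
    choose g hg using key
    refine contains_iff.2 ⟨g, fun x y hxy => hf (by rw [hg, hg, hxy]), fun x y => ?_⟩
    rw [(h x y).1, (h x y).2, hg, hg]
    simp [prod]
  · right
    have key : ∀ z, ∃ p : P'.carrier, f z = Sum.inr p := by
      intro z
      induction hc x₀ z with
      | refl => exact ⟨p, hx⟩
      | @tail b c _ hbc ih =>
        obtain ⟨q, hq⟩ := ih
        rw [(h _ _).1, (h _ _).1, hq] at hbc
        rcases hc' : f c with r | r
        · rw [hc'] at hbc; simp [prod] at hbc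
        · exact ⟨r, rfl⟩
    choose g hg using key
    refine contains_iff.2 ⟨g, fun x y hxy => hf (by rw [hg, hg, hxy]), fun x y => ?_⟩
    rw [(h x y).1, (h x y).2, hg, hg]
    simp [prod]

theorem hConnected_posetN : posetN.HConnected := by
  have h : ∀ x y : Fin 4, ∃ a b : Fin 4,
      (listRel [(0, 2), (0, 3), (1, 3)] x a ∨ listRel [(0, 2), (0, 3), (1, 3)] a x) ∧
      (listRel [(0, 2), (0, 3), (1, 3)] a b ∨ listRel [(0, 2), (0, 3), (1, 3)] b a) ∧
      (listRel [(0, 2), (0, 3), (1, 3)] b y ∨ listRel [(0, 2), (0, 3), (1, 3)] y b) := by decide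
  refine ⟨⟨(0 : Fin 4)⟩, fun x y => ?_⟩
  obtain ⟨a, b, h1, h2, h3⟩ := h x y
  have h1' : posetN.le₁ x a ∨ posetN.le₁ a x := h1
  have h2' : posetN.le₁ a b ∨ posetN.le₁ b a := h2
  have h3' : posetN.le₁ b y ∨ posetN.le₁ y b := h3
  exact .head h1' (.head h2' (.single h3'))

theorem hConnected_posetN' : posetN'.HConnected := by
  have h : ∀ x y : Fin 4, ∃ a b : Fin 4,
      (listRel [(0, 2), (1, 2), (1, 3)] x a ∨ listRel [(0, 2), (1, 2), (1, 3)] a x) ∧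
      (listRel [(0, 2), (1, 2), (1, 3)] a b ∨ listRel [(0, 2), (1, 2), (1, 3)] b a) ∧
      (listRel [(0, 2), (1, 2), (1, 3)] b y ∨ listRel [(0, 2), (1, 2), (1, 3)] y b) := by decide
  refine ⟨⟨(0 : Fin 4)⟩, fun x y => ?_⟩
  obtain ⟨a, b, h1, h2, h3⟩ := h x y
  have h1' : posetN'.le₁ x a ∨ posetN'.le₁ a x := h1
  have h2' : posetN'.le₁ a b ∨ posetN'.le₁ b a := h2
  have h3' : posetN'.le₁ b y ∨ posetN'.le₁ y b := h3
  exact .head h1' (.head h2' (.single h3'))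

theorem IsWN.prod {P Q : DoublePoset} (hP : P.IsWN) (hQ : Q.IsWN) : (P.prod Q).IsWN := by
  refine ⟨?_, fun h => ?_, fun h => ?_⟩
  · rintro (x | x) (y | y) hxy
    · simpa [DoublePoset.prod] using hP.1 x y (fun h => hxy (congrArg _ h))
    · simp [DoublePoset.prod]
    · simp [DoublePoset.prod]
    · simpa [DoublePoset.prod] using hQ.1 x y (fun h => hxy (congrArg _ h))
  · exact (contains_of_prod hConnected_posetN h).elim hP.2.1 hQ.2.1
  · exact (contains_of_prod hConnected_posetN' h).elim hP.2.2 hQ.2.2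

theorem isWN_of_subsingleton {P : DoublePoset} (h : Subsingleton P.carrier) : P.IsWN := by
  refine ⟨fun x y hxy => (hxy (Subsingleton.elim x y)).elim, fun hc => ?_, fun hc => ?_⟩
  · obtain ⟨f, hf, -⟩ := contains_iff.1 hc
    exact absurd (hf (Subsingleton.elim (f (0 : Fin 4)) (f (1 : Fin 4))))
      (by decide : ¬ (0 : Fin 4) = 1)
  · obtain ⟨f, hf, -⟩ := contains_iff.1 hc
    exact absurd (hf (Subsingleton.elim (f (0 : Fin 4)) (f (1 : Fin 4))))
      (by decide : ¬ (0 : Fin 4) = 1)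

end DoublePoset

/-- Isomorphism of WN posets. -/
instance wnSetoid : Setoid {P : DoublePoset // P.IsWN} where
  r P Q := DoublePoset.Iso P.1 Q.1
  iseqv := ⟨fun P => .refl P.1, fun h => h.symm, fun h h' => h.trans h'⟩

/-- Isoclasses of WN posets. -/
def WNP : Type 1 := Quotient wnSetoid

namespace WNP

/-- The isoclass of a WN poset. -/
def mk (P : DoublePoset) (hP : P.IsWN) : WNP := Quotient.mk wnSetoid ⟨P, hP⟩

/-- A WN poset in a given isoclass. -/
noncomputable def rep (P : WNP) : DoublePoset := (Quotient.out P).1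

theorem rep_isWN (P : WNP) : P.rep.IsWN := (Quotient.out P).2

theorem mk_eq_mk {P Q : DoublePoset} {hP : P.IsWN} {hQ : Q.IsWN} :
    mk P hP = mk Q hQ ↔ DoublePoset.Iso P Q :=
  Quotient.eq (r := wnSetoid)

theorem mk_rep (P : WNP) : mk P.rep P.rep_isWN = P := Quotient.out_eq P

theorem rep_mk (P : DoublePoset) (hP : P.IsWN) : DoublePoset.Iso (mk P hP).rep P :=
  mk_eq_mk.1 (mk_rep (mk P hP))

theorem eq_of_iso {P Q : WNP} (h : DoublePoset.Iso P.rep Q.rep) : P = Q := by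
  rw [← mk_rep P, ← mk_rep Q]; exact mk_eq_mk.2 h

/-- Isoclasses of WN posets form a monoid for the product `P · Q`, with unit the empty poset. -/
noncomputable instance : Monoid WNP where
  mul := Quotient.map₂ (fun P Q => ⟨P.1.prod Q.1, P.2.prod Q.2⟩)
    (fun _ _ h _ _ h' => DoublePoset.prod_congr h h')
  one := mk DoublePoset.empty (DoublePoset.isWN_of_subsingleton ⟨fun x => x.elim⟩)
  mul_assoc P Q R := by
    induction P, Q using Quotient.inductionOn₂ with | _ P Q
    induction R using Quotient.inductionOn with | _ R
    exact Quotient.sound (DoublePoset.prod_assoc P.1 Q.1 R.1)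
  one_mul P := by
    induction P using Quotient.inductionOn with | _ P
    exact Quotient.sound (DoublePoset.empty_prod P.1)
  mul_one P := by
    induction P using Quotient.inductionOn with | _ P
    exact Quotient.sound (DoublePoset.prod_empty P.1)

theorem mk_mul_mk {P Q : DoublePoset} (hP : P.IsWN) (hQ : Q.IsWN) :
    mk P hP * mk Q hQ = mk (P.prod Q) (hP.prod hQ) := rfl

theorem mul_rep (P Q : WNP) : DoublePoset.Iso (P * Q).rep (P.rep.prod Q.rep) := by
  conv_lhs => rw [← mk_rep P, ← mk_rep Q, mk_mul_mk]
  exact rep_mk _ _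

theorem eq_one_of_isEmpty {P : WNP} (h : IsEmpty P.rep.carrier) : P = 1 := by
  rw [← mk_rep P]; exact mk_eq_mk.2 (DoublePoset.iso_empty _ h)

/-- The number of elements. -/
noncomputable def card (P : WNP) : ℕ := Nat.card P.rep.carrier

theorem card_mul (P Q : WNP) : (P * Q).card = P.card + Q.card := by
  obtain ⟨e, -⟩ := mul_rep P Q
  have := P.rep.finite
  have := Q.rep.finite
  exact (Nat.card_congr e).trans Nat.card_sum

theorem finite_card_eq (n : ℕ) : {P : WNP | P.card = n}.Finite := by
  have he : ∀ P : {P : WNP // P.card = n}, Nonempty (Fin n ≃ P.1.rep.carrier) := fun P =>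
    have := P.1.rep.finite
    ⟨(Finite.equivFinOfCardEq P.2).symm⟩
  let e := fun P => (he P).some
  let f : {P : WNP // P.card = n} → (Fin n → Fin n → Prop) × (Fin n → Fin n → Prop) := fun P =>
    (fun i j => P.1.rep.le₁ (e P i) (e P j), fun i j => P.1.rep.le₂ (e P i) (e P j))
  have hf : Function.Injective f := by
    intro P Q h
    refine Subtype.ext (eq_of_iso ⟨(e P).symm.trans (e Q), fun x y => ?_⟩)
    have h1 := congrFun (congrFun (congrArg Prod.fst h) ((e P).symm x)) ((e P).symm y)
    have h2 := congrFun (congrFun (congrArg Prod.snd h) ((e P).symm x)) ((e P).symm y)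
    simp only [f, Equiv.apply_symm_apply] at h1 h2
    exact ⟨Iff.of_eq h1, Iff.of_eq h2⟩
  exact Set.finite_coe_iff.1 (Finite.of_injective f hf)

/-- `h`-connected WN posets. -/
def HConnected (P : WNP) : Prop := P.rep.HConnected

/-- The one-point poset. -/
def point : WNP := mk DoublePoset.point (DoublePoset.isWN_of_subsingleton ⟨fun _ _ => rfl⟩)

theorem point_hConnected : point.HConnected :=
  (rep_mk _ _).symm.hConnected ⟨⟨()⟩, fun _ _ => Relation.ReflTransGen.single (Or.inl trivial)⟩

/-- The number `n(P, Q; R)` of ideals `I` of `R` such that `R ∖ I` is isomorphic to `P` and `I` is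
isomorphic to `Q`. -/
noncomputable def numIdeals (P Q R : WNP) : ℕ :=
  {I : Set R.rep.carrier | R.rep.IsIdeal I ∧ DoublePoset.Iso (R.rep.restrict Iᶜ) P.rep ∧
    DoublePoset.Iso (R.rep.restrict I) Q.rep}.ncard

theorem card_of_numIdeals_ne_zero {P Q R : WNP} (h : numIdeals P Q R ≠ 0) :
    R.card = P.card + Q.card := by
  obtain ⟨I, -, ⟨e, -⟩, ⟨f, -⟩⟩ := Set.nonempty_of_ncard_ne_zero h
  have := R.rep.finite
  have h1 := Nat.card_congr e
  have h2 := Nat.card_congr f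
  have h3 := Set.ncard_add_ncard_compl I
  rw [card, card, card, ← h1, ← h2, ← h3, add_comm]
  rfl

theorem finite_numIdeals (P Q : WNP) : {R : WNP | numIdeals P Q R ≠ 0}.Finite :=
  (finite_card_eq (P.card + Q.card)).subset fun _ h => card_of_numIdeals_ne_zero h

theorem finite_factorizations (P : WNP) : {p : WNP × WNP | p.1 * p.2 = P}.Finite := by
  have h : (⋃ n ∈ Finset.range (P.card + 1), {Q : WNP | Q.card = n}).Finite :=
    Set.Finite.biUnion (Finset.finite_toSet _) fun n _ => finite_card_eq n
  refine (h.prod h).subset ?_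
  rintro ⟨Q, R⟩ rfl
  have := card_mul Q R
  simp only [Set.mem_prod, Set.mem_iUnion, Set.mem_ofPred_eq, Finset.mem_range, exists_prop,
    exists_eq_right']
  omega

/-- An `h`-connected poset only has the two trivial factorizations. -/
theorem mul_eq_iff_of_hConnected {P Q R : WNP} (hP : P.HConnected) :
    Q * R = P ↔ (Q = P ∧ R = 1) ∨ (Q = 1 ∧ R = P) := by
  constructor
  · rintro rfl
    rcases isEmpty_or_nonempty Q.rep.carrier with h | ⟨⟨x⟩⟩
    · right; simp [eq_one_of_isEmpty h]
    rcases isEmpty_or_nonempty R.rep.carrier with h | ⟨⟨y⟩⟩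
    · left; simp [eq_one_of_isEmpty h]
    exact (DoublePoset.not_hConnected_prod x y ((mul_rep Q R).hConnected hP)).elim
  · rintro (⟨rfl, rfl⟩ | ⟨rfl, rfl⟩) <;> simp

theorem ne_one_of_hConnected {P : WNP} (hP : P.HConnected) : P ≠ 1 := by
  rintro rfl
  obtain ⟨⟨x⟩, -⟩ := (rep_mk _ _).hConnected hP
  exact x.elim

end WNP

/-! ### The algebra of WN posets -/

/-- The vector space `H_WNP` with basis the isoclasses of WN posets. Its multiplication is the
linear extension of the product `P · Q`. -/
abbrev HWNP (K : Type*) [Field K] := MonoidAlgebra K WNP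

/-- The product `⋆` of `H_WNP`, given by `P ⋆ Q = ∑_R n(P, Q; R) R`. -/
noncomputable def starProd (K : Type*) [Field K] : HWNP K →ₗ[K] HWNP K →ₗ[K] HWNP K :=
  (MonoidAlgebra.basis WNP K).constr K fun P =>
    (MonoidAlgebra.basis WNP K).constr K fun Q =>
      ∑ R ∈ (WNP.finite_numIdeals P Q).toFinset,
        (WNP.numIdeals P Q R : K) • MonoidAlgebra.single R 1

/-- The coproduct of `H_WNP` dual to `·`, given by `P ↦ ∑_{Q · R = P} Q ⊗ R`. -/
noncomputable def comulWNP (K : Type*) [Field K] : HWNP K →ₗ[K] HWNP K ⊗[K] HWNP K :=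
  (MonoidAlgebra.basis WNP K).constr K fun P =>
    ∑ p ∈ (WNP.finite_factorizations P).toFinset,
      MonoidAlgebra.single p.1 1 ⊗ₜ[K] MonoidAlgebra.single p.2 1

/-- The space `Prim(H_WNP)` of the elements `x` with `Δ(x) = x ⊗ 1 + 1 ⊗ x`, where `Δ` is
`comulWNP`. -/
noncomputable def Prim (K : Type*) [Field K] : Submodule K (HWNP K) :=
  LinearMap.eqLocus (comulWNP K)
    ((TensorProduct.mk K (HWNP K) (HWNP K)).flip 1 + TensorProduct.mk K (HWNP K) (HWNP K) 1)

theorem mem_prim {K : Type*} [Field K] {x : HWNP K} :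
    x ∈ Prim K ↔ comulWNP K x = x ⊗ₜ 1 + 1 ⊗ₜ x := Iff.rfl

theorem single_mem_prim (K : Type*) [Field K] {P : WNP} (hP : P.HConnected) :
    (MonoidAlgebra.single P 1 : HWNP K) ∈ Prim K := by
  classical
  have h : (WNP.finite_factorizations P).toFinset = {(P, 1), (1, P)} := by
    ext ⟨Q, R⟩
    simp [WNP.mul_eq_iff_of_hConnected hP]
  have hne : (P, (1 : WNP)) ≠ (1, P) := fun h =>
    WNP.ne_one_of_hConnected hP (congrArg Prod.fst h)
  rw [mem_prim, comulWNP, ← MonoidAlgebra.basis_apply, Module.Basis.constr_basis, h,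
    Finset.sum_pair hne]
  rfl

open Classical in
/-- The canonical projection `π : H_WNP → Prim(H_WNP)`: it fixes the `h`-connected posets and
sends the other ones (the empty poset included) to `0`. -/
noncomputable def primProj (K : Type*) [Field K] : HWNP K →ₗ[K] Prim K :=
  (MonoidAlgebra.basis WNP K).constr K fun P =>
    if hP : P.HConnected then ⟨MonoidAlgebra.single P 1, single_mem_prim K hP⟩ else 0

/-- The linear map `Prim(H_WNP)^{⊗ n} → H_WNP`, `P₁ ⊗ ⋯ ⊗ Pₙ ↦ P₁ · ⋯ · Pₙ`. -/
noncomputable def primMul (K : Type*) [Field K] (n : ℕ) : (⨂[K]^n (Prim K)) →ₗ[K] HWNP K :=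
  PiTensorProduct.lift
    ((MultilinearMap.mkPiAlgebraFin K n (HWNP K)).compLinearMap fun _ => (Prim K).subtype)

/-- The brackets of `Prim(H_WNP)`:
`[P₁, …, Pₘ; Q₁, …, Qₙ] = π ((P₁ · ⋯ · Pₘ) ⋆ (Q₁ · ⋯ · Qₙ))`. -/
noncomputable def primBrackets (K : Type*) [Field K] : Brackets K (Prim K) := fun m n =>
  primProj K ∘ₗ TensorProduct.lift (starProd K) ∘ₗ TensorProduct.map (primMul K m) (primMul K n)

/-- The one-point poset, as an element of `Prim(H_WNP)`. -/
noncomputable def primPoint (K : Type*) [Field K] : Prim K :=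
  ⟨MonoidAlgebra.single WNP.point 1, single_mem_prim K WNP.point_hConnected⟩

end BInf

/-! The proof rests on two descriptions of `H_WNP`.

With the product `P · Q` and the coproduct `Δ`, it is the tensor algebra on its `h`-connected posets
with deconcatenation. A plane poset that is not `h`-connected is cut by `≤_r` (`IsPlane.exists_cut`)
and two cuts of the same poset are nested (`levi`), so the monoid of WN posets is free on the
`h`-connected ones (`freeMonoidEquiv`). Since `Δ` is dual to this product, the primitive elements
are supported on `h`-connected posets (`prim_eq_span`), and `fromT` and `toT` identify `T(Prim)`
with `H_WNP`, the projection `π` becoming the projection on letters (`primProj_fromT`). An ideal of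
`P · Q` is a pair of ideals, so `⋆` is compatible with `Δ` (`comulWNP_starProd`). Transported to
`T(Prim)` it is a Hopf product, with antipode a locally finite geometric series, and its projection
on letters gives the brackets.

With the two products `·` and `⋆`, which share their unit, `H_WNP` is free on the point. Exchanging
the two orders preserves WN posets and turns `·` into `stack`. A WN poset with at least two elements
is cut by one of the orders (`IsWN.hasCut`), which is where the exclusion of N matters. Hence a
poset other than `1` and the point is, in a unique way, an `h`-connected poset times a nonempty one,
or an `r`-connected poset stacked with a nonempty one. As `P ⋆ Q` is `stack P Q` plus posets with
fewer pairs `x ≤_h y` (`starProd_single_eq`), induction on the number `hrel` of such pairs shows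
that the point generates (`HWNP.generation`) and that morphisms can be built recursively from the
image of the point (`freeMap`, `freeHom_starProd`).

For a `B_∞`-algebra `B`, this applies to `T(B)` with concatenation and its product `⋆`. The morphism
`f` sending the point to the letter `x` respects coproducts, because the generator is primitive on
both sides and both products are compatible with the coproducts. It therefore sends primitive
elements to letters, so `f` is `T(φ)` for a linear map `φ`, which commutes with the brackets.
Conversely a `B_∞`-morphism `φ` induces a map `T(φ)` that respects both products
(`IsBInftyHom.mapT_star`), so generation by the point gives uniqueness. -/

namespace BInf

/-! ### Embeddings, exchange of the two orders, and cuts of plane and WN posets. -/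

namespace DoublePoset

/-- An embedding of double posets. -/
def IsEmb (P Q : DoublePoset) (f : P.carrier → Q.carrier) : Prop :=
  ∀ x y, (P.le₁ x y ↔ Q.le₁ (f x) (f y)) ∧ (P.le₂ x y ↔ Q.le₂ (f x) (f y))

theorem IsEmb.injective {P Q : DoublePoset} {f : P.carrier → Q.carrier} (hf : IsEmb P Q f) :
    Function.Injective f := fun x y h => by
  have := P.po₁
  have := Q.po₁
  refine antisymm_of P.le₁ ((hf x y).1.2 ?_) ((hf y x).1.2 ?_)
  · rw [h]; exact refl_of Q.le₁ _
  · rw [h]; exact refl_of Q.le₁ _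

/-- The double poset obtained by exchanging the two orders. -/
def swap (P : DoublePoset) : DoublePoset where
  carrier := P.carrier
  finite := P.finite
  le₁ := P.le₂
  le₂ := P.le₁
  po₁ := P.po₂
  po₂ := P.po₁

theorem Iso.swap {P Q : DoublePoset} : Iso P Q → Iso P.swap Q.swap := fun ⟨e, he⟩ =>
  ⟨e, fun x y => (he x y).symm⟩

theorem contains_of_isEmb {P Q R : DoublePoset} {f : P.carrier → Q.carrier} (hf : IsEmb P Q f)
    (h : P.Contains R) : Q.Contains R := by
  obtain ⟨g, hg, h⟩ := contains_iff.1 h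
  exact contains_iff.2 ⟨f ∘ g, hf.injective.comp hg, fun x y =>
    ⟨(h x y).1.trans (hf _ _).1, (h x y).2.trans (hf _ _).2⟩⟩

theorem IsWN.of_isEmb {P Q : DoublePoset} {f : P.carrier → Q.carrier} (hf : IsEmb P Q f)
    (hQ : Q.IsWN) : P.IsWN := by
  refine ⟨fun x y hxy => ?_, fun h => hQ.2.1 (contains_of_isEmb hf h),
    fun h => hQ.2.2 (contains_of_isEmb hf h)⟩
  rw [(hf x y).1, (hf y x).1, (hf x y).2, (hf y x).2]
  exact hQ.1 _ _ (hf.injective.ne hxy)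

theorem isEmb_val (P : DoublePoset) (I : Set P.carrier) :
    IsEmb (P.restrict I) P Subtype.val := fun _ _ => ⟨Iff.rfl, Iff.rfl⟩

theorem IsWN.restrict {P : DoublePoset} (hP : P.IsWN) (I : Set P.carrier) :
    (P.restrict I).IsWN := hP.of_isEmb (isEmb_val P I)

theorem isEmb_inl (P Q : DoublePoset) : IsEmb P (P.prod Q) Sum.inl := fun x y => by
  simp [prod]

theorem isEmb_inr (P Q : DoublePoset) : IsEmb Q (P.prod Q) Sum.inr := fun x y => by
  simp [prod]

theorem IsPlane.swap {P : DoublePoset} (hP : P.IsPlane) : P.swap.IsPlane := fun x y hxy => by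
  have := hP x y hxy
  simp only [DoublePoset.swap]
  tauto

/-- The two forbidden posets are exchanged by swapping the orders, after relabelling the vertices 1
and 2. Hence WN posets are stable under `swap`, and every result on `·` has a mirror image. -/
theorem iso_swap_posetN : Iso posetN.swap posetN' := by
  have h : ∀ x y : Fin 4,
      (listRel [(0, 1), (2, 1), (2, 3)] x y ↔ listRel [(0, 2), (1, 2), (1, 3)]
        (Equiv.swap (1 : Fin 4) 2 x) (Equiv.swap (1 : Fin 4) 2 y)) ∧
      (listRel [(0, 2), (0, 3), (1, 3)] x y ↔ listRel [(0, 1), (0, 3), (2, 3)]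
        (Equiv.swap (1 : Fin 4) 2 x) (Equiv.swap (1 : Fin 4) 2 y)) := by decide
  let e : Fin 4 ≃ Fin 4 := Equiv.swap 1 2
  exact ⟨e, h⟩

theorem contains_swap {P Q : DoublePoset} (h : P.swap.Contains Q) : P.Contains Q.swap := by
  obtain ⟨f, hf, h⟩ := contains_iff.1 h
  exact contains_iff.2 ⟨f, hf, fun x y => (h x y).symm⟩

theorem Contains.congr {P Q Q' : DoublePoset} (e : Iso Q Q') (h : P.Contains Q) :
    P.Contains Q' := by
  obtain ⟨I, hI⟩ := h
  exact ⟨I, e.symm.trans hI⟩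

theorem IsWN.swap {P : DoublePoset} (hP : P.IsWN) : P.swap.IsWN :=
  ⟨hP.1.swap, fun h => hP.2.2 ((contains_swap h).congr iso_swap_posetN),
    fun h => hP.2.1 ((contains_swap h).congr iso_swap_posetN.symm.swap)⟩

section Plane

variable {P : DoublePoset}

theorem IsPlane.total (hP : P.IsPlane) (x y : P.carrier) :
    P.le₁ x y ∨ P.le₁ y x ∨ P.le₂ x y ∨ P.le₂ y x := by
  have := P.po₁
  by_cases h : x = y
  · subst h; exact Or.inl (refl_of P.le₁ x)
  · have := hP x y h
    tauto

theorem IsPlane.eq_of_le (hP : P.IsPlane) {x y : P.carrier} (h₁ : P.le₁ x y ∨ P.le₁ y x)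
    (h₂ : P.le₂ x y ∨ P.le₂ y x) : x = y := by
  by_contra h
  exact (hP x y h).1 h₁ h₂

/-- In a plane poset `x <₁ y <₂ z` implies that `x` is below `z` for one of the orders. -/
theorem IsPlane.le_of_le₁_of_le₂ (hP : P.IsPlane) {x y z : P.carrier} (h : P.le₁ x y)
    (h' : P.le₂ y z) : P.le₁ x z ∨ P.le₂ x z := by
  have := P.po₁
  have := P.po₂
  rcases hP.total x z with h1 | h1 | h1 | h1
  · exact Or.inl h1
  · have := hP.eq_of_le (Or.inr (trans_of P.le₁ h1 h)) (Or.inl h')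
    subst this; exact Or.inl h
  · exact Or.inr h1
  · have := hP.eq_of_le (Or.inl h) (Or.inr (trans_of P.le₂ h' h1))
    subst this; exact Or.inr h'

/-- The union of the two orders is a linear order: planarity gives totality and antisymmetry, and
mixed transitivity is `IsPlane.le_of_le₁_of_le₂` together with its image under `swap`. -/
theorem IsPlane.exists_min (hP : P.IsPlane) [Nonempty P.carrier] :
    ∃ m : P.carrier, ∀ x, P.le₁ m x ∨ P.le₂ m x := by
  have := P.po₁
  have := P.po₂
  have := P.finite
  let r : P.carrier → P.carrier → Prop := fun x y => x ≠ y ∧ (P.le₁ x y ∨ P.le₂ x y)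
  have hanti : ∀ x y, (P.le₁ x y ∨ P.le₂ x y) → (P.le₁ y x ∨ P.le₂ y x) → x = y := by
    rintro x y (h | h) (h' | h')
    · exact antisymm_of P.le₁ h h'
    · exact hP.eq_of_le (.inl h) (.inr h')
    · exact hP.eq_of_le (.inr h') (.inl h)
    · exact antisymm_of P.le₂ h h'
  have htrans : ∀ x y z, (P.le₁ x y ∨ P.le₂ x y) → (P.le₁ y z ∨ P.le₂ y z) →
      (P.le₁ x z ∨ P.le₂ x z) := by
    rintro x y z (h | h) (h' | h')
    · exact .inl (trans_of P.le₁ h h')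
    · exact hP.le_of_le₁_of_le₂ h h'
    · exact (hP.swap.le_of_le₁_of_le₂ (P := P.swap) h h').symm
    · exact .inr (trans_of P.le₂ h h')
  have : IsTrans P.carrier r := ⟨fun x y z h h' => by
    refine ⟨fun hxz => h.1 ?_, htrans _ _ _ h.2 h'.2⟩
    subst hxz
    exact hanti _ _ h.2 h'.2⟩
  have : Std.Irrefl r := ⟨fun x h => h.1 rfl⟩
  have hwf : WellFounded r := Finite.wellFounded_of_trans_of_irrefl r
  refine ⟨hwf.min Set.univ Set.univ_nonempty, fun x => ?_⟩
  have h := hwf.not_lt_min Set.univ (x := x) trivial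
  by_contra hx
  have ht := hP.total (hwf.min Set.univ Set.univ_nonempty) x
  apply h
  refine ⟨?_, by tauto⟩
  intro hxm
  rw [← hxm] at hx
  exact hx (.inl (refl_of P.le₁ _))

/-- A plane poset that is not `h`-connected has a nontrivial cut for the product. -/
theorem IsPlane.exists_cut (hP : P.IsPlane) [Nonempty P.carrier] (h : ¬ P.HConnected) :
    ∃ A : Set P.carrier, A.Nonempty ∧ Aᶜ.Nonempty ∧ ∀ x ∈ A, ∀ y ∉ A, P.le₂ x y := by
  have := P.po₁
  have := P.po₂
  obtain ⟨m, hm⟩ := hP.exists_min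
  let r : P.carrier → P.carrier → Prop := fun a b => P.le₁ a b ∨ P.le₁ b a
  have hr : Std.Symm r := ⟨fun a b => Or.symm⟩
  -- The lower part of the cut is the `h`-connected component of the minimum; being below an outside
  -- point for `≤₂` propagates along paths from `m`.
  refine ⟨{x | Relation.ReflTransGen r m x}, ⟨m, .refl⟩, ?_, ?_⟩
  · rw [Set.nonempty_iff_ne_empty]
    intro he
    refine h ⟨inferInstance, fun x y => ?_⟩
    have hmem : ∀ z, Relation.ReflTransGen r m z := fun z => by
      by_contra hz
      exact (Set.ext_iff.1 he z).1 hz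
    exact (Std.Symm.symm (r := Relation.ReflTransGen r) _ _ (hmem x)).trans (hmem y)
  · intro x hx y hy
    induction hx with
    | refl =>
      rcases hm y with h | h
      · exact (hy (.single (.inl h))).elim
      · exact h
    | @tail b c hb hbc ih =>
      rcases hP.total c y with h | h | h | h
      · exact (hy ((hb.tail hbc).tail (.inl h))).elim
      · exact (hy ((hb.tail hbc).tail (.inr h))).elim
      · exact h
      -- Here `b ≤₂ y ≤₂ c` although `b` and `c` are `≤₁`-comparable, which forces `b = c`.
      · have := hP.eq_of_le hbc (.inl (trans_of P.le₂ ih h))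
        subst this; exact ih

end Plane

/-- The subset `C` is cut by the relation `r` in two nonempty parts. -/
def HasCut {α : Type*} (r : α → α → Prop) (C : Set α) : Prop :=
  ∃ B ⊆ C, B.Nonempty ∧ (C \ B).Nonempty ∧ ∀ x ∈ C \ B, ∀ y ∈ B, r x y

theorem IsPlane.exists_min_mem {P : DoublePoset} (hP : P.IsPlane) {C : Set P.carrier}
    (hC : C.Nonempty) : ∃ m ∈ C, ∀ x ∈ C, P.le₁ m x ∨ P.le₂ m x := by
  have hW : (P.restrict C).IsPlane := fun x y hxy => hP _ _ (fun h => hxy (Subtype.ext h))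
  have : Nonempty (P.restrict C).carrier := hC.to_subtype
  obtain ⟨m, hm⟩ := hW.exists_min
  exact ⟨m.1, m.2, fun x hx => hm ⟨x, hx⟩⟩

/-- Inserting a new minimum can destroy a cut only by being `≤₁`-below one part of an indecomposable
upper block and `≤₂`-below another part of it. Together with a point of the lower block this
produces an N. -/
theorem IsWN.hasCut_insert {P : DoublePoset} (hP : P.IsWN) {C : Set P.carrier} {m : P.carrier}
    (hmC : m ∉ C) (hm : ∀ x ∈ C, P.le₁ m x ∨ P.le₂ m x) (h : HasCut P.le₂ C) :
    HasCut P.le₁ (insert m C) ∨ HasCut P.le₂ (insert m C) := by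
  have := P.po₁
  have := P.po₂
  have := P.finite
  have hne : ∀ x ∈ C, m ≠ x := fun x hx h => hmC (h ▸ hx)
  have hex : ∀ x ∈ C, P.le₁ m x → P.le₂ m x → False := fun x hx h h' =>
    hne x hx (hP.1.eq_of_le (.inl h) (.inl h'))
  -- The upper block `B` is taken minimal, so that it cannot itself be cut by `≤₂`.
  obtain ⟨B, ⟨hBC, hB, hCB, hcut⟩, hmin⟩ := (wellFounded_lt (α := Set P.carrier)).has_min
    {B | B ⊆ C ∧ B.Nonempty ∧ (C \ B).Nonempty ∧ ∀ x ∈ C \ B, ∀ y ∈ B, P.le₂ x y} h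
  by_cases h1 : ∀ b ∈ B, P.le₂ m b
  · right
    refine ⟨B, hBC.trans (Set.subset_insert _ _), hB,
      hCB.mono (Set.sdiff_subset_sdiff_left (Set.subset_insert _ _)), ?_⟩
    rintro x ⟨rfl | hx, hxB⟩ y hy
    · exact h1 y hy
    · exact hcut x ⟨hx, hxB⟩ y hy
  push Not at h1
  obtain ⟨b, hb, hmb⟩ := h1
  have hmb' : P.le₁ m b := (hm b (hBC hb)).resolve_right hmb
  have hA : ∀ a ∈ C \ B, P.le₁ m a := fun a ha =>
    (hm a ha.1).resolve_right fun h => hmb (trans_of P.le₂ h (hcut a ha b hb))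
  by_cases h2 : ∀ b ∈ B, P.le₁ m b
  · left
    have hd : insert m C \ C = {m} := by
      ext x; constructor
      · rintro ⟨rfl | h, h'⟩
        · rfl
        · exact (h' h).elim
      · rintro rfl; exact ⟨.inl rfl, hmC⟩
    refine ⟨C, Set.subset_insert _ _, hB.mono hBC, by rw [hd]; exact ⟨m, rfl⟩, ?_⟩
    rw [hd]
    rintro x rfl y hy
    by_cases hyB : y ∈ B
    · exact h2 y hyB
    · exact hA y ⟨hy, hyB⟩
  exfalso
  push Not at h2
  obtain ⟨b', hb', hmb₁⟩ := h2
  -- If every point of `B` that is `≤₁`-above `m` lies `≤₂`-below every point of `B` that is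
  -- `≤₂`-above `m`, then the latter points form a smaller upper block. Otherwise a violating pair
  -- `c, c'` satisfies `c' ≤₁ c`.
  by_cases hadj : ∀ b ∈ B, ∀ b' ∈ B, P.le₁ m b → P.le₂ m b' → P.le₂ b b'
  · refine hmin {b' ∈ B | P.le₂ m b'} ⟨fun x hx => hBC hx.1, ⟨b', hb', ?_⟩, ⟨b, hBC hb, ?_⟩, ?_⟩ ?_
    · exact (hm b' (hBC hb')).resolve_left hmb₁
    · exact fun h => hmb h.2
    · rintro x ⟨hx, hxB⟩ y ⟨hy, hmy⟩
      by_cases hx' : x ∈ B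
      · exact hadj x hx' y hy ((hm x hx).resolve_right fun h => hxB ⟨hx', h⟩) hmy
      · exact hcut x ⟨hx, hx'⟩ y hy
    · exact ⟨fun x hx => hx.1, fun h => hmb (h hb).2⟩
  · push Not at hadj
    obtain ⟨c, hc, c', hc', hmc, hmc', hcc⟩ := hadj
    obtain ⟨a, ha⟩ := hCB
    have hac := hcut a ha c hc
    have hac' := hcut a ha c' hc'
    have hma := hA a ha
    have hcc' : P.le₁ c' c := by
      rcases hP.1.total c c' with h | h | h | h
      · exact (hex c' (hBC hc') (trans_of P.le₁ hmc h) hmc').elim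
      · exact h
      · exact (hcc h).elim
      · exact (hex c (hBC hc) hmc (trans_of P.le₂ hmc' h)).elim
    have n1 : m ≠ c' := hne c' (hBC hc')
    have n2 : m ≠ a := hne a ha.1
    have n3 : m ≠ c := hne c (hBC hc)
    have n4 : c' ≠ a := fun h => ha.2 (h ▸ hc')
    have n5 : c' ≠ c := fun h => hex c (hBC hc) hmc (h ▸ hmc')
    have n6 : a ≠ c := fun h => ha.2 (h ▸ hc)
    have A1 : ∀ {x y}, x ≠ y → P.le₁ x y → ¬ P.le₁ y x := fun h h' h'' =>
      h (antisymm_of P.le₁ h' h'')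
    have A2 : ∀ {x y}, x ≠ y → P.le₂ x y → ¬ P.le₂ y x := fun h h' h'' =>
      h (antisymm_of P.le₂ h' h'')
    have E1 : ∀ {x y}, x ≠ y → P.le₁ x y → ¬ P.le₂ x y ∧ ¬ P.le₂ y x := fun h h' =>
      ⟨fun h2 => h (hP.1.eq_of_le (.inl h') (.inl h2)),
        fun h2 => h (hP.1.eq_of_le (.inl h') (.inr h2))⟩
    have E2 : ∀ {x y}, x ≠ y → P.le₂ x y → ¬ P.le₁ x y ∧ ¬ P.le₁ y x := fun h h' =>
      ⟨fun h2 => h (hP.1.eq_of_le (.inl h2) (.inl h')),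
        fun h2 => h (hP.1.eq_of_le (.inr h2) (.inl h'))⟩
    have R1 : ∀ x, P.le₁ x x := refl_of P.le₁
    have R2 : ∀ x, P.le₂ x x := refl_of P.le₂
    -- The order of the vertices matches that of `posetN`; `a` comes from the lower block.
    let f : Fin 4 → P.carrier := ![m, c', a, c]
    have key : ∀ x y : Fin 4, (listRel [(0, 2), (0, 3), (1, 3)] x y ↔ P.le₁ (f x) (f y)) ∧
        (listRel [(0, 1), (2, 1), (2, 3)] x y ↔ P.le₂ (f x) (f y)) := by
      have D : ∀ {p q p' q' : Prop}, p → q → ¬ p' → ¬ q' → (p ↔ q) ∧ (p' ↔ q') :=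
        fun h1 h2 h3 h4 => ⟨iff_of_true h1 h2, iff_of_false h3 h4⟩
      have D' : ∀ {p q p' q' : Prop}, ¬ p → ¬ q → p' → q' → (p ↔ q) ∧ (p' ↔ q') :=
        fun h1 h2 h3 h4 => ⟨iff_of_false h1 h2, iff_of_true h3 h4⟩
      have D0 : ∀ {p q p' q' : Prop}, ¬ p → ¬ q → ¬ p' → ¬ q' → (p ↔ q) ∧ (p' ↔ q') :=
        fun h1 h2 h3 h4 => ⟨iff_of_false h1 h2, iff_of_false h3 h4⟩
      have D1 : ∀ {p q p' q' : Prop}, p → q → p' → q' → (p ↔ q) ∧ (p' ↔ q') :=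
        fun h1 h2 h3 h4 => ⟨iff_of_true h1 h2, iff_of_true h3 h4⟩
      intro x y
      fin_cases x <;> fin_cases y
      · exact D1 (by decide) (R1 m) (by decide) (R2 m)
      · exact D' (by decide) (E2 n1 hmc').1 (by decide) hmc'
      · exact D (by decide) hma (by decide) (E1 n2 hma).1
      · exact D (by decide) hmc (by decide) (E1 n3 hmc).1
      · exact D0 (by decide) (E2 n1 hmc').2 (by decide) (A2 n1 hmc')
      · exact D1 (by decide) (R1 c') (by decide) (R2 c')
      · exact D0 (by decide) (E2 n4.symm hac').2 (by decide) (A2 n4.symm hac')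
      · exact D (by decide) hcc' (by decide) (E1 n5 hcc').1
      · exact D0 (by decide) (A1 n2 hma) (by decide) (E1 n2 hma).2
      · exact D' (by decide) (E2 n4.symm hac').1 (by decide) hac'
      · exact D1 (by decide) (R1 a) (by decide) (R2 a)
      · exact D' (by decide) (E2 n6 hac).1 (by decide) hac
      · exact D0 (by decide) (A1 n3 hmc) (by decide) (E1 n3 hmc).2
      · exact D0 (by decide) (A1 n5 hcc') (by decide) (E1 n5 hcc').2
      · exact D0 (by decide) (E2 n6 hac).2 (by decide) (A2 n6 hac)
      · exact D1 (by decide) (R1 c) (by decide) (R2 c)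
    exact hP.2.1 (contains_of_isEmb (P := posetN) (f := f) key ⟨Set.univ,
      ⟨(Equiv.Set.univ _).symm, fun _ _ => ⟨Iff.rfl, Iff.rfl⟩⟩⟩)

/-- A subset with at least two elements of a WN poset is cut by one of the two orders. -/
theorem IsWN.hasCut {P : DoublePoset} (hP : P.IsWN) (C : Set P.carrier) (hC : C.Nontrivial) :
    HasCut P.le₁ C ∨ HasCut P.le₂ C := by
  have := P.finite
  induction C using (wellFounded_lt (α := Set P.carrier)).induction with
  | _ C ih =>
    -- The minimum is removed and put back with `IsWN.hasCut_insert`; a cut of the rest by `≤₁` is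
    -- handled in `P.swap`.
    obtain ⟨m, hmC, hm⟩ := hP.1.exists_min_mem hC.nonempty
    have hins : insert m (C \ {m}) = C := Set.insert_sdiff_self_of_mem hmC
    have hm' : ∀ x ∈ C \ {m}, P.le₁ m x ∨ P.le₂ m x := fun x hx => hm x hx.1
    have hmn : m ∉ C \ {m} := fun h => h.2 rfl
    obtain ⟨b, hb, hbm⟩ := hC.exists_ne m
    by_cases hN : (C \ {m}).Nontrivial
    · rcases ih (C \ {m}) ⟨Set.sdiff_subset, fun h => (h hmC).2 rfl⟩ hN with h | h
      · have : HasCut P.le₂ (insert m (C \ {m})) ∨ HasCut P.le₁ (insert m (C \ {m})) :=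
          hP.swap.hasCut_insert (P := P.swap) hmn (fun x hx => (hm' x hx).symm) h
        rw [hins] at this
        exact this.symm
      · have := hP.hasCut_insert hmn hm' h
        rwa [hins] at this
    · rw [Set.not_nontrivial_iff] at hN
      have hx : ∀ x ∈ C \ {b}, x = m := fun x hx => by
        by_contra h
        exact hx.2 (hN ⟨hx.1, h⟩ ⟨hb, hbm⟩)
      rcases hm b hb with h | h
      · exact .inl ⟨{b}, Set.singleton_subset_iff.2 hb, ⟨b, rfl⟩, ⟨m, hmC, hbm.symm⟩,
          fun x hx' y hy => by rw [hx x hx', hy]; exact h⟩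
      · exact .inr ⟨{b}, Set.singleton_subset_iff.2 hb, ⟨b, rfl⟩, ⟨m, hmC, hbm.symm⟩,
          fun x hx' y hy => by rw [hx x hx', hy]; exact h⟩

end DoublePoset

end BInf

/-! ### The free monoid structure on isoclasses, and the stacked product. -/

namespace BInf

open DoublePoset

namespace WNP

/-- The isoclass of the double subposet of `P` on `I`. -/
def sub (P : DoublePoset) (hP : P.IsWN) (I : Set P.carrier) : WNP := mk (P.restrict I) (hP.restrict I)

theorem sub_univ (P : DoublePoset) (hP : P.IsWN) : sub P hP Set.univ = mk P hP :=
  mk_eq_mk.2 ⟨Equiv.Set.univ _, fun _ _ => ⟨Iff.rfl, Iff.rfl⟩⟩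

theorem sub_rep_univ (P : WNP) : sub P.rep P.rep_isWN Set.univ = P := by
  rw [sub_univ, mk_rep]

theorem sub_image {P Q : DoublePoset} (hP : P.IsWN) (hQ : Q.IsWN) {f : P.carrier → Q.carrier}
    (hf : IsEmb P Q f) (I : Set P.carrier) : sub Q hQ (f '' I) = sub P hP I :=
  mk_eq_mk.2 (Iso.symm ⟨Equiv.Set.image f I hf.injective, fun x y => hf x.1 y.1⟩)

/-- Planarity rules out `≤₁`-comparabilities across the cut, so a cut for `≤₂` alone is already a
factorization. -/
theorem sub_union {P : DoublePoset} (hP : P.IsWN) {A B : Set P.carrier} (hd : Disjoint A B)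
    (h : ∀ x ∈ A, ∀ y ∈ B, P.le₂ x y) : sub P hP (A ∪ B) = sub P hP A * sub P hP B := by
  classical
  rw [sub, sub, sub, mk_mul_mk, mk_eq_mk]
  have hne : ∀ {x y}, x ∈ A → y ∈ B → x ≠ y := fun hx hy hxy =>
    Set.disjoint_left.1 hd hx (hxy ▸ hy)
  have h2 : ∀ x ∈ A, ∀ y ∈ B, ¬ P.le₂ y x := fun x hx y hy h' => by
    have := P.po₂
    exact hne hx hy (antisymm_of P.le₂ (h x hx y hy) h')
  have h1 : ∀ x ∈ A, ∀ y ∈ B, ¬ P.le₁ x y := fun x hx y hy h' =>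
    hne hx hy (hP.1.eq_of_le (.inl h') (.inl (h x hx y hy)))
  have h1' : ∀ x ∈ A, ∀ y ∈ B, ¬ P.le₁ y x := fun x hx y hy h' =>
    hne hx hy (hP.1.eq_of_le (.inr h') (.inl (h x hx y hy)))
  have key : ∀ x y : A ⊕ B,
      (Sum.LiftRel (fun a b : A => P.le₁ a b) (fun a b : B => P.le₁ a b) x y ↔
        P.le₁ ((Equiv.Set.union hd).symm x) ((Equiv.Set.union hd).symm y)) ∧
      (Sum.Lex (fun a b : A => P.le₂ a b) (fun a b : B => P.le₂ a b) x y ↔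
        P.le₂ ((Equiv.Set.union hd).symm x) ((Equiv.Set.union hd).symm y)) := by
    rintro (⟨x, hx⟩ | ⟨x, hx⟩) (⟨y, hy⟩ | ⟨y, hy⟩)
    · simp
    · simp [h x hx y hy, h1 x hx y hy]
    · simp [h2 y hy x hx, h1' y hy x hx]
    · simp
  exact Iso.symm ⟨(Equiv.Set.union hd).symm, key⟩

theorem card_sub (P : DoublePoset) (hP : P.IsWN) (I : Set P.carrier) :
    (sub P hP I).card = I.ncard := by
  obtain ⟨e, -⟩ := rep_mk (P.restrict I) (hP.restrict I)
  exact Nat.card_congr e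

theorem card_one : (1 : WNP).card = 0 := by
  have := card_mul 1 1
  rw [mul_one] at this
  omega

theorem card_eq_zero {P : WNP} : P.card = 0 ↔ P = 1 := by
  constructor
  · intro h
    have := P.rep.finite
    exact eq_one_of_isEmpty (Finite.card_eq_zero_iff.1 h)
  · rintro rfl; exact card_one

theorem sub_eq_one {P : DoublePoset} {hP : P.IsWN} {I : Set P.carrier} :
    sub P hP I = 1 ↔ I = ∅ := by
  have := P.finite
  rw [← card_eq_zero, card_sub, Set.ncard_eq_zero]

theorem mul_eq_one {P Q : WNP} : P * Q = 1 ↔ P = 1 ∧ Q = 1 := by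
  rw [← card_eq_zero, ← card_eq_zero, ← card_eq_zero, card_mul]
  omega

/-- Both factors are realized as complementary subsets of one poset, so that identities between
isoclasses can be checked on sets. -/
theorem exists_sub_eq_mul (Q R : WNP) : ∃ (P : DoublePoset) (hP : P.IsWN) (A : Set P.carrier),
    mk P hP = Q * R ∧ sub P hP A = Q ∧ sub P hP Aᶜ = R ∧ ∀ x ∈ A, ∀ y ∉ A, P.le₂ x y := by
  have hP := Q.rep_isWN.prod R.rep_isWN
  let i : Q.rep.carrier → (Q.rep.prod R.rep).carrier := Sum.inl
  let j : R.rep.carrier → (Q.rep.prod R.rep).carrier := Sum.inr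
  have hij : (Set.range i)ᶜ = Set.range j := Set.compl_range_inl
  refine ⟨Q.rep.prod R.rep, hP, Set.range i, ?_, ?_, ?_, ?_⟩
  · rw [← mk_mul_mk Q.rep_isWN R.rep_isWN, mk_rep, mk_rep]
  · rw [← Set.image_univ, sub_image Q.rep_isWN hP (isEmb_inl _ _), sub_rep_univ]
  · rw [hij, ← Set.image_univ, sub_image R.rep_isWN hP (isEmb_inr _ _), sub_rep_univ]
  · rintro _ ⟨x, rfl⟩ (y | y) hy
    · exact (hy ⟨y, rfl⟩).elim
    · exact Sum.Lex.sep _ _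

/-- Levi's lemma for the product of WN posets. -/
theorem levi {Q R Q' R' : WNP} (h : Q * R = Q' * R') :
    ∃ T, (Q' = Q * T ∧ R = T * R') ∨ (Q = Q' * T ∧ R' = T * R) := by
  obtain ⟨P, hP, A, hPA, rfl, rfl, hA⟩ := exists_sub_eq_mul Q R
  obtain ⟨P', hP', A', hPA', rfl, rfl, hA'⟩ := exists_sub_eq_mul Q' R'
  rw [← hPA, ← hPA'] at h
  obtain ⟨e, he⟩ := mk_eq_mk.1 h
  have hcut : ∀ {A A' : Set P.carrier}, (∀ x ∈ A, ∀ y ∉ A, P.le₂ x y) →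
      (∀ x ∈ A', ∀ y ∉ A', P.le₂ x y) → A ⊆ A' →
      sub P hP A' = sub P hP A * sub P hP (A' \ A) ∧
        sub P hP Aᶜ = sub P hP (A' \ A) * sub P hP A'ᶜ := by
    intro A A' hA hA' hAA
    rw [← sub_union hP Set.disjoint_sdiff_right fun x hx y hy => hA x hx y hy.2,
      ← sub_union hP (A := A' \ A) (B := A'ᶜ) (Set.disjoint_left.2 fun x hx hx' => hx' hx.1)
        (fun x hx y hy => hA' x hx.1 y hy), Set.union_sdiff_cancel hAA]
    refine ⟨rfl, congrArg _ ?_⟩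
    ext x
    have := @hAA x
    simp only [Set.mem_compl_iff, Set.mem_union, Set.mem_sdiff]
    tauto
  have hs : ∀ I, sub P' hP' I = sub P hP (e ⁻¹' I) := fun I => by
    rw [← sub_image hP hP' he, Set.image_preimage_eq _ e.surjective]
  have hB : ∀ x ∈ e ⁻¹' A', ∀ y ∉ e ⁻¹' A', P.le₂ x y := fun x hx y hy =>
    (he x y).2.2 (hA' _ hx _ hy)
  rw [hs A', hs A'ᶜ, Set.preimage_compl]
  -- Two initial parts of cuts are nested: a point in the first only and a point in the second only
  -- would be `≤₂` each other, hence equal.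
  by_cases hAB : A ⊆ e ⁻¹' A'
  · exact ⟨_, .inl (hcut hA hB hAB)⟩
  · refine ⟨_, .inr (hcut hB hA ?_)⟩
    obtain ⟨x, hx, hx'⟩ := Set.not_subset.1 hAB
    intro y hy
    by_contra hy'
    have := P.po₂
    have := antisymm_of P.le₂ (hA x hx y hy') (hB y hy x hx')
    exact hx' (this ▸ hy)

theorem exists_mul_of_not_hConnected {P : WNP} (h1 : P ≠ 1) (h : ¬ P.HConnected) :
    ∃ Q R, Q ≠ 1 ∧ R ≠ 1 ∧ P = Q * R := by
  have : Nonempty P.rep.carrier := by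
    by_contra hne
    exact h1 (eq_one_of_isEmpty (not_nonempty_iff.1 hne))
  obtain ⟨A, hA, hA', hcut⟩ := P.rep_isWN.1.exists_cut h
  refine ⟨sub _ P.rep_isWN A, sub _ P.rep_isWN Aᶜ, ?_, ?_, ?_⟩
  · rw [Ne, sub_eq_one]; exact hA.ne_empty
  · rw [Ne, sub_eq_one]; exact hA'.ne_empty
  · rw [← sub_union _ disjoint_compl_right hcut, Set.union_compl_self, sub_rep_univ]

theorem exists_hConnected_mul {P : WNP} (h1 : P ≠ 1) :
    ∃ Q R, Q.HConnected ∧ P = Q * R := by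
  induction hn : P.card using Nat.strong_induction_on generalizing P with
  | _ n ih =>
    by_cases h : P.HConnected
    · exact ⟨P, 1, h, (mul_one P).symm⟩
    · obtain ⟨Q, R, hQ, hR, rfl⟩ := exists_mul_of_not_hConnected h1 h
      have hR' := mt card_eq_zero.1 hR
      obtain ⟨Q', R', hQ', rfl⟩ := ih Q.card (by rw [← hn, card_mul]; omega) hQ rfl
      exact ⟨Q', R' * R, hQ', mul_assoc _ _ _⟩

theorem mul_left_cancel' {Q R R' : WNP} (h : Q * R = Q * R') : R = R' := by
  obtain ⟨T, ⟨h1, h2⟩ | ⟨h1, h2⟩⟩ := levi h <;>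
  · have hc := congrArg card h1
    rw [card_mul] at hc
    rw [card_eq_zero.1 (show T.card = 0 by omega), one_mul] at h2
    first | exact h2 | exact h2.symm

/-- Levi's lemma makes one first factor divide the other, and `h`-connected posets are
indecomposable. -/
theorem hConnected_mul_inj {Q Q' R R' : WNP} (hQ : Q.HConnected) (hQ' : Q'.HConnected)
    (h : Q * R = Q' * R') : Q = Q' ∧ R = R' := by
  have hQQ : Q = Q' := by
    obtain ⟨T, ⟨h1, -⟩ | ⟨h1, -⟩⟩ := levi h
    · rcases (mul_eq_iff_of_hConnected hQ').1 h1.symm with h | h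
      · exact h.1
      · exact (ne_one_of_hConnected hQ h.1).elim
    · rcases (mul_eq_iff_of_hConnected hQ).1 h1.symm with h | h
      · exact h.1.symm
      · exact (ne_one_of_hConnected hQ' h.1).elim
  subst hQQ
  exact ⟨rfl, mul_left_cancel' h⟩

/-- The isoclass obtained by exchanging the two orders. -/
noncomputable def swap (P : WNP) : WNP := mk P.rep.swap P.rep_isWN.swap

theorem swap_mk (P : DoublePoset) (hP : P.IsWN) : swap (mk P hP) = mk P.swap hP.swap :=
  mk_eq_mk.2 (rep_mk P hP).swap

theorem swap_sub (P : DoublePoset) (hP : P.IsWN) (I : Set P.carrier) :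
    swap (sub P hP I) = sub P.swap hP.swap I :=
  swap_mk _ _

@[simp] theorem swap_swap (P : WNP) : P.swap.swap = P := by
  conv_rhs => rw [← mk_rep P]
  exact swap_mk _ _

theorem swap_injective : Function.Injective swap := fun P Q h => by
  rw [← swap_swap P, h, swap_swap]

@[simp] theorem card_swap (P : WNP) : P.swap.card = P.card := by
  conv_rhs => rw [← sub_rep_univ P]
  rw [swap, ← sub_univ, card_sub, card_sub]
  rfl

@[simp] theorem swap_one : swap 1 = 1 := by
  rw [← card_eq_zero, card_swap, card_one]

theorem swap_eq_one {P : WNP} : P.swap = 1 ↔ P = 1 := by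
  rw [← card_eq_zero, card_swap, card_eq_zero]

/-- The product exchanged by `swap`: `stack P Q` is the disjoint union of `P` and `Q`, where
`x ≤₁ y` and `x, y` are not comparable for `≤₂` whenever `x ∈ P` and `y ∈ Q`. -/
noncomputable def stack (P Q : WNP) : WNP := swap (P.swap * Q.swap)

theorem swap_stack (P Q : WNP) : swap (stack P Q) = P.swap * Q.swap := swap_swap _

theorem card_stack (P Q : WNP) : (stack P Q).card = P.card + Q.card := by
  rw [stack, card_swap, card_mul, card_swap, card_swap]

@[simp] theorem stack_one (P : WNP) : stack P 1 = P := by simp [stack]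

/-- `r`-connected WN posets. -/
def RConnected (P : WNP) : Prop := P.swap.HConnected

theorem exists_rConnected_stack {P : WNP} (h1 : P ≠ 1) :
    ∃ Q R, Q.RConnected ∧ P = stack Q R := by
  obtain ⟨Q, R, hQ, h⟩ := exists_hConnected_mul (mt swap_eq_one.1 h1)
  refine ⟨Q.swap, R.swap, by rwa [RConnected, swap_swap], swap_injective ?_⟩
  rw [h, swap_stack, swap_swap, swap_swap]

theorem rConnected_stack_inj {Q Q' R R' : WNP} (hQ : Q.RConnected) (hQ' : Q'.RConnected)
    (h : stack Q R = stack Q' R') : Q = Q' ∧ R = R' := by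
  have := hConnected_mul_inj hQ hQ' (swap_injective h)
  exact ⟨swap_injective this.1, swap_injective this.2⟩

theorem ne_one_of_rConnected {P : WNP} (hP : P.RConnected) : P ≠ 1 := fun h =>
  ne_one_of_hConnected hP (swap_eq_one.2 h)

theorem eq_point {P : WNP} (h : P.card = 1) : P = point := by
  have := P.rep.finite
  obtain ⟨hs, ⟨x⟩⟩ := Nat.card_eq_one_iff_unique.1 h
  have := P.rep.po₁
  have := P.rep.po₂
  rw [← mk_rep P]
  refine mk_eq_mk.2 ⟨⟨fun _ => (), fun _ => x, fun y => Subsingleton.elim _ _, fun _ => rfl⟩,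
    fun y z => ?_⟩
  rw [Subsingleton.elim y z]
  exact ⟨iff_of_true (refl_of P.rep.le₁ z) trivial, iff_of_true (refl_of P.rep.le₂ z) trivial⟩

theorem card_point : point.card = 1 := by
  rw [point, ← sub_univ, card_sub, Set.ncard_univ]
  exact Nat.card_unique (α := Unit)

/-- A WN poset with at least two elements is not both `h`-connected and `r`-connected. -/
theorem eq_point_of_connected {P : WNP} (hP : P.HConnected) (hP' : P.RConnected) : P = point := by
  by_contra hne
  have hfin := P.rep.finite
  have h1 : P.card ≠ 1 := fun h => hne (eq_point h)
  have h0 : P.card ≠ 0 := mt card_eq_zero.1 (ne_one_of_hConnected hP)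
  have hnt : (Set.univ : Set P.rep.carrier).Nontrivial := by
    rw [← Set.one_lt_ncard_iff_nontrivial, Set.ncard_univ]
    have : P.card = Nat.card P.rep.carrier := rfl
    omega
  -- A cut by `≤₂` contradicts `h`-connectedness; applied to `P.rep.swap`, this also excludes a cut
  -- by `≤₁`.
  have key : ∀ {Q : DoublePoset} (hQ : Q.IsWN), (mk Q hQ).HConnected →
      ¬ HasCut Q.le₂ Set.univ := by
    rintro Q hQ hc ⟨B, -, hB, hB', hcut⟩
    have h := sub_union hQ Set.disjoint_sdiff_left hcut
    rw [Set.sdiff_union_of_subset (Set.subset_univ B), sub_univ] at h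
    rcases (mul_eq_iff_of_hConnected hc).1 h.symm with h | h
    · exact hB.ne_empty (sub_eq_one.1 h.2)
    · exact hB'.ne_empty (sub_eq_one.1 h.1)
  rcases P.rep_isWN.hasCut Set.univ hnt with h | h
  · exact key P.rep_isWN.swap hP' h
  · exact key P.rep_isWN (by rwa [mk_rep]) h

end WNP

end BInf

/-! ### Sums over ideals and the number of `h`-relations. -/

namespace BInf

open DoublePoset

namespace WNP

/-- The ideals of the double subposet of `P` on `C`. -/
noncomputable def ideals (P : DoublePoset) (C : Set P.carrier) : Finset (Set P.carrier) :=
  haveI := P.finite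
  (Set.toFinite {J | J ⊆ C ∧ ∀ x ∈ J, ∀ y ∈ C, P.le₁ x y → y ∈ J}).toFinset

theorem mem_ideals {P : DoublePoset} {C J : Set P.carrier} :
    J ∈ ideals P C ↔ J ⊆ C ∧ ∀ x ∈ J, ∀ y ∈ C, P.le₁ x y → y ∈ J := by
  simp [ideals]

variable {N : Type*} [AddCommMonoid N]

/-- The sum of `f (C ∖ J) J` over the ideals `J` of `C`. -/
noncomputable def isum (P : DoublePoset) (hP : P.IsWN) (C : Set P.carrier) (f : WNP → WNP → N) : N :=
  ∑ J ∈ ideals P C, f (sub P hP (C \ J)) (sub P hP J)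

/-- The sum of `f (R ∖ I) I` over the ideals `I` of `R`. -/
noncomputable def idealSum (R : WNP) (f : WNP → WNP → N) : N := isum R.rep R.rep_isWN Set.univ f

/-- Invariance under embeddings allows an ideal sum on an isoclass to be computed in any
representative, and on any subset of a larger poset. -/
theorem isum_image {P Q : DoublePoset} (hP : P.IsWN) (hQ : Q.IsWN) {g : P.carrier → Q.carrier}
    (hg : IsEmb P Q g) (C : Set P.carrier) (f : WNP → WNP → N) :
    isum Q hQ (g '' C) f = isum P hP C f := by
  symm
  refine Finset.sum_nbij' (fun J => g '' J) (fun J => g ⁻¹' J) ?_ ?_ ?_ ?_ ?_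
  · intro J hJ
    rw [mem_ideals] at hJ ⊢
    refine ⟨Set.image_mono hJ.1, ?_⟩
    rintro _ ⟨x, hx, rfl⟩ _ ⟨y, hy, rfl⟩ h
    exact ⟨y, hJ.2 x hx y hy ((hg x y).1.2 h), rfl⟩
  · intro J hJ
    rw [mem_ideals] at hJ ⊢
    refine ⟨fun x hx => ?_, fun x hx y hy h => hJ.2 _ hx _ ⟨y, hy, rfl⟩ ((hg x y).1.1 h)⟩
    obtain ⟨y, hy, h⟩ := hJ.1 hx
    exact hg.injective h ▸ hy
  · intro J _
    exact Set.preimage_image_eq _ hg.injective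
  · intro J hJ
    rw [mem_ideals] at hJ
    exact Set.image_preimage_eq_of_subset (hJ.1.trans (Set.image_subset_range _ _))
  · intro J hJ
    rw [sub_image hP hQ hg, ← Set.image_sdiff hg.injective, sub_image hP hQ hg]

theorem idealSum_mk (P : DoublePoset) (hP : P.IsWN) (f : WNP → WNP → N) :
    idealSum (mk P hP) f = isum P hP Set.univ f := by
  obtain ⟨e, he⟩ := rep_mk P hP
  rw [idealSum, ← isum_image (mk P hP).rep_isWN hP he, Set.image_univ, e.range_eq_univ]

theorem idealSum_sub (P : DoublePoset) (hP : P.IsWN) (C : Set P.carrier) (f : WNP → WNP → N) :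
    idealSum (sub P hP C) f = isum P hP C f := by
  let g : (P.restrict C).carrier → P.carrier := Subtype.val
  have hg : g '' Set.univ = C := by
    rw [Set.image_univ]; exact Subtype.range_val
  conv_rhs => rw [← hg]
  rw [sub, idealSum_mk, isum_image (hP.restrict C) hP (isEmb_val P C)]

/-- No `≤₁`-relation crosses the cut, so an ideal of the union is a pair of independent ideals. -/
theorem isum_union {P : DoublePoset} (hP : P.IsWN) {A B : Set P.carrier} (hd : Disjoint A B)
    (h : ∀ x ∈ A, ∀ y ∈ B, P.le₂ x y) (f : WNP → WNP → N) :
    isum P hP (A ∪ B) f =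
      isum P hP A fun a b => isum P hP B fun c d => f (a * c) (b * d) := by
  have hne : ∀ {x y}, x ∈ A → y ∈ B → x ≠ y := fun hx hy hxy =>
    Set.disjoint_left.1 hd hx (hxy ▸ hy)
  have h1 : ∀ {x y}, x ∈ A → y ∈ B → ¬ P.le₁ x y := fun hx hy h' =>
    hne hx hy (hP.1.eq_of_le (.inl h') (.inl (h _ hx _ hy)))
  have h1' : ∀ {x y}, x ∈ A → y ∈ B → ¬ P.le₁ y x := fun hx hy h' =>
    hne hx hy (hP.1.eq_of_le (.inr h') (.inl (h _ hx _ hy)))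
  simp only [isum]
  rw [← Finset.sum_product']
  refine Finset.sum_nbij' (fun J => (J ∩ A, J ∩ B)) (fun J => J.1 ∪ J.2) ?_ ?_ ?_ ?_ ?_
  · intro J hJ
    rw [Finset.mem_product, mem_ideals, mem_ideals]
    rw [mem_ideals] at hJ
    exact ⟨⟨Set.inter_subset_right, fun x hx y hy hxy => ⟨hJ.2 x hx.1 y (.inl hy) hxy, hy⟩⟩,
      ⟨Set.inter_subset_right, fun x hx y hy hxy => ⟨hJ.2 x hx.1 y (.inr hy) hxy, hy⟩⟩⟩
  · rintro ⟨J, L⟩ hJ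
    rw [Finset.mem_product, mem_ideals, mem_ideals] at hJ
    obtain ⟨⟨hJ1, hJ2⟩, hL1, hL2⟩ := hJ
    rw [mem_ideals]
    refine ⟨Set.union_subset_union hJ1 hL1, ?_⟩
    rintro x (hx | hx) y (hy | hy) hxy
    · exact .inl (hJ2 x hx y hy hxy)
    · exact (h1 (hJ1 hx) hy hxy).elim
    · exact (h1' hy (hL1 hx) hxy).elim
    · exact .inr (hL2 x hx y hy hxy)
  · intro J hJ
    rw [mem_ideals] at hJ
    rw [← Set.inter_union_distrib_left, Set.inter_eq_left.2 hJ.1]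
  · rintro ⟨J, L⟩ hJ
    rw [Finset.mem_product, mem_ideals, mem_ideals] at hJ
    obtain ⟨⟨hJ1, -⟩, hL1, -⟩ := hJ
    refine Prod.ext ?_ ?_ <;> ext x
    · have h2 := @hJ1 x
      have h3 := @hL1 x
      have h4 : x ∈ A → x ∉ B := fun h => Set.disjoint_left.1 hd h
      simp only [Set.mem_inter_iff, Set.mem_union] at *
      tauto
    · have h2 := @hJ1 x
      have h3 := @hL1 x
      have h4 : x ∈ A → x ∉ B := fun h => Set.disjoint_left.1 hd h
      simp only [Set.mem_inter_iff, Set.mem_union] at *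
      tauto
  · intro J hJ
    rw [mem_ideals] at hJ
    have e1 : (A ∪ B) \ J = A \ (J ∩ A) ∪ B \ (J ∩ B) := by
      ext x
      simp only [Set.mem_sdiff, Set.mem_union, Set.mem_inter_iff]
      tauto
    have e2 : J = J ∩ A ∪ J ∩ B := by
      rw [← Set.inter_union_distrib_left, Set.inter_eq_left.2 hJ.1]
    conv_lhs => rw [e1]
    conv_lhs => arg 2; rw [e2]
    rw [sub_union hP (hd.mono Set.sdiff_subset Set.sdiff_subset)
        fun x hx y hy => h x hx.1 y hy.1,
      sub_union hP (hd.mono Set.inter_subset_right Set.inter_subset_right)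
        fun x hx y hy => h x hx.2 y hy.2]

/-- This is the combinatorial form of the compatibility of `⋆` with `Δ`. -/
theorem idealSum_mul (Q R : WNP) (f : WNP → WNP → N) :
    idealSum (Q * R) f = idealSum Q fun a b => idealSum R fun c d => f (a * c) (b * d) := by
  obtain ⟨P, hP, A, hPA, rfl, rfl, hA⟩ := exists_sub_eq_mul Q R
  rw [← hPA, idealSum_mk, idealSum_sub]
  simp only [idealSum_sub]
  rw [← Set.union_compl_self A, isum_union hP disjoint_compl_right fun x hx y hy => hA x hx y hy]

/-- Both sides sum over the divisions of `R` into three successive layers, that is, over chains `J ⊆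
J ∪ L` of ideals. It becomes the associativity of `⋆`. -/
theorem idealSum_coassoc (R : WNP) (f : WNP → WNP → WNP → N) :
    (idealSum R fun s t => idealSum s fun a b => f a b t) =
      idealSum R fun s t => idealSum t fun a b => f s a b := by
  obtain ⟨P, hP, rfl⟩ : ∃ P hP, R = mk P hP := ⟨_, R.rep_isWN, (mk_rep R).symm⟩
  rw [idealSum_mk, idealSum_mk]
  simp only [isum, idealSum_sub]
  rw [Finset.sum_sigma', Finset.sum_sigma']
  refine Finset.sum_nbij' (fun J => ⟨J.1 ∪ J.2, J.1⟩) (fun J => ⟨J.2, J.1 \ J.2⟩) ?_ ?_ ?_ ?_ ?_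
  · rintro ⟨J, L⟩ h
    simp only [Finset.mem_sigma, mem_ideals, Set.subset_univ, true_and, Set.mem_univ,
      true_imp_iff, Set.mem_sdiff, Set.mem_union] at h ⊢
    obtain ⟨h1, h2, h3⟩ := h
    refine ⟨?_, Set.subset_union_left, fun x hx y _ hxy => h1 x hx y hxy⟩
    rintro x (hx | hx) y hxy
    · exact .inl (h1 x hx y hxy)
    · by_cases hy : y ∈ J
      · exact .inl hy
      · exact .inr (h3 x hx y hy hxy)
  · rintro ⟨J, L⟩ h
    simp only [Finset.mem_sigma, mem_ideals, Set.subset_univ, true_and, Set.mem_univ,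
      true_imp_iff, Set.mem_sdiff] at h ⊢
    obtain ⟨h1, h2, h3⟩ := h
    refine ⟨fun x hx y hxy => h3 x hx y (h1 x (h2 hx) y hxy) hxy, fun x hx => ⟨trivial, hx.2⟩, ?_⟩
    exact fun x hx y hy hxy => ⟨h1 x hx.1 y hxy, hy⟩
  · rintro ⟨J, L⟩ h
    simp only [Finset.mem_sigma, mem_ideals] at h
    refine Sigma.ext rfl (heq_of_eq ?_)
    ext x
    have := @h.2.1 x
    simp only [Set.mem_sdiff, Set.mem_union] at *
    tauto
  · rintro ⟨J, L⟩ h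
    simp only [Finset.mem_sigma, mem_ideals] at h
    refine Sigma.ext ?_ (heq_of_eq rfl)
    exact Set.union_sdiff_cancel h.2.1
  · rintro ⟨J, L⟩ h
    simp only [Finset.mem_sigma, mem_ideals] at h
    have e1 : (Set.univ \ J) \ L = Set.univ \ (J ∪ L) := by
      ext x; simp
    have e2 : (J ∪ L) \ J = L := by
      ext x
      have := @h.2.1 x
      simp only [Set.mem_sdiff, Set.mem_union] at *
      tauto
    simp only [e1, e2]

theorem idealSum_of_left (R : WNP) (f : WNP → WNP → N) (hf : ∀ a b, a ≠ 1 → f a b = 0) :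
    idealSum R f = f 1 R := by
  rw [idealSum, isum, Finset.sum_eq_single Set.univ]
  · rw [sub_rep_univ, Set.sdiff_self, sub_eq_one.2 rfl]
  · intro J _ hJ
    refine hf _ _ fun h => hJ ?_
    rw [sub_eq_one, Set.sdiff_eq_empty] at h
    exact Set.univ_subset_iff.1 h
  · intro h
    exact (h (mem_ideals.2 ⟨subset_rfl, fun _ _ _ h _ => h⟩)).elim

theorem idealSum_of_right (R : WNP) (f : WNP → WNP → N) (hf : ∀ a b, b ≠ 1 → f a b = 0) :
    idealSum R f = f R 1 := by
  rw [idealSum, isum, Finset.sum_eq_single ∅]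
  · rw [Set.sdiff_empty, sub_rep_univ, sub_eq_one.2 rfl]
  · intro J _ hJ
    exact hf _ _ fun h => hJ (sub_eq_one.1 h)
  · intro h
    exact (h (mem_ideals.2 ⟨Set.empty_subset _, fun _ h => h.elim⟩)).elim

-- Writing the structure constants as ideal sums of indicator functions makes the identities on
-- ideal sums available for `⋆`.
open Classical in
theorem numIdeals_eq (P Q R : WNP) :
    numIdeals P Q R = idealSum R fun a b => if a = P ∧ b = Q then 1 else 0 := by
  rw [idealSum, isum, Finset.sum_boole, Nat.cast_id, numIdeals, ← Set.ncard_coe_finset]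
  congr 1
  ext I
  have hs : ∀ (J : Set R.rep.carrier) (S : WNP),
      DoublePoset.Iso (R.rep.restrict J) S.rep ↔ sub R.rep R.rep_isWN J = S := fun J S => by
    conv_rhs => rw [← mk_rep S]
    exact mk_eq_mk.symm
  simp only [Finset.coe_filter, mem_ideals, Set.subset_univ, true_and, Set.mem_univ, true_imp_iff,
    hs, Set.compl_eq_univ_sdiff]
  rfl

/-- The number of pairs `(x, y)` with `x ≤₁ y` in `C`. -/
noncomputable def relCard (P : DoublePoset) (C : Set P.carrier) : ℕ :=
  {p : P.carrier × P.carrier | p.1 ∈ C ∧ p.2 ∈ C ∧ P.le₁ p.1 p.2}.ncard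

/-- The number of pairs `(x, y)` with `x ≤₁ y`. -/
noncomputable def hrel (R : WNP) : ℕ := relCard R.rep Set.univ

theorem relCard_image {P Q : DoublePoset} {g : P.carrier → Q.carrier}
    (hg : IsEmb P Q g) (C : Set P.carrier) : relCard Q (g '' C) = relCard P C := by
  rw [relCard, relCard, ← Set.ncard_image_of_injective _ (hg.injective.prodMap hg.injective)]
  congr 1
  ext ⟨x, y⟩
  constructor
  · rintro ⟨⟨a, ha, rfl⟩, ⟨b, hb, rfl⟩, h⟩
    exact ⟨(a, b), ⟨ha, hb, (hg a b).1.2 h⟩, rfl⟩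
  · rintro ⟨⟨a, b⟩, ⟨ha, hb, h⟩, he⟩
    cases he
    exact ⟨⟨a, ha, rfl⟩, ⟨b, hb, rfl⟩, (hg a b).1.1 h⟩

theorem hrel_sub (P : DoublePoset) (hP : P.IsWN) (C : Set P.carrier) :
    hrel (sub P hP C) = relCard P C := by
  obtain ⟨e, he⟩ := rep_mk (P.restrict C) (hP.restrict C)
  let g : (P.restrict C).carrier → P.carrier := Subtype.val
  have hg : g '' Set.univ = C := by
    rw [Set.image_univ]; exact Subtype.range_val
  conv_rhs => rw [← hg]
  rw [relCard_image (isEmb_val P C), hrel, ← e.range_eq_univ, ← Set.image_univ, relCard_image he]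
  rfl

/-- The relations of the union are those inside `A`, those inside `B`, and a subset of `A × B`. The
three conclusions bound this subset, characterize when it is full, and treat the case where it is
empty. -/
theorem relCard_union_le {P : DoublePoset} {A B : Set P.carrier} (hd : Disjoint A B)
    (h : ∀ x ∈ B, ∀ y ∈ A, ¬ P.le₁ x y) :
    relCard P (A ∪ B) ≤ relCard P A + relCard P B + A.ncard * B.ncard ∧
    (relCard P (A ∪ B) = relCard P A + relCard P B + A.ncard * B.ncard ↔
      ∀ x ∈ A, ∀ y ∈ B, P.le₁ x y) ∧
    ((∀ x ∈ A, ∀ y ∈ B, ¬ P.le₁ x y) → relCard P (A ∪ B) = relCard P A + relCard P B) := by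
  have := P.finite
  let X : Set P.carrier → Set P.carrier → Set (P.carrier × P.carrier) := fun C D =>
    {p | p.1 ∈ C ∧ p.2 ∈ D ∧ P.le₁ p.1 p.2}
  have hX : relCard P (A ∪ B) = relCard P A + relCard P B + (X A B).ncard := by
    have e : {p : P.carrier × P.carrier | p.1 ∈ A ∪ B ∧ p.2 ∈ A ∪ B ∧ P.le₁ p.1 p.2} =
        (X A A ∪ X B B) ∪ X A B := by
      ext ⟨x, y⟩
      have := fun hx => h x hx y
      simp only [X, Set.mem_union, Set.mem_ofPred_eq]
      tauto
    have hdd : ∀ x, x ∈ A → x ∈ B → False := fun x h h' => Set.disjoint_left.1 hd h h'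
    rw [relCard, e, Set.ncard_union_eq, Set.ncard_union_eq]
    · rfl
    · exact Set.disjoint_left.2 fun p hp hp' => hdd _ hp.1 hp'.1
    · refine Set.disjoint_left.2 ?_
      rintro p (hp | hp) hp'
      · exact hdd _ hp.2.1 hp'.2.1
      · exact hdd _ hp'.1 hp.1
  have hsub : X A B ⊆ A ×ˢ B := fun p hp => ⟨hp.1, hp.2.1⟩
  have hle := Set.ncard_le_ncard hsub
  rw [Set.ncard_prod] at hle
  refine ⟨by omega, ⟨fun h x hx y hy => ?_, fun h => ?_⟩, fun h => ?_⟩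
  · have he : X A B = A ×ˢ B := Set.eq_of_subset_of_ncard_le hsub (by rw [Set.ncard_prod]; omega)
    have : (x, y) ∈ X A B := he ▸ ⟨hx, hy⟩
    exact this.2.2
  · have he : X A B = A ×ˢ B := hsub.antisymm fun p hp => ⟨hp.1, hp.2, h _ hp.1 _ hp.2⟩
    rw [hX, he, Set.ncard_prod]
  · have he : X A B = ∅ := Set.eq_empty_of_forall_notMem fun p hp => h _ hp.1 _ hp.2.1 hp.2.2
    rw [hX, he, Set.ncard_empty, add_zero]

theorem hrel_mul (Q R : WNP) : hrel (Q * R) = hrel Q + hrel R := by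
  obtain ⟨P, hP, A, hPA, rfl, rfl, hA⟩ := exists_sub_eq_mul Q R
  have hne : ∀ {x y}, x ∈ A → y ∈ Aᶜ → x ≠ y := fun hx hy hxy => hy (hxy ▸ hx)
  rw [← hPA, ← sub_univ, ← Set.union_compl_self A, hrel_sub, hrel_sub, hrel_sub]
  refine (relCard_union_le disjoint_compl_right fun x hx y hy h => ?_).2.2 fun x hx y hy h => ?_
  · exact hne hy hx (hP.1.eq_of_le (.inr h) (.inl (hA y hy x hx)))
  · exact hne hx hy (hP.1.eq_of_le (.inl h) (.inl (hA x hx y hy)))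

/-- Reflexive pairs are counted, so `hrel` drops strictly on proper factors of either product and
can drive the later inductions. -/
theorem hrel_pos {P : WNP} (h : P ≠ 1) : 0 < hrel P := by
  have hfin := P.rep.finite
  have := P.rep.po₁
  obtain ⟨x⟩ : Nonempty P.rep.carrier := by
    by_contra hne
    exact h (eq_one_of_isEmpty (not_nonempty_iff.1 hne))
  rw [hrel, relCard, Set.ncard_pos]
  exact ⟨(x, x), trivial, trivial, refl_of P.rep.le₁ x⟩

theorem exists_sub_eq_stack (Q R : WNP) : ∃ (P : DoublePoset) (hP : P.IsWN) (A : Set P.carrier),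
    mk P hP = stack Q R ∧ sub P hP A = Q ∧ sub P hP Aᶜ = R ∧ ∀ x ∈ A, ∀ y ∉ A, P.le₁ x y := by
  obtain ⟨P, hP, A, h1, h2, h3, h4⟩ := exists_sub_eq_mul Q.swap R.swap
  refine ⟨P.swap, hP.swap, A, ?_, ?_, ?_, h4⟩
  · rw [stack, ← h1, swap_mk]
  · exact (swap_sub P hP A).symm.trans (by rw [h2, swap_swap])
  · exact (swap_sub P hP Aᶜ).symm.trans (by rw [h3, swap_swap])

theorem hrel_stack (Q R : WNP) : hrel (stack Q R) = hrel Q + hrel R + Q.card * R.card := by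
  obtain ⟨P, hP, A, hPA, rfl, rfl, hA⟩ := exists_sub_eq_stack Q R
  have := P.po₁
  rw [← hPA, ← sub_univ, ← Set.union_compl_self A, hrel_sub, hrel_sub, hrel_sub, card_sub, card_sub]
  refine (relCard_union_le disjoint_compl_right fun x hx y hy h => ?_).2.1.2 hA
  have := antisymm_of P.le₁ h (hA y hy x hx)
  exact hx (this ▸ hy)

theorem mk_eq_stack {P : DoublePoset} (hP : P.IsWN) {A B : Set P.carrier} (hd : Disjoint A B)
    (hAB : A ∪ B = Set.univ) (h : ∀ x ∈ A, ∀ y ∈ B, P.le₁ x y) :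
    mk P hP = stack (sub P hP A) (sub P hP B) := by
  apply swap_injective
  rw [swap_stack, swap_sub, swap_sub, ← sub_univ, ← hAB, swap_sub]
  exact sub_union hP.swap hd h

/-- The posets that appear in the product of `P` and `Q` for the ideals have at most as many
relations as `stack P Q`, with equality for `stack P Q` only. -/
theorem eq_stack_or_hrel_lt {P Q R : WNP} (h : numIdeals P Q R ≠ 0) :
    R = stack P Q ∨ hrel R < hrel (stack P Q) := by
  classical
  rw [numIdeals_eq, idealSum, isum] at h
  obtain ⟨J, hJ, h⟩ := Finset.exists_ne_zero_of_sum_ne_zero h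
  rw [mem_ideals] at hJ
  have hPQ := by_contra fun hn => h (if_neg hn)
  obtain ⟨rfl, rfl⟩ := hPQ
  have hu : Set.univ \ J ∪ J = Set.univ := Set.sdiff_union_of_subset (Set.subset_univ _)
  -- An ideal has no point below a point of its complement. Equality in the count means that the
  -- whole complement lies below the ideal, so `R` is the stack.
  have hl := relCard_union_le (P := R.rep) (A := Set.univ \ J) (B := J) Set.disjoint_sdiff_left
    fun x hx y hy hxy => hy.2 (hJ.2 x hx y trivial hxy)
  rw [hu] at hl
  rw [hrel_stack, hrel_sub, hrel_sub, card_sub, card_sub]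
  rcases hl.1.lt_or_eq with h | h
  · exact .inr h
  · left
    conv_lhs => rw [← mk_rep R]
    exact mk_eq_stack R.rep_isWN Set.disjoint_sdiff_left hu (hl.2.1.1 h)

/-- An ideal of a stack that meets the lower layer contains the upper one, so every ideal is
comparable with the upper layer for inclusion, and its cardinality decides. -/
theorem numIdeals_stack (P Q : WNP) : numIdeals P Q (stack P Q) = 1 := by
  classical
  rw [numIdeals_eq]
  obtain ⟨S, hS, A, hSA, rfl, rfl, hA⟩ := exists_sub_eq_stack P Q
  have hfin := S.finite
  have hanti := S.po₁
  rw [← hSA, idealSum_mk, isum, Finset.sum_eq_single Aᶜ]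
  · rw [if_pos ⟨by rw [← Set.compl_eq_univ_sdiff, compl_compl], rfl⟩]
  · intro J hJ hJA
    rw [mem_ideals] at hJ
    refine if_neg fun h => hJA ?_
    have hc := congrArg card h.2
    rw [card_sub, card_sub] at hc
    by_cases hJA' : J ⊆ Aᶜ
    · exact Set.eq_of_subset_of_ncard_le hJA' hc.ge
    · obtain ⟨x, hx, hxA⟩ := Set.not_subset.1 hJA'
      have hxA : x ∈ A := not_not.1 hxA
      exact (Set.eq_of_subset_of_ncard_le (fun y hy => hJ.2 x hx y trivial (hA x hxA y hy))
        hc.le).symm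
  · intro h
    refine (h (mem_ideals.2 ⟨Set.subset_univ _, fun x hx y _ hxy hy => ?_⟩)).elim
    have := antisymm_of S.le₁ hxy (hA y hy x hx)
    exact hx (this ▸ hy)

end WNP

end BInf

/-! ### Coefficients, associativity of `⋆`, primitive elements, and compatibility with `Δ`. -/

namespace BInf

namespace WNP

theorem idealSum_add {N : Type*} [AddCommMonoid N] (R : WNP) (f g : WNP → WNP → N) :
    idealSum R (fun a b => f a b + g a b) = idealSum R f + idealSum R g :=
  Finset.sum_add_distrib

theorem idealSum_mul_left {A : Type*} [NonUnitalNonAssocSemiring A] (R : WNP) (r : A)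
    (f : WNP → WNP → A) : idealSum R (fun a b => r * f a b) = r * idealSum R f :=
  (Finset.mul_sum _ _ _).symm

theorem idealSum_mul_right {A : Type*} [NonUnitalNonAssocSemiring A] (R : WNP) (r : A)
    (f : WNP → WNP → A) : idealSum R (fun a b => f a b * r) = idealSum R f * r :=
  (Finset.sum_mul _ _ _).symm

theorem map_idealSum {N N' : Type*} [AddCommMonoid N] [AddCommMonoid N'] (R : WNP) (φ : N →+ N')
    (f : WNP → WNP → N) : φ (idealSum R f) = idealSum R fun a b => φ (f a b) :=
  map_sum _ _ _

end WNP

open WNP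

variable {K : Type*} [Field K]

theorem HWNP.hom_ext {M : Type*} [AddCommGroup M] [Module K M] {f g : HWNP K →ₗ[K] M}
    (h : ∀ P : WNP, f (MonoidAlgebra.single P 1) = g (MonoidAlgebra.single P 1)) : f = g :=
  (MonoidAlgebra.basis WNP K).ext fun P => by simpa using h P

/-- The linear form giving a coefficient. -/
noncomputable def coeffHom (K : Type*) [Field K] (R : WNP) : HWNP K →ₗ[K] K where
  toFun x := x.coeff R
  map_add' _ _ := rfl
  map_smul' _ _ := rfl

theorem coeff_single_one (P R : WNP) [Decidable (R = P)] :
    (MonoidAlgebra.single P 1 : HWNP K).coeff R = if R = P then 1 else 0 := by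
  classical
  rw [MonoidAlgebra.coeff_single, Finsupp.single_apply]
  simp only [eq_comm]

theorem coeff_one (R : WNP) [Decidable (R = 1)] :
    (1 : HWNP K).coeff R = if R = 1 then 1 else 0 := coeff_single_one 1 R

theorem starProd_single (P Q : WNP) :
    starProd K (MonoidAlgebra.single P 1) (MonoidAlgebra.single Q 1) =
      ∑ R ∈ (finite_numIdeals P Q).toFinset,
        (numIdeals P Q R : K) • MonoidAlgebra.single R 1 := by
  rw [starProd, ← MonoidAlgebra.basis_apply, Module.Basis.constr_basis,
    ← MonoidAlgebra.basis_apply, Module.Basis.constr_basis]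

/-- The product `⋆` is dual to the splitting of a poset along its ideals; its properties are checked
coefficient by coefficient through this formula. -/
theorem coeff_starProd (x y : HWNP K) (R : WNP) :
    (starProd K x y).coeff R = idealSum R fun a b => x.coeff a * y.coeff b := by
  classical
  let F : HWNP K →ₗ[K] HWNP K →ₗ[K] K := LinearMap.mk₂ K
    (fun x y => idealSum R fun a b => x.coeff a * y.coeff b)
    (fun x x' y => by simp only [MonoidAlgebra.coeff_add, Finsupp.add_apply, add_mul, idealSum_add])
    (fun r x y => by
      simp only [MonoidAlgebra.coeff_smul, Finsupp.smul_apply, smul_eq_mul, mul_assoc,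
        idealSum_mul_left])
    (fun x y y' => by simp only [MonoidAlgebra.coeff_add, Finsupp.add_apply, mul_add, idealSum_add])
    (fun r x y => by
      simp only [MonoidAlgebra.coeff_smul, Finsupp.smul_apply, smul_eq_mul, mul_left_comm _ r,
        idealSum_mul_left])
  have h : (starProd K).compr₂ (coeffHom K R) = F := by
    refine HWNP.hom_ext fun P => HWNP.hom_ext fun Q => ?_
    change (starProd K (MonoidAlgebra.single P 1) (MonoidAlgebra.single Q 1)).coeff R =
      idealSum R fun a b => (MonoidAlgebra.single P 1 : HWNP K).coeff a *
        (MonoidAlgebra.single Q 1 : HWNP K).coeff b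
    simp only [coeff_single_one, ← ite_and, mul_ite, mul_one, mul_zero, ← ite_and]
    have h1 : (numIdeals P Q R : K) = idealSum R fun a b => if b = Q ∧ a = P then 1 else 0 := by
      rw [numIdeals_eq, ← Nat.coe_castAddMonoidHom, map_idealSum]
      congr! with a b
      simp [and_comm, apply_ite]
    rw [← h1, starProd_single, MonoidAlgebra.coeff_sum, Finsupp.finsetSum_apply]
    simp only [MonoidAlgebra.coeff_smul, Finsupp.smul_apply, coeff_single_one, smul_eq_mul, mul_ite,
      mul_one, mul_zero, Finset.sum_ite_eq]
    split_ifs with h2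
    · rfl
    · simp only [Set.Finite.mem_toFinset, Set.mem_ofPred_eq, not_not] at h2
      rw [h2, Nat.cast_zero]
  exact LinearMap.congr_fun₂ h x y

theorem HWNP.ext {x y : HWNP K} (h : ∀ R, x.coeff R = y.coeff R) : x = y :=
  MonoidAlgebra.coeff_injective (Finsupp.ext h)

theorem starProd_assoc (x y z : HWNP K) :
    starProd K (starProd K x y) z = starProd K x (starProd K y z) := by
  refine HWNP.ext fun R => ?_
  simp only [coeff_starProd, ← idealSum_mul_left, ← idealSum_mul_right]
  rw [idealSum_coassoc R fun a b c => x.coeff a * y.coeff b * z.coeff c]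
  simp only [mul_assoc]

theorem one_starProd (x : HWNP K) : starProd K 1 x = x := by
  classical
  refine HWNP.ext fun R => ?_
  rw [coeff_starProd, idealSum_of_left _ _ fun a b h => by simp [coeff_one, h]]
  simp

theorem starProd_one (x : HWNP K) : starProd K x 1 = x := by
  classical
  refine HWNP.ext fun R => ?_
  rw [coeff_starProd, idealSum_of_right _ _ fun a b h => by simp [coeff_one, h]]
  simp

/-- The coefficients of an element of `H ⊗ H`. -/
noncomputable def coeff₂ (t : HWNP K ⊗[K] HWNP K) (Q R : WNP) : K :=
  ((MonoidAlgebra.basis WNP K).tensorProduct (MonoidAlgebra.basis WNP K)).repr t (Q, R)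

@[simp] theorem coeff₂_tmul (x y : HWNP K) (Q R : WNP) :
    coeff₂ (x ⊗ₜ y) Q R = x.coeff Q * y.coeff R := by
  simp only [coeff₂, Module.Basis.tensorProduct_repr_tmul_apply]
  rw [smul_eq_mul, mul_comm]
  rfl

@[simp] theorem coeff₂_add (s t : HWNP K ⊗[K] HWNP K) (Q R : WNP) :
    coeff₂ (s + t) Q R = coeff₂ s Q R + coeff₂ t Q R := by simp [coeff₂]

@[simp] theorem coeff₂_zero (Q R : WNP) : coeff₂ (0 : HWNP K ⊗[K] HWNP K) Q R = 0 := by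
  simp [coeff₂]

theorem coeff₂_smul (r : K) (t : HWNP K ⊗[K] HWNP K) (Q R : WNP) :
    coeff₂ (r • t) Q R = r * coeff₂ t Q R := by simp [coeff₂]

theorem coeff₂_injective {s t : HWNP K ⊗[K] HWNP K} (h : ∀ Q R, coeff₂ s Q R = coeff₂ t Q R) :
    s = t := by
  refine ((MonoidAlgebra.basis WNP K).tensorProduct (MonoidAlgebra.basis WNP K)).repr.injective ?_
  exact Finsupp.ext fun p => h p.1 p.2

theorem comulWNP_single (P : WNP) :
    comulWNP K (MonoidAlgebra.single P 1) = ∑ p ∈ (finite_factorizations P).toFinset,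
      MonoidAlgebra.single p.1 1 ⊗ₜ[K] MonoidAlgebra.single p.2 1 := by
  rw [comulWNP, ← MonoidAlgebra.basis_apply, Module.Basis.constr_basis]

/-- This expresses the duality between `Δ` and the monoid product. -/
theorem coeff₂_comulWNP (x : HWNP K) (Q R : WNP) :
    coeff₂ (comulWNP K x) Q R = x.coeff (Q * R) := by
  classical
  let F : HWNP K →ₗ[K] K :=
    { toFun := fun x => coeff₂ (comulWNP K x) Q R
      map_add' := fun x y => by simp
      map_smul' := fun r x => by simp [coeff₂_smul] }
  have h : F = coeffHom K (Q * R) := by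
    refine HWNP.hom_ext fun P => ?_
    change coeff₂ (comulWNP K _) Q R = (MonoidAlgebra.single P 1 : HWNP K).coeff (Q * R)
    let G : HWNP K ⊗[K] HWNP K →+ K := ⟨⟨fun t => coeff₂ t Q R, coeff₂_zero Q R⟩,
      fun s t => coeff₂_add s t Q R⟩
    rw [comulWNP_single]
    change G _ = _
    rw [map_sum]
    change ∑ p ∈ _, coeff₂ _ Q R = _
    simp only [coeff₂_tmul, coeff_single_one, mul_ite, mul_one, mul_zero, ← ite_and]
    have : ∀ p : WNP × WNP, (R = p.2 ∧ Q = p.1) ↔ (Q, R) = p := fun p => by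
      rw [Prod.ext_iff, and_comm]
    simp only [this, Finset.sum_ite_eq, Set.Finite.mem_toFinset, Set.mem_ofPred_eq]
  exact LinearMap.congr_fun h x

/-- Comparing coefficients at `(Q, R)` with both factors nonempty shows that a primitive element has
coefficient zero at every decomposable poset. -/
theorem prim_eq_span : Prim K =
    Submodule.span K {x | ∃ P : WNP, P.HConnected ∧ x = MonoidAlgebra.single P 1} := by
  classical
  apply le_antisymm
  · intro x hx
    have hc : ∀ Q R, x.coeff (Q * R) =
        x.coeff Q * (1 : HWNP K).coeff R + (1 : HWNP K).coeff Q * x.coeff R := fun Q R => by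
      rw [← coeff₂_comulWNP, mem_prim.1 hx, coeff₂_add, coeff₂_tmul, coeff₂_tmul]
    simp only [coeff_one] at hc
    rw [← MonoidAlgebra.sum_coeff_single x]
    refine Submodule.sum_mem _ fun P hP => ?_
    have hP' : x.coeff P ≠ 0 := Finsupp.mem_support_iff.1 hP
    have : MonoidAlgebra.single P (x.coeff P) = x.coeff P • (MonoidAlgebra.single P 1 : HWNP K) := by
      rw [MonoidAlgebra.smul_single', mul_one]
    rw [this]
    refine Submodule.smul_mem _ _ (Submodule.subset_span ⟨P, ?_, rfl⟩)
    by_contra h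
    by_cases h1 : P = 1
    · subst h1
      -- At the empty poset the equation reads `c = c + c`, so `c = 0` in every characteristic.
      have := hc 1 1
      simp at this
      exact hP' this
    · obtain ⟨Q, R, hQ, hR, rfl⟩ := exists_mul_of_not_hConnected h1 h
      have := hc Q R
      simp only [hQ, hR, if_false, mul_zero, zero_mul, add_zero] at this
      exact hP' this
  · rw [Submodule.span_le]
    rintro _ ⟨P, hP, rfl⟩
    exact single_mem_prim K hP

theorem coeff₂_map_starProd (s t : HWNP K ⊗[K] HWNP K) (Q R : WNP) :
    coeff₂ (TensorProduct.map (TensorProduct.lift (starProd K)) (TensorProduct.lift (starProd K))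
      (TensorProduct.tensorTensorTensorComm K _ _ _ _ (s ⊗ₜ t))) Q R =
    idealSum Q fun a b => idealSum R fun c d => coeff₂ s a c * coeff₂ t b d := by
  induction s with
  | zero => simp [idealSum, isum]
  | add s s' h h' =>
    simp only [TensorProduct.add_tmul, map_add, coeff₂_add, h, h', add_mul, idealSum_add]
  | tmul x x' =>
    induction t with
    | zero => simp [idealSum, isum]
    | add s s' h h' =>
      simp only [TensorProduct.tmul_add, map_add, coeff₂_add, h, h', mul_add, idealSum_add]
    | tmul y y' =>
      simp only [TensorProduct.tensorTensorTensorComm_tmul, TensorProduct.map_tmul,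
        TensorProduct.lift.tmul, coeff₂_tmul, coeff_starProd]
      rw [← idealSum_mul_right]
      simp only [← idealSum_mul_left]
      simp only [mul_mul_mul_comm]

/-- The product `⋆` is compatible with the coproduct. -/
theorem comulWNP_starProd (x y : HWNP K) :
    comulWNP K (starProd K x y) =
      TensorProduct.map (TensorProduct.lift (starProd K)) (TensorProduct.lift (starProd K))
        (TensorProduct.tensorTensorTensorComm K _ _ _ _ (comulWNP K x ⊗ₜ comulWNP K y)) := by
  refine coeff₂_injective fun Q R => ?_
  -- At `(Q, R)` both sides are sums over the ideals of `Q · R`, seen as pairs of ideals.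
  rw [coeff₂_map_starProd, coeff₂_comulWNP, coeff_starProd, idealSum_mul]
  simp only [coeff₂_comulWNP]

end BInf

/-! ### The tensor coalgebra: heads of words, primitive elements, coalgebra morphisms. -/

namespace BInf

section TensorCoalgebra

variable {K V W : Type*} [Field K] [AddCommGroup V] [Module K V] [AddCommGroup W] [Module K W]

theorem counit_eq (w : TensorAlgebra K V) :
    Coalgebra.counit (R := K) w = TensorAlgebra.algebraMapInv w := rfl

theorem comul_eq (w : TensorAlgebra K V) : Coalgebra.comul (R := K) w = deconc K V w := rfl

@[simp] theorem algebraMapInv_ι (v : V) :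
    TensorAlgebra.algebraMapInv (TensorAlgebra.ι K v) = (0 : K) := by
  simp [TensorAlgebra.algebraMapInv]

/-- The projection on letters is the second component of an algebra morphism to the square-zero
extension of `K` by `V`, hence a derivation over the counit. -/
theorem ιInv_mul (a b : TensorAlgebra K V) :
    TensorAlgebra.ιInv (a * b) = TensorAlgebra.algebraMapInv a • TensorAlgebra.ιInv b +
      TensorAlgebra.algebraMapInv b • TensorAlgebra.ιInv a := by
  -- The square-zero extension needs a right action on `V`; it is the left action read through
  -- commutativity.
  let _ : Module Kᵐᵒᵖ V := Module.compHom _ ((RingHom.id K).fromOpposite mul_comm)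
  have : IsCentralScalar K V := ⟨fun r m => rfl⟩
  have h : ∀ a : TensorAlgebra K V,
      (TensorAlgebra.toTrivSqZeroExt a).fst = TensorAlgebra.algebraMapInv a := fun a => by
    have : (TrivSqZeroExt.fstHom K K V).comp TensorAlgebra.toTrivSqZeroExt =
        (TensorAlgebra.algebraMapInv : TensorAlgebra K V →ₐ[K] K) := by
      ext v
      simp
    exact DFunLike.congr_fun this a
  change (TensorAlgebra.toTrivSqZeroExt (a * b)).snd = _ • (TensorAlgebra.toTrivSqZeroExt b).snd +
    _ • (TensorAlgebra.toTrivSqZeroExt a).snd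
  rw [map_mul, TrivSqZeroExt.snd_mul, h, h]
  rfl

@[simp] theorem ιInv_one : TensorAlgebra.ιInv (1 : TensorAlgebra K V) = 0 := by
  have := ιInv_mul (1 : TensorAlgebra K V) 1
  simpa using this

@[simp] theorem ιInv_ι (v : V) : TensorAlgebra.ιInv (TensorAlgebra.ι K v) = v :=
  TensorAlgebra.ι_leftInverse v

theorem ιInv_ι_mul (v : V) (w : TensorAlgebra K V) :
    TensorAlgebra.ιInv (TensorAlgebra.ι K v * w) = TensorAlgebra.algebraMapInv w • v := by
  rw [ιInv_mul]; simp

/-- Linear maps on `T(V)` that agree on words are equal. -/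
theorem tensorAlgebra_hom_ext {M : Type*} [AddCommGroup M] [Module K M]
    {f g : TensorAlgebra K V →ₗ[K] M}
    (h : ∀ l : List V, f (l.map (TensorAlgebra.ι K)).prod = g (l.map (TensorAlgebra.ι K)).prod) :
    f = g := by
  -- A prefix is carried along, so that each letter split off from `w` can be moved into it.
  suffices H : ∀ (w : TensorAlgebra K V) (l : List V),
      f ((l.map (TensorAlgebra.ι K)).prod * w) = g ((l.map (TensorAlgebra.ι K)).prod * w) by
    ext w
    simpa using H w []
  intro w
  induction w using tensorAlgebra_left_induction with
  | one => intro l; simpa using h l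
  | cons v w ih =>
    intro l
    simpa [mul_assoc] using ih (l ++ [v])
  | add a b ha hb => intro l; simp only [mul_add, map_add, ha, hb]
  | smul r a ha => intro l; simp only [mul_smul_comm, map_smul, ha]

/-- The operator `a ⊗ b ↦ π(a) · b`, where `π` is the projection on `V`. -/
noncomputable def headMul (K V : Type*) [Field K] [AddCommGroup V] [Module K V] :
    TensorAlgebra K V ⊗[K] TensorAlgebra K V →ₗ[K] TensorAlgebra K V :=
  LinearMap.mul' K _ ∘ₗ (TensorAlgebra.ι K ∘ₗ TensorAlgebra.ιInv).rTensor _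

@[simp] theorem headMul_tmul (a b : TensorAlgebra K V) :
    headMul K V (a ⊗ₜ b) = TensorAlgebra.ι K (TensorAlgebra.ιInv a) * b := rfl

/-- Among the cuts of a nonempty word, only the one after the first letter survives the projection
of the left half on letters. An element is thus recovered from its counit and its coproduct. -/
theorem eq_counit_add_headMul (t : TensorAlgebra K V) :
    t = TensorAlgebra.algebraMapInv t • 1 + headMul K V (deconc K V t) := by
  induction t using tensorAlgebra_left_induction with
  | one => simp [deconc_one]
  | add a b ha hb =>
    conv_lhs => rw [ha, hb]
    simp only [map_add, add_smul]
    abel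
  | smul r a ha =>
    conv_lhs => rw [ha]
    simp only [map_smul, smul_add, smul_assoc]
  | cons v w ih =>
    have h : ∀ s : TensorAlgebra K V ⊗[K] TensorAlgebra K V,
        headMul K V ((TensorAlgebra.ι K v ⊗ₜ 1) * s) = TensorAlgebra.ι K v *
          TensorProduct.lid K _ ((TensorAlgebra.algebraMapInv.toLinearMap).rTensor _ s) := by
      intro s
      induction s with
      | zero => simp
      | add x y hx hy => simp only [mul_add, map_add, hx, hy]
      | tmul x y => simp [ιInv_ι_mul]
    have hc : (TensorAlgebra.algebraMapInv.toLinearMap).rTensor _ (deconc K V w) =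
      (1 : K) ⊗ₜ[K] w := Coalgebra.rTensor_counit_comul w
    rw [deconc_ι_mul, map_add, h, hc]
    simp

/-- For a primitive element the counit vanishes and the head formula leaves only the letter part. -/
theorem ι_ιInv_of_primitive {t : TensorAlgebra K V} (h : deconc K V t = t ⊗ₜ 1 + 1 ⊗ₜ t) :
    TensorAlgebra.ι K (TensorAlgebra.ιInv t) = t := by
  have hc : (TensorAlgebra.algebraMapInv.toLinearMap).rTensor _ (deconc K V t) =
    (1 : K) ⊗ₜ[K] t := Coalgebra.rTensor_counit_comul t
  have h0 : TensorAlgebra.algebraMapInv t • (1 : TensorAlgebra K V) = 0 := by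
    have := congrArg (TensorProduct.lid K _) hc
    rw [h] at this
    simpa using this
  have := eq_counit_add_headMul t
  rw [h0, h] at this
  simpa using this.symm

/-- A cut of `ab` falls inside `b` or inside `a`; the cut at the junction is counted twice, whence
the subtraction. -/
theorem deconc_mul (a b : TensorAlgebra K V) :
    deconc K V (a * b) = (a ⊗ₜ 1) * deconc K V b + deconc K V a * (1 ⊗ₜ b) - a ⊗ₜ b := by
  induction a using tensorAlgebra_left_induction with
  | one => simp [deconc_one, ← Algebra.TensorProduct.one_def]
  | add a a' ha hb => simp only [add_mul, map_add, ha, hb, TensorProduct.add_tmul]; abel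
  | smul r a ha =>
    simp only [smul_mul_assoc, map_smul, ha, ← TensorProduct.smul_tmul', smul_add, smul_sub]
  | cons v w ih =>
    rw [mul_assoc, deconc_ι_mul, ih, deconc_ι_mul, add_mul, mul_sub, mul_add]
    simp only [← mul_assoc, Algebra.TensorProduct.tmul_mul_tmul, one_mul, mul_one]
    abel

/-- The coalgebra morphism `T(φ) : T(V) → T(W)`. -/
noncomputable def mapT (φ : V →ₗ[K] W) : TensorAlgebra K V →ₐ[K] TensorAlgebra K W :=
  TensorAlgebra.lift K (TensorAlgebra.ι K ∘ₗ φ)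

@[simp] theorem mapT_ι (φ : V →ₗ[K] W) (v : V) :
    mapT φ (TensorAlgebra.ι K v) = TensorAlgebra.ι K (φ v) := by simp [mapT]

theorem mapT_word (φ : V →ₗ[K] W) (l : List V) :
    mapT φ (l.map (TensorAlgebra.ι K)).prod = ((l.map φ).map (TensorAlgebra.ι K)).prod := by
  induction l with
  | nil => simp
  | cons v l ih => simp only [List.map_cons, List.prod_cons, map_mul, ih, mapT_ι]

/-- `T(φ)` as a coalgebra morphism. -/
noncomputable def mapTc (φ : V →ₗ[K] W) : TensorAlgebra K V →ₗc[K] TensorAlgebra K W where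
  toLinearMap := (mapT φ).toLinearMap
  counit_comp := by
    have : (TensorAlgebra.algebraMapInv.comp (mapT φ) : TensorAlgebra K V →ₐ[K] K) =
        TensorAlgebra.algebraMapInv := by
      ext v; simp
    exact congrArg AlgHom.toLinearMap this
  map_comp_comul := by
    refine tensorAlgebra_hom_ext fun l => ?_
    simp only [LinearMap.comp_apply, AlgHom.toLinearMap_apply, comul_eq, mapT_word, deconc_word,
      map_sum, TensorProduct.map_tmul, List.length_map]
    simp only [List.map_take, List.map_drop]

@[simp] theorem mapTc_apply (φ : V →ₗ[K] W) (w : TensorAlgebra K V) : mapTc φ w = mapT φ w := rfl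

theorem algebraMapInv_mapT (φ : V →ₗ[K] W) (w : TensorAlgebra K V) :
    TensorAlgebra.algebraMapInv (mapT φ w) = TensorAlgebra.algebraMapInv w :=
  CoalgHomClass.counit_comp_apply (mapTc φ) w

theorem ιInv_mapT (φ : V →ₗ[K] W) (w : TensorAlgebra K V) :
    TensorAlgebra.ιInv (mapT φ w) = φ (TensorAlgebra.ιInv w) := by
  induction w using tensorAlgebra_left_induction with
  | one => simp
  | add a b ha hb => simp only [map_add, ha, hb]
  | smul r a ha => simp only [map_smul, ha]
  | cons v w ih => rw [map_mul, mapT_ι, ιInv_ι_mul, ιInv_ι_mul, algebraMapInv_mapT, map_smul]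

/-- The head formula applied to an image of `F`, with the coproduct pulled back through `F`, gives a
recursion on word lengths. -/
theorem coalgHom_word_tmul (F : TensorAlgebra K V ⊗[K] TensorAlgebra K V →ₗc[K] TensorAlgebra K W)
    (l m : List V) :
    F ((l.map (TensorAlgebra.ι K)).prod ⊗ₜ (m.map (TensorAlgebra.ι K)).prod) =
      Coalgebra.counit (R := K)
        ((l.map (TensorAlgebra.ι K)).prod ⊗ₜ[K] (m.map (TensorAlgebra.ι K)).prod) • 1 +
      ∑ i ∈ Finset.range (l.length + 1), ∑ j ∈ Finset.range (m.length + 1),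
        TensorAlgebra.ι K (TensorAlgebra.ιInv
          (F (((l.take i).map (TensorAlgebra.ι K)).prod ⊗ₜ
            ((m.take j).map (TensorAlgebra.ι K)).prod))) *
          F (((l.drop i).map (TensorAlgebra.ι K)).prod ⊗ₜ
            ((m.drop j).map (TensorAlgebra.ι K)).prod) := by
  conv_lhs => rw [eq_counit_add_headMul (F _)]
  rw [← counit_eq, CoalgHomClass.counit_comp_apply, ← comul_eq, ← CoalgHomClass.map_comp_comul_apply,
    TensorProduct.comul_tmul, comul_eq, comul_eq, deconc_word, deconc_word]
  simp only [TensorProduct.sum_tmul, TensorProduct.tmul_sum, map_sum]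
  simp [TensorProduct.AlgebraTensorModule.tensorTensorTensorComm_tmul]
  rw [Finset.sum_comm]

/-- A coalgebra morphism `T(V) ⊗ T(V) → T(W)` is determined by its projection on `W`. -/
theorem coalgHom_ext {F G : TensorAlgebra K V ⊗[K] TensorAlgebra K V →ₗc[K] TensorAlgebra K W}
    (hG : G (1 ⊗ₜ 1) = 1)
    (h : ∀ l m : List V, TensorAlgebra.ιInv
        (F ((l.map (TensorAlgebra.ι K)).prod ⊗ₜ (m.map (TensorAlgebra.ι K)).prod)) =
      TensorAlgebra.ιInv
        (G ((l.map (TensorAlgebra.ι K)).prod ⊗ₜ (m.map (TensorAlgebra.ι K)).prod)))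
    (a b : TensorAlgebra K V) : F (a ⊗ₜ b) = G (a ⊗ₜ b) := by
  have key : ∀ (n : ℕ) (l m : List V), l.length + m.length = n →
      F ((l.map (TensorAlgebra.ι K)).prod ⊗ₜ (m.map (TensorAlgebra.ι K)).prod) =
        G ((l.map (TensorAlgebra.ι K)).prod ⊗ₜ (m.map (TensorAlgebra.ι K)).prod) := by
    intro n
    induction n using Nat.strong_induction_on with
    | _ n ih =>
      intro l m hn
      rw [coalgHom_word_tmul F, coalgHom_word_tmul G]
      congr 1
      refine Finset.sum_congr rfl fun i hi => Finset.sum_congr rfl fun j hj => ?_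
      rw [h]
      rw [Finset.mem_range] at hi hj
      -- The term with empty prefixes still has full length, out of reach of the induction, but its
      -- head is the letter part of `1`, which is zero.
      by_cases hij : i = 0 ∧ j = 0
      · obtain ⟨rfl, rfl⟩ := hij
        simp [hG]
      · rw [ih ((l.drop i).length + (m.drop j).length) (by
          rw [List.length_drop, List.length_drop]; omega) _ _ rfl]
  have h2 : (TensorProduct.mk K _ _).compr₂ F.toLinearMap =
      (TensorProduct.mk K _ _).compr₂ G.toLinearMap := by
    refine tensorAlgebra_hom_ext fun l => tensorAlgebra_hom_ext fun m => ?_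
    exact key _ l m rfl
  exact LinearMap.congr_fun₂ h2 a b

theorem word_eq_tprod (l : List V) :
    (l.map (TensorAlgebra.ι K)).prod = TensorAlgebra.tprod K V l.length l.get := by
  rw [TensorAlgebra.tprod_apply]
  congr 1
  conv_lhs => rw [← List.ofFn_get l]
  rw [List.map_ofFn]
  rfl

/-- Morphisms of `B_∞`-algebras are compatible with the products of the tensor coalgebras. -/
theorem IsBInftyHom.mapT_star {brV : Brackets K V} {brW : Brackets K W} {φ : V →ₗ[K] W}
    (hφ : IsBInftyHom brV brW φ)
    {starV : TensorAlgebra K V ⊗[K] TensorAlgebra K V →ₗc[K] TensorAlgebra K V}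
    (hV : IsHopfProduct starV)
    (hbV : ∀ (m n : ℕ+) (x : Fin m → V) (y : Fin n → V),
      TensorAlgebra.ιInv (starV (TensorAlgebra.tprod K V m x ⊗ₜ TensorAlgebra.tprod K V n y)) =
        brV m n (PiTensorProduct.tprod K x ⊗ₜ PiTensorProduct.tprod K y))
    {starW : TensorAlgebra K W ⊗[K] TensorAlgebra K W →ₗc[K] TensorAlgebra K W}
    (hW : IsHopfProduct starW)
    (hbW : ∀ (m n : ℕ+) (x : Fin m → W) (y : Fin n → W),
      TensorAlgebra.ιInv (starW (TensorAlgebra.tprod K W m x ⊗ₜ TensorAlgebra.tprod K W n y)) =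
        brW m n (PiTensorProduct.tprod K x ⊗ₜ PiTensorProduct.tprod K y))
    (a b : TensorAlgebra K V) :
    mapT φ (starV (a ⊗ₜ b)) = starW (mapT φ a ⊗ₜ mapT φ b) := by
  refine coalgHom_ext (F := (mapTc φ).comp starV)
    (G := starW.comp (Coalgebra.TensorProduct.map (mapTc φ) (mapTc φ))) ?_ ?_ a b
  · simp [hW.one_star]
  · intro l m
    simp only [CoalgHom.comp_apply, Coalgebra.TensorProduct.map_tmul, mapTc_apply]
    -- The brackets only see nonempty words; the other cases follow from the unit laws.
    rcases eq_or_ne l [] with rfl | hl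
    · simp [hV.one_star, hW.one_star]
    rcases eq_or_ne m [] with rfl | hm
    · simp [hV.star_one, hW.star_one]
    have hl' := List.length_pos_of_ne_nil hl
    have hm' := List.length_pos_of_ne_nil hm
    have e1 := hbV ⟨l.length, hl'⟩ ⟨m.length, hm'⟩ l.get m.get
    have e2 := hbW ⟨l.length, hl'⟩ ⟨m.length, hm'⟩ (fun i => φ (l.get i)) (fun i => φ (m.get i))
    have e3 := hφ ⟨l.length, hl'⟩ ⟨m.length, hm'⟩ l.get m.get
    have hw : ∀ l : List V, mapT φ (l.map (TensorAlgebra.ι K)).prod =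
        TensorAlgebra.tprod K W l.length fun i => φ (l.get i) := fun l => by
      rw [word_eq_tprod, TensorAlgebra.tprod_apply, TensorAlgebra.tprod_apply, map_list_prod,
        List.map_ofFn]
      simp [Function.comp_def]
    rw [ιInv_mapT, hw, hw, word_eq_tprod, word_eq_tprod]
    exact (congrArg φ e1).trans (e3.trans e2.symm)

end TensorCoalgebra

end BInf

/-! ### Identification of `H_WNP` with the tensor coalgebra on its primitive elements. -/

namespace BInf

open WNP

/-- The monoid of WN posets is free on the `h`-connected ones. -/
noncomputable def freeMonoidEquiv : FreeMonoid {P : WNP // P.HConnected} ≃* WNP :=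
  MulEquiv.ofBijective (FreeMonoid.lift Subtype.val) <| by
    constructor
    · intro l
      induction l using FreeMonoid.inductionOn' with
      | one =>
        intro m h
        induction m using FreeMonoid.inductionOn' with
        | one => rfl
        | of_mul P m _ =>
          rw [map_one, map_mul, FreeMonoid.lift_eval_of] at h
          exact (ne_one_of_hConnected P.2 (mul_eq_one.1 h.symm).1).elim
      | of_mul P l ih =>
        intro m h
        induction m using FreeMonoid.inductionOn' with
        | one =>
          rw [map_one, map_mul, FreeMonoid.lift_eval_of] at h
          exact (ne_one_of_hConnected P.2 (mul_eq_one.1 h).1).elim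
        | of_mul Q m _ =>
          rw [map_mul, map_mul, FreeMonoid.lift_eval_of, FreeMonoid.lift_eval_of] at h
          obtain ⟨h1, h2⟩ := hConnected_mul_inj P.2 Q.2 h
          rw [Subtype.ext h1, ih h2]
    · intro P
      induction hn : P.card using Nat.strong_induction_on generalizing P with
      | _ n ih =>
        by_cases h1 : P = 1
        · exact ⟨1, by rw [h1, map_one]⟩
        · obtain ⟨Q, R, hQ, rfl⟩ := exists_hConnected_mul h1
          have hQ' := mt card_eq_zero.1 (ne_one_of_hConnected hQ)
          obtain ⟨l, rfl⟩ := ih R.card (by rw [← hn, card_mul]; omega) R rfl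
          exact ⟨FreeMonoid.of ⟨Q, hQ⟩ * l, by rw [map_mul, FreeMonoid.lift_eval_of]⟩

variable {K : Type*} [Field K]

/-- An `h`-connected poset as a primitive element. -/
noncomputable def primSingle (K : Type*) [Field K] (P : {P : WNP // P.HConnected}) : Prim K :=
  ⟨MonoidAlgebra.single P.1 1, single_mem_prim K P.2⟩

theorem prim_induction {C : Prim K → Prop} (single : ∀ P, C (primSingle K P)) (zero : C 0)
    (add : ∀ x y, C x → C y → C (x + y)) (smul : ∀ (r : K) x, C x → C (r • x)) (x : Prim K) :
    C x := by
  have key : ∀ x ∈ Submodule.span K {x | ∃ P : WNP, P.HConnected ∧ x = MonoidAlgebra.single P 1},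
      ∃ hx : x ∈ Prim K, C ⟨x, hx⟩ := by
    intro x hx
    induction hx using Submodule.span_induction with
    | mem x hx =>
      obtain ⟨P, hP, rfl⟩ := hx
      exact ⟨single_mem_prim K hP, single ⟨P, hP⟩⟩
    | zero => exact ⟨zero_mem _, zero⟩
    | add x y _ _ h1 h2 =>
      obtain ⟨hx, h1⟩ := h1
      obtain ⟨hy, h2⟩ := h2
      exact ⟨add_mem hx hy, add _ _ h1 h2⟩
    | smul r x _ h1 =>
      obtain ⟨hx, h1⟩ := h1
      exact ⟨Submodule.smul_mem _ r hx, smul r _ h1⟩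
  exact (key x (prim_eq_span (K := K) ▸ x.2)).2

theorem HWNP.induction {C : HWNP K → Prop} (single : ∀ P, C (MonoidAlgebra.single P 1))
    (zero : C 0) (add : ∀ x y, C x → C y → C (x + y)) (smul : ∀ (r : K) x, C x → C (r • x))
    (x : HWNP K) : C x := by
  induction x using MonoidAlgebra.induction_linear with
  | zero => exact zero
  | add x y hx hy => exact add x y hx hy
  | single P r =>
    have := smul r _ (single P)
    rwa [MonoidAlgebra.smul_single', mul_one] at this

theorem prim_hom_ext {M : Type*} [AddCommGroup M] [Module K M] {f g : Prim K →ₗ[K] M}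
    (h : ∀ P, f (primSingle K P) = g (primSingle K P)) : f = g := by
  ext x
  induction x using prim_induction with
  | single P => exact h P
  | zero => rw [map_zero, map_zero]
  | add x y hx hy => rw [map_add, map_add, hx, hy]
  | smul r x hx => rw [map_smul, map_smul, hx]

/-- The algebra morphism `T(Prim(H)) → H` given by the product of `H`. -/
noncomputable def fromT (K : Type*) [Field K] : TensorAlgebra K (Prim K) →ₐ[K] HWNP K :=
  TensorAlgebra.lift K (Prim K).subtype

@[simp] theorem fromT_ι (x : Prim K) : fromT K (TensorAlgebra.ι K x) = x := by simp [fromT]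

/-- The inverse of `fromT`. -/
noncomputable def toT (K : Type*) [Field K] : HWNP K →ₐ[K] TensorAlgebra K (Prim K) :=
  MonoidAlgebra.lift K (TensorAlgebra K (Prim K)) WNP
    ((FreeMonoid.lift fun P => TensorAlgebra.ι K (primSingle K P)).comp
      freeMonoidEquiv.symm.toMonoidHom)

theorem freeMonoidEquiv_symm_of (P : {P : WNP // P.HConnected}) :
    freeMonoidEquiv.symm P.1 = FreeMonoid.of P := by
  rw [MulEquiv.symm_apply_eq]
  exact (FreeMonoid.lift_eval_of _ _).symm

theorem toT_single (P : {P : WNP // P.HConnected}) :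
    toT K (MonoidAlgebra.single P.1 1) = TensorAlgebra.ι K (primSingle K P) := by
  rw [toT, MonoidAlgebra.lift_single, one_smul, MonoidHom.comp_apply]
  change FreeMonoid.lift _ (freeMonoidEquiv.symm P.1) = _
  rw [freeMonoidEquiv_symm_of, FreeMonoid.lift_eval_of]

theorem toT_prim (x : Prim K) : toT K x = TensorAlgebra.ι K x := by
  have : (toT K).toLinearMap ∘ₗ (Prim K).subtype = TensorAlgebra.ι K :=
    prim_hom_ext fun P => toT_single P
  exact LinearMap.congr_fun this x

theorem toT_fromT (w : TensorAlgebra K (Prim K)) : toT K (fromT K w) = w := by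
  have : (toT K).comp (fromT K) = AlgHom.id K _ := by
    ext x
    simp [toT_prim]
  exact DFunLike.congr_fun this w

theorem fromT_toT (x : HWNP K) : fromT K (toT K x) = x := by
  have : (fromT K).toLinearMap ∘ₗ (toT K).toLinearMap = LinearMap.id := by
    refine HWNP.hom_ext fun P => ?_
    obtain ⟨l, rfl⟩ := freeMonoidEquiv.surjective P
    change fromT K (toT K _) = MonoidAlgebra.single _ 1
    induction l using FreeMonoid.inductionOn' with
    | one => rw [map_one, ← MonoidAlgebra.one_def, map_one, map_one]
    | of_mul P l ih =>
      have h1 : (MonoidAlgebra.single (freeMonoidEquiv (FreeMonoid.of P * l)) 1 : HWNP K) =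
          MonoidAlgebra.single P.1 1 * MonoidAlgebra.single (freeMonoidEquiv l) 1 := by
        rw [MonoidAlgebra.single_mul_single, map_mul, one_mul]
        congr 2
      rw [h1, map_mul, map_mul, ih, toT_single, fromT_ι]
      rfl
  exact LinearMap.congr_fun this x

theorem coeff_one_prim_mul (x : Prim K) (y : HWNP K) : ((x : HWNP K) * y).coeff 1 = 0 := by
  induction x using prim_induction with
  | single P =>
    exact MonoidAlgebra.coeff_single_mul_of_forall_mul_ne _ _ fun d h =>
      ne_one_of_hConnected P.2 (mul_eq_one.1 h).1
  | zero => simp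
  | add x x' hx hx' => simp [add_mul, hx, hx']
  | smul r x hx => simp [hx]

theorem coeff_one_fromT (w : TensorAlgebra K (Prim K)) :
    (fromT K w).coeff 1 = TensorAlgebra.algebraMapInv w := by
  classical
  induction w using tensorAlgebra_left_induction with
  | one => simp
  | add a b ha hb => simp only [map_add, ← ha, ← hb]; rfl
  | smul r a ha => simp only [map_smul, ← ha]; rfl
  | cons v w ih => simp [coeff_one_prim_mul]

open Classical in
theorem primProj_single (P : WNP) : primProj K (MonoidAlgebra.single P 1) =
    if hP : P.HConnected then primSingle K ⟨P, hP⟩ else 0 := by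
  rw [primProj, ← MonoidAlgebra.basis_apply, Module.Basis.constr_basis]
  rfl

theorem primProj_one : primProj K (1 : HWNP K) = 0 := by
  rw [MonoidAlgebra.one_def, primProj_single, dif_neg fun h => ne_one_of_hConnected h rfl]

/-- For `P` `h`-connected, `P · Q` is `h`-connected only when `Q` is empty. This is the counterpart
of `ιInv_ι_mul`. -/
theorem primProj_prim_mul (x : Prim K) (y : HWNP K) :
    primProj K ((x : HWNP K) * y) = y.coeff 1 • x := by
  classical
  have key : ∀ (P : {P : WNP // P.HConnected}) (Q : WNP),
      primProj K (MonoidAlgebra.single P.1 1 * MonoidAlgebra.single Q 1) =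
        (MonoidAlgebra.single Q 1 : HWNP K).coeff 1 • primSingle K P := by
    intro P Q
    rw [MonoidAlgebra.single_mul_single, one_mul, primProj_single, coeff_single_one]
    by_cases hQ : Q = 1
    · subst hQ
      simp only [mul_one, P.2, dif_pos, if_true, one_smul]
    · rw [dif_neg, if_neg (Ne.symm hQ), zero_smul]
      intro h
      rcases (mul_eq_iff_of_hConnected h).1 rfl with h | h
      · exact hQ h.2
      · exact ne_one_of_hConnected P.2 h.1
  induction x using prim_induction with
  | zero => simp
  | add x x' hx hx' => simp only [Submodule.coe_add, add_mul, map_add, hx, hx', smul_add]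
  | smul r x hx =>
    simp only [Submodule.coe_smul, smul_mul_assoc, map_smul, hx, smul_comm r]
  | single P =>
    induction y using HWNP.induction with
    | single Q => exact key P Q
    | zero => simp
    | add y y' hy hy' =>
      simp only [mul_add, map_add, hy, hy', MonoidAlgebra.coeff_add, Finsupp.add_apply, add_smul]
    | smul r y hy =>
      simp only [mul_smul_comm, map_smul, hy, MonoidAlgebra.coeff_smul, Finsupp.smul_apply,
        smul_assoc]

theorem primProj_fromT (w : TensorAlgebra K (Prim K)) :
    primProj K (fromT K w) = TensorAlgebra.ιInv w := by
  induction w using tensorAlgebra_left_induction with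
  | one => rw [map_one, primProj_one, ιInv_one]
  | add a b ha hb => simp only [map_add, ha, hb]
  | smul r a ha => simp only [map_smul, ha]
  | cons v w ih => rw [map_mul, fromT_ι, primProj_prim_mul, coeff_one_fromT, ιInv_ι_mul]

theorem comulWNP_one : comulWNP K (1 : HWNP K) = 1 ⊗ₜ 1 := by
  classical
  refine coeff₂_injective fun Q R => ?_
  rw [coeff₂_comulWNP, coeff₂_tmul, coeff_one, coeff_one, coeff_one, ite_zero_mul_ite_zero]
  simp [mul_eq_one]

/-- This is the recursion that defines deconcatenation, which makes `fromT` a coalgebra morphism. -/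
theorem comulWNP_prim_mul (x : Prim K) (y : HWNP K) :
    comulWNP K ((x : HWNP K) * y) =
      ((x : HWNP K) ⊗ₜ 1) * comulWNP K y + 1 ⊗ₜ ((x : HWNP K) * y) := by
  classical
  have key : ∀ (P : {P : WNP // P.HConnected}) (Q : WNP),
      comulWNP K (MonoidAlgebra.single P.1 1 * MonoidAlgebra.single Q 1) =
        (MonoidAlgebra.single P.1 1 ⊗ₜ 1) * comulWNP K (MonoidAlgebra.single Q 1) +
          1 ⊗ₜ (MonoidAlgebra.single P.1 1 * MonoidAlgebra.single Q 1) := by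
    intro P Q
    -- By Levi's lemma an indecomposable `P` stays whole: it goes right together with all of `Q`, or
    -- it goes left and `Q` is then factored.
    have hf : (finite_factorizations (P.1 * Q)).toFinset = insert (1, P.1 * Q)
        ((finite_factorizations Q).toFinset.image fun p => (P.1 * p.1, p.2)) := by
      ext ⟨A, B⟩
      simp only [Set.Finite.mem_toFinset, Set.mem_ofPred_eq, Finset.mem_insert, Finset.mem_image,
        Prod.mk.injEq, Prod.exists]
      constructor
      · intro h
        obtain ⟨T, ⟨h1, h2⟩ | ⟨h1, h2⟩⟩ := levi h
        · rcases (mul_eq_iff_of_hConnected P.2).1 h1.symm with ⟨h3, h4⟩ | ⟨h3, h4⟩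
          · right
            exact ⟨1, Q, one_mul Q, by rw [mul_one, h3], by rw [h2, h4, one_mul]⟩
          · left
            exact ⟨h3, by rw [h2, h4]⟩
        · exact .inr ⟨T, B, h2.symm, h1.symm, rfl⟩
      · rintro (⟨rfl, rfl⟩ | ⟨a, b, h, rfl, rfl⟩)
        · rw [one_mul]
        · rw [mul_assoc, h]
    rw [MonoidAlgebra.single_mul_single, one_mul, comulWNP_single, hf, Finset.sum_insert,
      Finset.sum_image, comulWNP_single, Finset.mul_sum, add_comm]
    · congr 1
      refine Finset.sum_congr rfl fun p _ => ?_
      rw [Algebra.TensorProduct.tmul_mul_tmul, MonoidAlgebra.single_mul_single, one_mul, one_mul]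
    · rintro ⟨a, b⟩ _ ⟨c, d⟩ _ h
      simp only [Prod.mk.injEq] at h
      rw [mul_left_cancel' h.1, h.2]
    · simp only [Finset.mem_image, not_exists, Prod.mk.injEq]
      rintro p ⟨-, h, -⟩
      exact ne_one_of_hConnected P.2 (mul_eq_one.1 h).1
  induction x using prim_induction with
  | zero => simp
  | add x x' hx hx' =>
    simp only [Submodule.coe_add, add_mul, map_add, hx, hx', TensorProduct.add_tmul,
      TensorProduct.tmul_add]
    abel
  | smul r x hx =>
    simp only [Submodule.coe_smul, smul_mul_assoc, map_smul, hx, ← TensorProduct.smul_tmul',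
      TensorProduct.tmul_smul, smul_add]
  | single P =>
    induction y using HWNP.induction with
    | single Q => exact key P Q
    | zero => simp
    | add y y' hy hy' =>
      simp only [mul_add, map_add, hy, hy', TensorProduct.tmul_add]
      abel
    | smul r y hy =>
      simp only [mul_smul_comm, map_smul, hy, TensorProduct.tmul_smul, smul_add]

theorem comulWNP_fromT (w : TensorAlgebra K (Prim K)) :
    comulWNP K (fromT K w) =
      TensorProduct.map (fromT K).toLinearMap (fromT K).toLinearMap (deconc K _ w) := by
  induction w using tensorAlgebra_left_induction with
  | one => rw [map_one, comulWNP_one, deconc_one]; simp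
  | add a b ha hb => simp only [map_add, ha, hb]
  | smul r a ha => simp only [map_smul, ha]
  | cons v w ih =>
    rw [map_mul, fromT_ι, comulWNP_prim_mul, ih, deconc_ι_mul, map_add]
    congr 1
    · induction deconc K (Prim K) w with
      | zero => simp
      | add x y hx hy => simp only [mul_add, map_add, hx, hy]
      | tmul x y => simp
    · simp

theorem deconc_toT (x : HWNP K) :
    deconc K _ (toT K x) =
      TensorProduct.map (toT K).toLinearMap (toT K).toLinearMap (comulWNP K x) := by
  conv_rhs => rw [← fromT_toT x, comulWNP_fromT]
  induction deconc K (Prim K) (toT K x) with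
  | zero => simp
  | add x y hx hy => simp only [map_add, ← hx, ← hy]
  | tmul x y => simp [toT_fromT]

end BInf

/-! ### The Hopf algebra `T(Prim)` for `⋆`, and its brackets. -/

namespace BInf

open WNP

namespace WNP

theorem idealSum_one {N : Type*} [AddCommMonoid N] (f : WNP → WNP → N) :
    idealSum 1 f = f 1 1 := by
  have hfin := (1 : WNP).rep.finite
  have h0 : IsEmpty (1 : WNP).rep.carrier := Finite.card_eq_zero_iff.1 card_one
  rw [idealSum, isum, Finset.sum_eq_single ∅]
  · rw [sub_eq_one.2 (Set.eq_empty_of_isEmpty _), sub_eq_one.2 (Set.eq_empty_of_isEmpty _)]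
  · intro J _ hJ
    exact (hJ (Set.eq_empty_of_isEmpty J)).elim
  · intro h
    exact (h (mem_ideals.2 ⟨Set.empty_subset _, fun _ h => h.elim⟩)).elim

end WNP

variable {K : Type*} [Field K]

theorem coeff_one_toT (x : HWNP K) : TensorAlgebra.algebraMapInv (toT K x) = x.coeff 1 := by
  rw [← coeff_one_fromT, fromT_toT]

/-- The product `⋆` on `T(Prim(H))`. -/
noncomputable def starT (K : Type*) [Field K] :
    TensorAlgebra K (Prim K) ⊗[K] TensorAlgebra K (Prim K) →ₗ[K] TensorAlgebra K (Prim K) :=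
  (toT K).toLinearMap ∘ₗ TensorProduct.lift (starProd K) ∘ₗ
    TensorProduct.map (fromT K).toLinearMap (fromT K).toLinearMap

theorem starT_tmul (a b : TensorAlgebra K (Prim K)) :
    starT K (a ⊗ₜ b) = toT K (starProd K (fromT K a) (fromT K b)) := rfl

theorem map_toT_map_starProd (s t : TensorAlgebra K (Prim K) ⊗[K] TensorAlgebra K (Prim K)) :
    TensorProduct.map (toT K).toLinearMap (toT K).toLinearMap
      (TensorProduct.map (TensorProduct.lift (starProd K)) (TensorProduct.lift (starProd K))
        (TensorProduct.tensorTensorTensorComm K _ _ _ _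
          (TensorProduct.map (fromT K).toLinearMap (fromT K).toLinearMap s ⊗ₜ
            TensorProduct.map (fromT K).toLinearMap (fromT K).toLinearMap t))) =
    TensorProduct.map (starT K) (starT K)
      (TensorProduct.tensorTensorTensorComm K _ _ _ _ (s ⊗ₜ t)) := by
  induction s with
  | zero => simp
  | add s s' h h' => simp only [TensorProduct.add_tmul, map_add, h, h']
  | tmul x x' =>
    induction t with
    | zero => simp
    | add s s' h h' => simp only [TensorProduct.tmul_add, map_add, h, h']
    | tmul y y' => simp [starT_tmul]

/-- The product `⋆` on `T(Prim(H))` as a coalgebra morphism. -/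
noncomputable def starTc (K : Type*) [Field K] :
    TensorAlgebra K (Prim K) ⊗[K] TensorAlgebra K (Prim K) →ₗc[K] TensorAlgebra K (Prim K) where
  toLinearMap := starT K
  counit_comp := by
    refine TensorProduct.ext' fun a b => ?_
    rw [LinearMap.comp_apply, starT_tmul, counit_eq, coeff_one_toT, coeff_starProd, idealSum_one,
      coeff_one_fromT, coeff_one_fromT, TensorProduct.counit_tmul]
    simp [counit_eq, mul_comm]
  map_comp_comul := by
    refine TensorProduct.ext' fun a b => ?_
    rw [LinearMap.comp_apply, LinearMap.comp_apply, starT_tmul, comul_eq, deconc_toT,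
      comulWNP_starProd, comulWNP_fromT, comulWNP_fromT, map_toT_map_starProd]
    rfl

theorem starTc_tmul (a b : TensorAlgebra K (Prim K)) :
    starTc K (a ⊗ₜ b) = toT K (starProd K (fromT K a) (fromT K b)) := rfl

/-! ### The antipode -/

/-- The space `H_WNP` seen as an algebra for the product `⋆`. -/
def HStar (K : Type*) [Field K] := HWNP K

noncomputable instance : AddCommGroup (HStar K) := inferInstanceAs (AddCommGroup (HWNP K))

noncomputable instance : Module K (HStar K) := inferInstanceAs (Module K (HWNP K))

noncomputable instance : Ring (HStar K) :=
  { (inferInstance : AddCommGroup (HStar K)) with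
    mul := fun x y => starProd K x y
    one := (1 : HWNP K)
    mul_assoc := starProd_assoc (K := K)
    one_mul := one_starProd (K := K)
    mul_one := starProd_one (K := K)
    left_distrib := fun x y z => map_add (starProd K x) y z
    right_distrib := fun x y z => LinearMap.map_add₂ (starProd K) x y z
    zero_mul := fun x => LinearMap.map_zero₂ (starProd K) x
    mul_zero := fun x => map_zero (starProd K x) }

noncomputable instance : Algebra K (HStar K) :=
  Algebra.ofModule (fun r x y => LinearMap.map_smul₂ (starProd K) r x y)
    (fun r x y => map_smul (starProd K x) r y)

/-- `toT` on the basis of posets. -/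
noncomputable def wordT (K : Type*) [Field K] (P : WNP) : TensorAlgebra K (Prim K) :=
  toT K (MonoidAlgebra.single P 1)

theorem wordT_one : wordT K 1 = 1 := by
  rw [wordT, ← MonoidAlgebra.one_def, map_one]

theorem hom_ext_wordT {M : Type*} [AddCommGroup M] [Module K M]
    {f g : TensorAlgebra K (Prim K) →ₗ[K] M} (h : ∀ P, f (wordT K P) = g (wordT K P)) : f = g := by
  have : f ∘ₗ (toT K).toLinearMap = g ∘ₗ (toT K).toLinearMap := HWNP.hom_ext h
  ext w
  simpa [toT_fromT] using LinearMap.congr_fun this (fromT K w)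

open WithConv

theorem convMul_wordT (f g : WithConv (TensorAlgebra K (Prim K) →ₗ[K] HStar K)) (P : WNP) :
    (f * g) (wordT K P) = ∑ p ∈ (finite_factorizations P).toFinset,
      f (wordT K p.1) * g (wordT K p.2) := by
  rw [LinearMap.convMul_apply, comul_eq, wordT, deconc_toT, comulWNP_single]
  simp only [map_sum, TensorProduct.map_tmul, LinearMap.mul'_apply]
  rfl

/-- `fromT` as an element of the convolution algebra. -/
noncomputable def convFromT (K : Type*) [Field K] :
    WithConv (TensorAlgebra K (Prim K) →ₗ[K] HStar K) :=
  toConv (show TensorAlgebra K (Prim K) →ₗ[K] HStar K from (fromT K).toLinearMap)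

/-- The operator `1 - convFromT K` kills the empty poset, so its `k`-th convolution power only sees
factorizations into `k` nonempty posets. The geometric series for the inverse is therefore locally
finite. -/
theorem pow_wordT (P : WNP) (k : ℕ) (h : P.card < k) :
    ((1 - convFromT K) ^ k) (wordT K P) = 0 := by
  induction k generalizing P with
  | zero => omega
  | succ k ih =>
    rw [pow_succ', convMul_wordT]
    refine Finset.sum_eq_zero fun p hp => ?_
    rw [Set.Finite.mem_toFinset, Set.mem_ofPred_eq] at hp
    by_cases h1 : p.1 = 1
    · have : (1 - convFromT K) (wordT K p.1) = 0 := by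
        have h2 : convFromT K 1 = 1 := map_one (fromT K)
        rw [h1, wordT_one]
        change (1 : WithConv (TensorAlgebra K (Prim K) →ₗ[K] HStar K)) 1 - convFromT K 1 = 0
        rw [LinearMap.convOne_apply, h2, counit_eq, map_one, map_one, sub_self]
      rw [this, zero_mul]
    · have hc := card_mul p.1 p.2
      have h1' := mt card_eq_zero.1 h1
      rw [hp] at hc
      rw [ih p.2 (by omega), mul_zero]

/-- The inverse of `fromT` for the convolution product. -/
noncomputable def antipodeT (K : Type*) [Field K] :
    WithConv (TensorAlgebra K (Prim K) →ₗ[K] HStar K) :=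
  toConv ((MonoidAlgebra.basis WNP K).constr K (fun P =>
    (∑ k ∈ Finset.range (P.card + 1), (1 - convFromT K) ^ k) (wordT K P)) ∘ₗ
      (fromT K).toLinearMap)

theorem conv_sum_apply (n : ℕ) (f : ℕ → WithConv (TensorAlgebra K (Prim K) →ₗ[K] HStar K))
    (w : TensorAlgebra K (Prim K)) :
    (∑ k ∈ Finset.range n, f k) w = ∑ k ∈ Finset.range n, f k w := by
  induction n with
  | zero => rfl
  | succ n ih => rw [Finset.sum_range_succ, Finset.sum_range_succ, ← ih]; rfl

theorem antipodeT_wordT (P : WNP) (n : ℕ) (h : P.card < n) :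
    antipodeT K (wordT K P) = (∑ k ∈ Finset.range n, (1 - convFromT K) ^ k) (wordT K P) := by
  have : antipodeT K (wordT K P) =
      (∑ k ∈ Finset.range (P.card + 1), (1 - convFromT K) ^ k) (wordT K P) := by
    change (MonoidAlgebra.basis WNP K).constr K _ (fromT K (toT K (MonoidAlgebra.single P 1))) = _
    rw [fromT_toT, ← MonoidAlgebra.basis_apply, Module.Basis.constr_basis]
  rw [this, conv_sum_apply, conv_sum_apply]
  refine Finset.sum_subset (fun k hk => ?_) fun k _ hk' => ?_
  · rw [Finset.mem_range] at *; omega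
  · rw [Finset.mem_range] at *
    exact pow_wordT P k (by omega)

theorem conv_hom_ext_wordT {f g : WithConv (TensorAlgebra K (Prim K) →ₗ[K] HStar K)}
    (h : ∀ P, f (wordT K P) = g (wordT K P)) : f = g :=
  ofConv_injective (hom_ext_wordT h)

theorem antipodeT_mul : antipodeT K * convFromT K = 1 := by
  refine conv_hom_ext_wordT fun P => ?_
  -- One truncation is long enough for all the factors of `P`, so the finite geometric sum can
  -- replace the antipode in every term.
  have h := geom_sum_mul_neg (1 - convFromT K) (P.card + 1)
  rw [sub_sub_cancel] at h
  have h' := congrArg (fun f => f (wordT K P)) h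
  have h2 : (1 - (1 - convFromT K) ^ (P.card + 1)) (wordT K P) =
      (1 : WithConv (TensorAlgebra K (Prim K) →ₗ[K] HStar K)) (wordT K P) -
        ((1 - convFromT K) ^ (P.card + 1)) (wordT K P) := rfl
  rw [pow_wordT P _ (Nat.lt_succ_self _), sub_zero] at h2
  rw [← h2, ← h', convMul_wordT, convMul_wordT]
  refine Finset.sum_congr rfl fun p hp => ?_
  rw [Set.Finite.mem_toFinset, Set.mem_ofPred_eq] at hp
  rw [antipodeT_wordT p.1 (P.card + 1) (by rw [← hp, card_mul]; omega)]

theorem mul_antipodeT : convFromT K * antipodeT K = 1 := by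
  refine conv_hom_ext_wordT fun P => ?_
  have h := mul_neg_geom_sum (1 - convFromT K) (P.card + 1)
  rw [sub_sub_cancel] at h
  have h' := congrArg (fun f => f (wordT K P)) h
  have h2 : (1 - (1 - convFromT K) ^ (P.card + 1)) (wordT K P) =
      (1 : WithConv (TensorAlgebra K (Prim K) →ₗ[K] HStar K)) (wordT K P) -
        ((1 - convFromT K) ^ (P.card + 1)) (wordT K P) := rfl
  rw [pow_wordT P _ (Nat.lt_succ_self _), sub_zero] at h2
  rw [← h2, ← h', convMul_wordT, convMul_wordT]
  refine Finset.sum_congr rfl fun p hp => ?_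
  rw [Set.Finite.mem_toFinset, Set.mem_ofPred_eq] at hp
  rw [antipodeT_wordT p.2 (P.card + 1) (by rw [← hp, card_mul]; omega)]

/-- Transports a convolution identity with values in `(H_WNP, ⋆)` to `T(Prim)`; both antipode axioms
are instances. -/
theorem toT_convMul (f g : TensorAlgebra K (Prim K) →ₗ[K] TensorAlgebra K (Prim K))
    (F G : WithConv (TensorAlgebra K (Prim K) →ₗ[K] HStar K))
    (hF : ∀ w, F w = fromT K (f w)) (hG : ∀ w, G w = fromT K (g w)) (h : F * G = 1)
    (w : TensorAlgebra K (Prim K)) :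
    starTc K (TensorProduct.map f g (Coalgebra.comul (R := K) w)) =
      algebraMap K _ (Coalgebra.counit (R := K) w) := by
  have h1 : (F * G) w = fromT K (starTc K (TensorProduct.map f g (Coalgebra.comul (R := K) w))) := by
    rw [LinearMap.convMul_apply]
    induction Coalgebra.comul (R := K) w with
    | zero => simp only [map_zero]; rfl
    | add s t hs ht => simp only [map_add, hs, ht]; rfl
    | tmul a b =>
      rw [TensorProduct.map_tmul, TensorProduct.map_tmul, starTc_tmul, fromT_toT, ← hF, ← hG]
      rfl
  rw [h, LinearMap.convOne_apply] at h1
  rw [← toT_fromT (starTc K _), ← h1]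
  have h2 : (algebraMap K (HStar K) (Coalgebra.counit (R := K) w) : HWNP K) =
      Coalgebra.counit (R := K) w • (1 : HWNP K) := rfl
  refine (congrArg (toT K) h2).trans ?_
  rw [map_smul, map_one, Algebra.algebraMap_eq_smul_one]

theorem isHopfProduct_starTc : IsHopfProduct (starTc K) where
  one_star x := by rw [starTc_tmul, map_one, one_starProd, toT_fromT]
  star_one x := by rw [starTc_tmul, map_one, starProd_one, toT_fromT]
  star_assoc x y z := by simp only [starTc_tmul, fromT_toT, starProd_assoc]
  exists_antipode := by
    refine ⟨(toT K).toLinearMap ∘ₗ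
      (show TensorAlgebra K (Prim K) →ₗ[K] HWNP K from (antipodeT K).ofConv), fun x => ⟨?_, ?_⟩⟩
    · exact toT_convMul _ LinearMap.id (antipodeT K) (convFromT K)
        (fun w => (fromT_toT _).symm) (fun w => rfl) antipodeT_mul x
    · exact toT_convMul LinearMap.id _ (convFromT K) (antipodeT K)
        (fun w => rfl) (fun w => (fromT_toT _).symm) mul_antipodeT x

theorem primMul_tprod (n : ℕ) (x : Fin n → Prim K) :
    primMul K n (PiTensorProduct.tprod K x) = fromT K (TensorAlgebra.tprod K _ n x) := by
  rw [primMul, PiTensorProduct.lift.tprod, TensorAlgebra.tprod_apply, map_list_prod, List.map_ofFn]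
  simp [Function.comp_def]

theorem primBrackets_tprod (m n : ℕ+) (x : Fin m → Prim K) (y : Fin n → Prim K) :
    primBrackets K m n (PiTensorProduct.tprod K x ⊗ₜ PiTensorProduct.tprod K y) =
      primProj K (starProd K (fromT K (TensorAlgebra.tprod K _ m x))
        (fromT K (TensorAlgebra.tprod K _ n y))) := by
  rw [← primMul_tprod, ← primMul_tprod]
  rfl

theorem ιInv_starTc (m n : ℕ+) (x : Fin m → Prim K) (y : Fin n → Prim K) :
    TensorAlgebra.ιInv (starTc K (TensorAlgebra.tprod K (Prim K) m x ⊗ₜ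
      TensorAlgebra.tprod K (Prim K) n y)) =
      primBrackets K m n (PiTensorProduct.tprod K x ⊗ₜ PiTensorProduct.tprod K y) := by
  rw [primBrackets_tprod, starTc_tmul, ← primProj_fromT, fromT_toT]

theorem isBInfty_primBrackets : IsBInfty (primBrackets K) :=
  ⟨starTc K, isHopfProduct_starTc, ιInv_starTc⟩

end BInf

/-! ### Triangularity of `⋆` and generation by the point. -/

namespace BInf

open WNP

namespace WNP

theorem hConnected_stack {Q R : WNP} (hQ : Q ≠ 1) (hR : R ≠ 1) : (stack Q R).HConnected := by
  obtain ⟨P, hP, A, hPA, rfl, rfl, hA⟩ := exists_sub_eq_stack Q R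
  obtain ⟨a, ha⟩ : A.Nonempty := Set.nonempty_iff_ne_empty.2 (mt sub_eq_one.2 hQ)
  obtain ⟨b, hb⟩ : Aᶜ.Nonempty := Set.nonempty_iff_ne_empty.2 (mt sub_eq_one.2 hR)
  rw [← hPA]
  refine (rep_mk P hP).symm.hConnected ⟨⟨a⟩, fun x y => ?_⟩
  by_cases hx : x ∈ A <;> by_cases hy : y ∈ A
  · exact .tail (.single (.inl (hA x hx b hb))) (.inr (hA y hy b hb))
  · exact .single (.inl (hA x hx y hy))
  · exact .single (.inr (hA y hy x hx))
  · exact .tail (.single (.inr (hA a ha x hx))) (.inl (hA a ha y hy))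

theorem hrel_lt_mul_left {Q R : WNP} (hR : R ≠ 1) : hrel Q < hrel (Q * R) := by
  have := hrel_pos hR
  rw [hrel_mul]; omega

theorem hrel_lt_mul_right {Q R : WNP} (hQ : Q ≠ 1) : hrel R < hrel (Q * R) := by
  have := hrel_pos hQ
  rw [hrel_mul]; omega

theorem hrel_lt_stack_left {Q R : WNP} (hR : R ≠ 1) : hrel Q < hrel (stack Q R) := by
  have := hrel_pos hR
  rw [hrel_stack]; omega

theorem hrel_lt_stack_right {Q R : WNP} (hQ : Q ≠ 1) : hrel R < hrel (stack Q R) := by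
  have := hrel_pos hQ
  rw [hrel_stack]; omega

/-- An empty upper part would make `P` both `h`-connected and `r`-connected, hence the point. -/
theorem exists_stack {P : WNP} (h1 : P ≠ 1) (hp : P ≠ point) (h : P.HConnected) :
    ∃ p : WNP × WNP, p.1.RConnected ∧ p.2 ≠ 1 ∧ P = stack p.1 p.2 := by
  obtain ⟨Q, R, hQ, rfl⟩ := exists_rConnected_stack h1
  refine ⟨(Q, R), hQ, ?_, rfl⟩
  rintro rfl
  rw [stack_one] at h hp
  exact hp (eq_point_of_connected h hQ)

theorem exists_mul {P : WNP} (h1 : P ≠ 1) (h : ¬ P.HConnected) :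
    ∃ p : WNP × WNP, p.1.HConnected ∧ p.2 ≠ 1 ∧ P = p.1 * p.2 := by
  obtain ⟨Q, R, hQ, rfl⟩ := exists_hConnected_mul h1
  refine ⟨(Q, R), hQ, ?_, rfl⟩
  rintro rfl
  rw [mul_one] at h
  exact h hQ

end WNP

variable {K : Type*} [Field K]

-- The expansion is unitriangular for `hrel`, with leading term the stack, so `stack` can be
-- replaced by `⋆` in inductions.
open Classical in
theorem starProd_single_eq (Q R : WNP) :
    starProd K (MonoidAlgebra.single Q 1) (MonoidAlgebra.single R 1) =
      MonoidAlgebra.single (stack Q R) 1 + ∑ S ∈ (finite_numIdeals Q R).toFinset,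
        if hrel S < hrel (stack Q R) then (numIdeals Q R S : K) • MonoidAlgebra.single S 1 else 0 := by
  have h : ∀ S ∈ (finite_numIdeals Q R).toFinset,
      (numIdeals Q R S : K) • (MonoidAlgebra.single S 1 : HWNP K) =
      (if S = stack Q R then MonoidAlgebra.single S 1 else 0) +
        if hrel S < hrel (stack Q R) then
          (numIdeals Q R S : K) • (MonoidAlgebra.single S 1 : HWNP K) else 0 := by
    intro S hS
    rw [Set.Finite.mem_toFinset, Set.mem_ofPred_eq] at hS
    rcases eq_stack_or_hrel_lt hS with rfl | h
    · rw [if_pos rfl, if_neg (lt_irrefl _), numIdeals_stack, Nat.cast_one, one_smul, add_zero]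
    · rw [if_neg fun h' => h.ne (congrArg hrel h'), if_pos h, zero_add]
  rw [starProd_single, Finset.sum_congr rfl h, Finset.sum_add_distrib, Finset.sum_ite_eq', if_pos]
  rw [Set.Finite.mem_toFinset, Set.mem_ofPred_eq, numIdeals_stack]
  exact one_ne_zero

/-- `H_WNP` is generated by the one-point poset for its two products. -/
theorem HWNP.generation {C : HWNP K → Prop} (one : C 1) (point : C (MonoidAlgebra.single point 1))
    (add : ∀ x y, C x → C y → C (x + y)) (smul : ∀ (r : K) x, C x → C (r • x))
    (mul : ∀ x y, C x → C y → C (x * y)) (star : ∀ x y, C x → C y → C (starProd K x y))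
    (x : HWNP K) : C x := by
  classical
  have zero : C 0 := by simpa using smul 0 1 one
  induction x using HWNP.induction with
  | zero => exact zero
  | add x y hx hy => exact add x y hx hy
  | smul r x hx => exact smul r x hx
  | single P =>
    induction hn : hrel P using Nat.strong_induction_on generalizing P with
    | _ n ih =>
      subst hn
      by_cases h1 : P = 1
      · subst h1; exact one
      by_cases hp : P = WNP.point
      · subst hp; exact point
      by_cases h : P.HConnected
      · obtain ⟨⟨Q, R⟩, hQ, hR, rfl⟩ := exists_stack h1 hp h
        have hQ1 := ne_one_of_rConnected hQ
        -- An `h`-connected poset is the product `Q ⋆ R` of smaller posets, corrected by terms with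
        -- fewer relations.
        rw [eq_sub_of_add_eq (starProd_single_eq (K := K) Q R).symm, sub_eq_add_neg, ← neg_one_smul K]
        refine add _ _ (star _ _ (ih _ (hrel_lt_stack_left hR) Q rfl)
          (ih _ (hrel_lt_stack_right hQ1) R rfl)) (smul _ _ ?_)
        refine Finset.sum_induction _ C add zero fun S _ => ?_
        split_ifs with hlt
        · exact smul _ _ (ih _ hlt S rfl)
        · exact zero
      · obtain ⟨⟨Q, R⟩, hQ, hR, rfl⟩ := exists_mul h1 h
        have := mul _ _ (ih _ (hrel_lt_mul_left hR) Q rfl)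
          (ih _ (hrel_lt_mul_right (ne_one_of_hConnected hQ)) R rfl)
        rwa [MonoidAlgebra.single_mul_single, one_mul] at this

/-! ### Recursive construction of morphisms for two products. -/

section Free

variable {A : Type*} [Ring A] [Algebra K A] (s : A →ₗ[K] A →ₗ[K] A) (x : A)

open Classical in
/-- The values on posets of the morphism from `H_WNP` to an algebra with a second product `s` that
sends the one-point poset to `x`. -/
noncomputable def freeMap (P : WNP) : A :=
  if h1 : P = 1 then 1
  else if hp : P = point then x
  else if h : P.HConnected then
    -- This value is forced by applying the desired morphism to the triangular expansion of `Q ⋆ R`.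
    s (freeMap (exists_stack h1 hp h).choose.1) (freeMap (exists_stack h1 hp h).choose.2) -
      ∑ S ∈ (finite_numIdeals (exists_stack h1 hp h).choose.1
          (exists_stack h1 hp h).choose.2).toFinset,
        -- The condition removes the leading term `P` and makes the recursion terminate.
        if _hlt : hrel S < hrel P then (numIdeals (exists_stack h1 hp h).choose.1
          (exists_stack h1 hp h).choose.2 S : K) • freeMap S else 0
  else freeMap (exists_mul h1 h).choose.1 * freeMap (exists_mul h1 h).choose.2
termination_by hrel P
decreasing_by
  · have hQ := (exists_stack h1 hp h).choose_spec
    exact (hrel_lt_stack_left hQ.2.1).trans_eq (congrArg hrel hQ.2.2.symm)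
  · have hQ := (exists_stack h1 hp h).choose_spec
    exact (hrel_lt_stack_right (ne_one_of_rConnected hQ.1)).trans_eq (congrArg hrel hQ.2.2.symm)
  · assumption
  · have hQ := (exists_mul h1 h).choose_spec
    exact (hrel_lt_mul_left hQ.2.1).trans_eq (congrArg hrel hQ.2.2.symm)
  · have hQ := (exists_mul h1 h).choose_spec
    exact (hrel_lt_mul_right (ne_one_of_hConnected hQ.1)).trans_eq (congrArg hrel hQ.2.2.symm)

theorem freeMap_one : freeMap s x 1 = 1 := by
  rw [freeMap, dif_pos rfl]

theorem freeMap_point : freeMap s x point = x := by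
  rw [freeMap, dif_neg (ne_one_of_hConnected point_hConnected), dif_pos rfl]

/-- By uniqueness of the first `h`-connected factor, the factorization chosen in the recursion is
`(Q, R)`. -/
theorem freeMap_mul_of_hConnected {Q : WNP} (hQ : Q.HConnected) (R : WNP) :
    freeMap s x (Q * R) = freeMap s x Q * freeMap s x R := by
  by_cases hR : R = 1
  · rw [hR, freeMap_one, mul_one, mul_one]
  have hQ1 := ne_one_of_hConnected hQ
  have h : ¬ (Q * R).HConnected := fun h => by
    rcases (mul_eq_iff_of_hConnected h).1 rfl with h | h
    · exact hR h.2
    · exact hQ1 h.1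
  have h1 : Q * R ≠ 1 := fun h => hQ1 (mul_eq_one.1 h).1
  have hp : Q * R ≠ point := fun h' => h (h' ▸ point_hConnected)
  obtain ⟨hQ', hR', he⟩ := (exists_mul h1 h).choose_spec
  obtain ⟨e1, e2⟩ := hConnected_mul_inj hQ hQ' he
  have e : (exists_mul h1 h).choose = (Q, R) := Prod.ext e1.symm e2.symm
  rw [freeMap, dif_neg h1, dif_neg hp, dif_neg h, e]

open Classical in
theorem freeMap_stack {Q R : WNP} (hQ : Q.RConnected) (hR : R ≠ 1) :
    freeMap s x (stack Q R) = s (freeMap s x Q) (freeMap s x R) -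
      ∑ S ∈ (finite_numIdeals Q R).toFinset,
        if hrel S < hrel (stack Q R) then (numIdeals Q R S : K) • freeMap s x S else 0 := by
  have hQ1 := ne_one_of_rConnected hQ
  have h := hConnected_stack hQ1 hR
  have h1 := ne_one_of_hConnected h
  have hp : stack Q R ≠ point := fun h' => by
    have := congrArg card h'
    rw [card_stack, card_point] at this
    have := mt card_eq_zero.1 hQ1
    have := mt card_eq_zero.1 hR
    omega
  obtain ⟨hQ', hR', he⟩ := (exists_stack h1 hp h).choose_spec
  obtain ⟨e1, e2⟩ := rConnected_stack_inj hQ hQ' he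
  have e : (exists_stack h1 hp h).choose = (Q, R) := Prod.ext e1.symm e2.symm
  rw [freeMap, dif_neg h1, dif_neg hp, dif_pos h]
  simp only [e, dite_eq_ite]

/-- The linear extension of `freeMap`. -/
noncomputable def freeHom : HWNP K →ₗ[K] A := (MonoidAlgebra.basis WNP K).constr K (freeMap s x)

@[simp] theorem freeHom_single (P : WNP) :
    freeHom s x (MonoidAlgebra.single P 1) = freeMap s x P := by
  rw [freeHom, ← MonoidAlgebra.basis_apply, Module.Basis.constr_basis]

theorem freeHom_one : freeHom s x 1 = 1 := by
  rw [MonoidAlgebra.one_def, freeHom_single, freeMap_one]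

theorem freeMap_mul (P Q : WNP) : freeMap s x (P * Q) = freeMap s x P * freeMap s x Q := by
  induction hn : P.card using Nat.strong_induction_on generalizing P with
  | _ n ih =>
    by_cases h1 : P = 1
    · rw [h1, freeMap_one, one_mul, one_mul]
    · obtain ⟨P, R, hP, rfl⟩ := exists_hConnected_mul h1
      have hP' := mt card_eq_zero.1 (ne_one_of_hConnected hP)
      rw [mul_assoc, freeMap_mul_of_hConnected s x hP, freeMap_mul_of_hConnected s x hP,
        ih R.card (by rw [← hn, card_mul]; omega) R rfl, mul_assoc]

theorem freeHom_mul (y z : HWNP K) : freeHom s x (y * z) = freeHom s x y * freeHom s x z := by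
  induction y using HWNP.induction with
  | zero => simp
  | add y y' hy hy' => simp only [add_mul, map_add, hy, hy']
  | smul r y hy => simp only [smul_mul_assoc, map_smul, hy]
  | single P =>
    induction z using HWNP.induction with
    | zero => simp
    | add y y' hy hy' => simp only [mul_add, map_add, hy, hy']
    | smul r y hy => simp only [mul_smul_comm, map_smul, hy]
    | single Q =>
      rw [MonoidAlgebra.single_mul_single, one_mul, freeHom_single, freeHom_single, freeHom_single,
        freeMap_mul]

/-- For an `r`-connected left factor the recursion is exactly this identity on the basis; only the
unit law of `s` is needed, for `z = 1`. -/
theorem freeHom_starProd_of_rConnected (hs1 : ∀ a, s a 1 = a) {Q : WNP} (hQ : Q.RConnected) (z : HWNP K) :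
    freeHom s x (starProd K (MonoidAlgebra.single Q 1) z) =
      s (freeMap s x Q) (freeHom s x z) := by
  classical
  induction z using HWNP.induction with
  | zero => simp
  | add y y' hy hy' => simp only [map_add, hy, hy']
  | smul r y hy => simp only [map_smul, hy]
  | single R =>
    by_cases hR : R = 1
    · rw [hR, ← MonoidAlgebra.one_def, starProd_one, freeHom_one, hs1, freeHom_single]
    · rw [starProd_single_eq, map_add, freeHom_single, freeHom_single, freeMap_stack s x hQ hR,
        map_sum]
      simp only [apply_ite (freeHom s x), map_smul, freeHom_single, map_zero, sub_add_cancel]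

/-- The left factor is written as `Q ⋆ R` with `Q` `r`-connected, minus terms with fewer relations.
Associativity of both products moves `Q` outside, and induction on `hrel` treats `R` and the
corrections. -/
theorem freeHom_starProd (hassoc : ∀ a b c, s (s a b) c = s a (s b c)) (h1s : ∀ a, s 1 a = a)
    (hs1 : ∀ a, s a 1 = a) (y z : HWNP K) :
    freeHom s x (starProd K y z) = s (freeHom s x y) (freeHom s x z) := by
  classical
  induction y using HWNP.induction with
  | zero => simp
  | add y y' hy hy' => simp only [map_add, LinearMap.add_apply, hy, hy']
  | smul r y hy => simp only [map_smul, LinearMap.smul_apply, hy]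
  | single P =>
    induction hn : hrel P using Nat.strong_induction_on generalizing P z with
    | _ n ih =>
      subst hn
      by_cases h1 : P = 1
      · rw [h1, ← MonoidAlgebra.one_def, one_starProd, freeHom_one, h1s]
      obtain ⟨Q, R, hQ, rfl⟩ := exists_rConnected_stack h1
      by_cases hR : R = 1
      · rw [hR, stack_one, freeHom_starProd_of_rConnected s x hs1 hQ, freeHom_single]
      have hP := eq_sub_of_add_eq (starProd_single_eq (K := K) Q R).symm
      have hsum : freeHom s x (starProd K (∑ S ∈ (finite_numIdeals Q R).toFinset,
          if hrel S < hrel (stack Q R) then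
            (numIdeals Q R S : K) • MonoidAlgebra.single S 1 else 0) z) =
          s (freeHom s x (∑ S ∈ (finite_numIdeals Q R).toFinset,
          if hrel S < hrel (stack Q R) then
            (numIdeals Q R S : K) • MonoidAlgebra.single S 1 else 0)) (freeHom s x z) := by
        simp only [map_sum, LinearMap.sum_apply]
        refine Finset.sum_congr rfl fun S _ => ?_
        split_ifs with hlt
        · simp only [map_smul, LinearMap.smul_apply]
          rw [ih _ hlt z S rfl]
        · simp
      rw [hP]
      simp only [map_sub, LinearMap.sub_apply]
      rw [hsum, starProd_assoc, freeHom_starProd_of_rConnected s x hs1 hQ,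
        ih _ (hrel_lt_stack_right (ne_one_of_rConnected hQ)) z R rfl,
        freeHom_starProd_of_rConnected s x hs1 hQ, hassoc]

end Free

end BInf

/-! ### The universal property. -/

namespace BInf

open WNP

variable {K : Type*} [Field K]

theorem comulWNP_mul (x y : HWNP K) :
    comulWNP K (x * y) = (x ⊗ₜ 1) * comulWNP K y + comulWNP K x * (1 ⊗ₜ y) - x ⊗ₜ y := by
  have h : ∀ w, comulWNP K (fromT K w) =
      Algebra.TensorProduct.map (fromT K) (fromT K) (deconc K _ w) := comulWNP_fromT
  rw [← fromT_toT x, ← fromT_toT y, ← map_mul, h, h, h, deconc_mul]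
  simp only [map_sub, map_add, map_mul, Algebra.TensorProduct.map_tmul, map_one]

theorem map_map_starProd {B : Type*} [AddCommGroup B] [Module K B]
    (star : TensorAlgebra K B ⊗[K] TensorAlgebra K B →ₗ[K] TensorAlgebra K B)
    (f : HWNP K →ₗ[K] TensorAlgebra K B)
    (hf : ∀ x y, f (starProd K x y) = star (f x ⊗ₜ f y)) (s t : HWNP K ⊗[K] HWNP K) :
    TensorProduct.map f f
      (TensorProduct.map (TensorProduct.lift (starProd K)) (TensorProduct.lift (starProd K))
        (TensorProduct.tensorTensorTensorComm K _ _ _ _ (s ⊗ₜ t))) =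
    TensorProduct.map star star
      (TensorProduct.tensorTensorTensorComm K _ _ _ _
        (TensorProduct.map f f s ⊗ₜ TensorProduct.map f f t)) := by
  induction s with
  | zero => simp
  | add s s' h h' => simp only [TensorProduct.add_tmul, map_add, h, h']
  | tmul x x' =>
    induction t with
    | zero => simp
    | add s s' h h' => simp only [TensorProduct.tmul_add, map_add, h, h']
    | tmul y y' => simp [hf]

theorem deconc_star {B : Type*} [AddCommGroup B] [Module K B]
    (star : TensorAlgebra K B ⊗[K] TensorAlgebra K B →ₗc[K] TensorAlgebra K B)
    (a b : TensorAlgebra K B) :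
    deconc K B (star (a ⊗ₜ b)) = TensorProduct.map star.toLinearMap star.toLinearMap
      (TensorProduct.tensorTensorTensorComm K _ _ _ _ (deconc K B a ⊗ₜ deconc K B b)) := by
  rw [← comul_eq, ← CoalgHomClass.map_comp_comul_apply, TensorProduct.comul_tmul]
  rfl

theorem deconc_ι {B : Type*} [AddCommGroup B] [Module K B] (b : B) :
    deconc K B (TensorAlgebra.ι K b) = TensorAlgebra.ι K b ⊗ₜ 1 + 1 ⊗ₜ TensorAlgebra.ι K b := by
  have := deconc_ι_mul (K := K) b 1
  simpa [deconc_one] using this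

section UniversalProperty

variable {B : Type*} [AddCommGroup B] [Module K B]

/-- An algebra morphism `H_WNP → T(B)` that respects the products `⋆` and sends the one-point poset
to a letter is a coalgebra morphism. -/
theorem deconc_of_map_starProd
    (star : TensorAlgebra K B ⊗[K] TensorAlgebra K B →ₗc[K] TensorAlgebra K B)
    (f : HWNP K →ₐ[K] TensorAlgebra K B)
    (hf : ∀ x y, f (starProd K x y) = star (f x ⊗ₜ f y)) (b : B)
    (hb : f (MonoidAlgebra.single point 1) = TensorAlgebra.ι K b) (x : HWNP K) :
    deconc K B (f x) = TensorProduct.map f.toLinearMap f.toLinearMap (comulWNP K x) := by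
  -- It suffices to look at the point, which is primitive on both sides, and at the two products,
  -- whose coproduct rules agree.
  induction x using HWNP.generation with
  | one => rw [map_one, deconc_one, comulWNP_one]; simp
  | point =>
    rw [hb, deconc_ι, mem_prim.1 (single_mem_prim K point_hConnected)]
    simp [hb]
  | add x y hx hy => simp only [map_add, hx, hy]
  | smul r x hx => simp only [map_smul, hx]
  | mul x y hx hy =>
    change _ = Algebra.TensorProduct.map f f _ at hx hy
    change _ = Algebra.TensorProduct.map f f _
    rw [map_mul, deconc_mul, comulWNP_mul, hx, hy]
    simp only [map_sub, map_add, map_mul, Algebra.TensorProduct.map_tmul, map_one]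
  | star x y hx hy =>
    rw [hf, deconc_star, comulWNP_starProd, hx, hy]
    exact (map_map_starProd star.toLinearMap f.toLinearMap hf _ _).symm

theorem mapT_tprod {V : Type*} [AddCommGroup V] [Module K V] (φ : V →ₗ[K] B) (n : ℕ)
    (x : Fin n → V) :
    mapT φ (TensorAlgebra.tprod K V n x) = TensorAlgebra.tprod K B n fun i => φ (x i) := by
  rw [TensorAlgebra.tprod_apply, TensorAlgebra.tprod_apply, map_list_prod, List.map_ofFn]
  simp [Function.comp_def]

/-- The recursive morphism to `T(B)` is a coalgebra morphism, so it sends primitive elements to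
letters; its restriction to them is the required map. -/
theorem exists_isBInftyHom (br : Brackets K B) (h : IsBInfty br) (x : B) :
    ∃ φ : Prim K →ₗ[K] B, IsBInftyHom (primBrackets K) br φ ∧ φ (primPoint K) = x := by
  obtain ⟨star, hs, hbr⟩ := h
  let s : TensorAlgebra K B →ₗ[K] TensorAlgebra K B →ₗ[K] TensorAlgebra K B :=
    (TensorProduct.mk K _ _).compr₂ star.toLinearMap
  have hsa : ∀ a b, s a b = star (a ⊗ₜ b) := fun _ _ => rfl
  let f : HWNP K →ₐ[K] TensorAlgebra K B :=
    AlgHom.ofLinearMap (freeHom s (TensorAlgebra.ι K x)) (freeHom_one _ _) (freeHom_mul _ _)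
  have hf : ∀ y z, f (starProd K y z) = star (f y ⊗ₜ f z) :=
    freeHom_starProd s _ hs.star_assoc hs.one_star hs.star_one
  have hp : f (MonoidAlgebra.single point 1) = TensorAlgebra.ι K x :=
    (freeHom_single _ _ _).trans (freeMap_point _ _)
  let φ : Prim K →ₗ[K] B := TensorAlgebra.ιInv ∘ₗ f.toLinearMap ∘ₗ (Prim K).subtype
  have hφ : ∀ p : Prim K, TensorAlgebra.ι K (φ p) = f p := fun p => by
    apply ι_ιInv_of_primitive
    change deconc K B (f p) = f p ⊗ₜ 1 + 1 ⊗ₜ f p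
    rw [deconc_of_map_starProd star f hf x hp, mem_prim.1 p.2]
    simp
  -- Since `f` respects concatenation, it is determined by the letters and equals `T(φ)`.
  have hfm : ∀ w, f (fromT K w) = mapT φ w := fun w => by
    have : f.comp (fromT K) = mapT φ := by
      ext p
      simp [hφ]
    exact DFunLike.congr_fun this w
  refine ⟨φ, fun m n y z => ?_, ?_⟩
  · rw [primBrackets_tprod, ← hbr, ← mapT_tprod, ← mapT_tprod, ← hfm, ← hfm, ← hf]
    generalize starProd K _ _ = t
    rw [← fromT_toT t, primProj_fromT, hfm, ιInv_mapT]
  · change TensorAlgebra.ιInv (f (MonoidAlgebra.single point 1)) = x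
    rw [hp, ιInv_ι]

/-- The maps `T(φ)` and `T(ψ)` respect both products, so they agree on everything generated by the
point, in particular on letters. -/
theorem isBInftyHom_unique (br : Brackets K B) (h : IsBInfty br) {φ ψ : Prim K →ₗ[K] B}
    (hφ : IsBInftyHom (primBrackets K) br φ) (hψ : IsBInftyHom (primBrackets K) br ψ)
    (hp : φ (primPoint K) = ψ (primPoint K)) : φ = ψ := by
  obtain ⟨star, hs, hbr⟩ := h
  have key : ∀ x : HWNP K, mapT φ (toT K x) = mapT ψ (toT K x) := by
    intro x
    induction x using HWNP.generation with
    | one => simp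
    | point =>
      have := toT_prim (primPoint K)
      change toT K (MonoidAlgebra.single point 1) = _ at this
      rw [this, mapT_ι, mapT_ι, hp]
    | add x y hx hy => simp only [map_add, hx, hy]
    | smul r x hx => simp only [map_smul, hx]
    | mul x y hx hy => simp only [map_mul, hx, hy]
    | star x y hx hy =>
      have := starTc_tmul (toT K x) (toT K y)
      rw [fromT_toT, fromT_toT] at this
      rw [← this, hφ.mapT_star isHopfProduct_starTc ιInv_starTc hs hbr,
        hψ.mapT_star isHopfProduct_starTc ιInv_starTc hs hbr, hx, hy]
  ext p
  have := key p
  rw [toT_prim, mapT_ι, mapT_ι] at this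
  exact (TensorAlgebra.ι_inj K _ _).1 this

end UniversalProperty

end BInf

theorem mainTheorem6 (K : Type*) [Field K] :
    BInf.Prim K =
        Submodule.span K {x | ∃ P : BInf.WNP, P.HConnected ∧ x = MonoidAlgebra.single P 1} ∧
      BInf.IsBInfty (BInf.primBrackets K) ∧
      ∀ (B : Type*) [AddCommGroup B] [Module K B] (br : BInf.Brackets K B),
        BInf.IsBInfty br → ∀ x : B,
          ∃! φ : BInf.Prim K →ₗ[K] B,
            BInf.IsBInftyHom (BInf.primBrackets K) br φ ∧ φ (BInf.primPoint K) = x := by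
  refine ⟨BInf.prim_eq_span, BInf.isBInfty_primBrackets, fun B _ _ br h x => ?_⟩
  obtain ⟨φ, hφ, hx⟩ := BInf.exists_isBInftyHom br h x
  exact ⟨φ, ⟨hφ, hx⟩, fun ψ hψ =>
    BInf.isBInftyHom_unique br h hψ.1 hφ (hψ.2.trans hx.symm)⟩
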